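/- **Theorem (Nash-equilibrium verification is in EXPTIME).** *Games.* Let $b\ge 1$. A $b$-bounded concurrent game $\mathbb G$ consists of a finite set $V$ of states with an initial state $v_0\in V$; agents $\Omega=\{1,\dots,k\}$ with finite action sets $A_1,\dots,A_k$; a playing function $P:V\to 2^{\Omega}$ with $|P(v)|\le b$ for all $v$ (the agents in $P(v)$ are active at $v$); a number $\mathbb L\ge 1$ of bits; a transition function which for every $v\in V$ and every $\theta\in\prod_{i\in P(v)}A_i$ gives a probability distribution $\delta(v,\theta,\cdot)$ on $V$; reachability goals $G_1,\dots,G_k\subseteq V$; and a time horizon $F\ge 1$. All probabilities $\delta(v,\theta,v')$ are binary numbers with exactly $\mathbb L$ bits, one before and $\mathbb L-1$ after the point. *Strategies and payoffs.* A strategy of agent $i$ is any function $V^+\to\mathbb D(A_i)$, where $V^+$ is the set of nonempty finite sequences of states and $\mathbb D(A_i)$ is the set of probability distributions on $A_i$. A play starts at $v_0$ and visits exactly $F$ states $v_0,v_1,\dots,v_{F-1}$; after $v_0,\dots,v_j$ (for $j<F-1$) each active agent $i\in P(v_j)$ independently draws an action from $\pi_i(v_0\cdots v_j)$, and $v_{j+1}$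 is drawn from $\delta(v_j,\theta,\cdot)$, where $\theta$ is the tuple of the drawn actions. The payoff $p(\pi,i)$ is the probability that the play visits $G_i$ when the agents follow the profile $\pi=\langle\pi_1,\dots,\pi_k\rangle$. The profile $\pi$ is a Nash equilibrium if for every agent $i$ and every strategy $\pi_i'$ of agent $i$ (with unbounded memory and arbitrary real probabilities allowed), replacing $\pi_i$ by $\pi'_i$ does not increase the payoff of agent $i$. *Transducers.* A probabilistic transducer for agent $i$ has a finite state set $S_i$, an initial state $s_0^i$, a deterministic transition function $\gamma^i:S_i\times V\to S_i$ and an output function $O_i:S_i\times V\to\mathbb D(A_i)$ whose probabilities are again binary numbers of exactly $\mathbb L$ bits. It represents the strategy that after $v_0\cdots v_j$ plays $O_i(s,v_j)$, where $s$ is the state reached from $s_0^i$ by reading $v_0\cdots v_{j-1}$. *Input.* An input is a number $b\ge1$, a $b$-bounded concurrent game $\mathbb G$, and a tuple of probabilistic transducers, one for each agent. It is encoded as a bit string that lists all sets, functions and probabilities by explicit tables, with $b$ and $F$ written in binary and $\mathbb L$ in unary. *Claim.* The Nash-equilibrium verification problem, that is, the language of all encodings of inputs whose strategy profile is a Nash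 equilibrium of $\mathbb G$, belongs to EXPTIME: there are a deterministic Turing machine and a polynomial $p$ such that on every bit string $w$ the machine halts within $2^{p(|w|)}$ steps and decides whether $w$ belongs to the language. -/

import Mathlib

/-! ### Bounded probabilistic concurrent games -/

/-- A `b`-bounded concurrent game system (`b` is the field `bound`). The finite sets of states,
agents and actions are initial segments `Fin n` of the natural numbers, as in any encoding of a
game. Every probability is a binary number of exactly `precision` bits, one bit before and
`precision - 1` bits after the point; `trans v θ v'` is the integer with these bits, so that the
transition probability is `trans v θ v' / 2 ^ (precision - 1)`. -/
structure ConcurrentGame where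
  /-- the bound on the number of agents that act concurrently -/
  bound : ℕ
  one_le_bound : 1 ≤ bound
  /-- the number of states -/
  numStates : ℕ
  /-- the initial state -/
  init : Fin numStates
  /-- the number of agents -/
  numAgents : ℕ
  /-- the sizes of the action sets -/
  numActions : Fin numAgents → ℕ
  /-- the playing function: the agents that are active at a state -/
  playing : Fin numStates → Finset (Fin numAgents)
  card_playing_le : ∀ v, (playing v).card ≤ bound
  /-- the number of bits of each probability -/
  precision : ℕ
  one_le_precision : 1 ≤ precision
  /-- the transition function; it reads the actions of the active agents only -/
  trans : (v : Fin numStates) → ((i : {i // i ∈ playing v}) → Fin (numActions i)) →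
    Fin numStates → ℕ
  sum_trans : ∀ v θ, ∑ v', trans v θ v' = 2 ^ (precision - 1)
  /-- the reachability goals -/
  goal : Fin numAgents → Finset (Fin numStates)
  /-- the time horizon: the number of states that a play visits -/
  horizon : ℕ
  one_le_horizon : 1 ≤ horizon

namespace ConcurrentGame

/-- The states of a game. -/
abbrev State (G : ConcurrentGame) : Type := Fin G.numStates

/-- The agents of a game. -/
abbrev Agent (G : ConcurrentGame) : Type := Fin G.numAgents

/-- The actions of an agent. -/
abbrev Action (G : ConcurrentGame) (i : G.Agent) : Type := Fin (G.numActions i)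

/-- The joint actions of the agents that are active at `v`. -/
abbrev JointAction (G : ConcurrentGame) (v : G.State) : Type :=
  (i : {i // i ∈ G.playing v}) → G.Action i

/-- The nonempty finite sequences of states. -/
abbrev History (G : ConcurrentGame) : Type := {h : List G.State // h ≠ []}

/-- A strategy maps every nonempty sequence of states to a distribution over the actions. Its
values at sequences that end in a state where the agent is not active play no role. -/
abbrev Strategy (G : ConcurrentGame) (i : G.Agent) : Type :=
  G.History → stdSimplex ℝ (G.Action i)

/-- The probability that the joint action `θ` leads from `v` to `v'`. -/
noncomputable def transProb (G : ConcurrentGame) (v : G.State) (θ : G.JointAction v)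
    (v' : G.State) : ℝ :=
  (G.trans v θ v' : ℝ) / 2 ^ (G.precision - 1)

/-- The position in a play at which the `j`-th joint action is chosen. -/
def before (G : ConcurrentGame) (j : Fin (G.horizon - 1)) : Fin G.horizon :=
  ⟨j, by omega⟩

/-- The position in a play that is reached by the `j`-th joint action. -/
def after (G : ConcurrentGame) (j : Fin (G.horizon - 1)) : Fin G.horizon :=
  ⟨j + 1, by omega⟩

/-- A play: the `horizon` states that are visited, with the `horizon - 1` joint actions chosen
between them. -/
abbrev Play (G : ConcurrentGame) : Type :=
  Σ s : Fin G.horizon → G.State, (j : Fin (G.horizon - 1)) → G.JointAction (s (G.before j))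

/-- The states visited up to and including position `j`. -/
def historyAt (G : ConcurrentGame) (s : Fin G.horizon → G.State) (j : Fin G.horizon) :
    G.History :=
  ⟨(List.ofFn s).take (j + 1), by
    have := j.2
    intro h
    have h' := congrArg List.length h
    simp only [List.length_take, List.length_ofFn, List.length_nil] at h'
    omega⟩

/-- The probability that the play `t` is sampled when all agents follow `π`. -/
noncomputable def playProb (G : ConcurrentGame) (π : (i : G.Agent) → G.Strategy i)
    (t : G.Play) : ℝ :=
  (if t.1 ⟨0, G.one_le_horizon⟩ = G.init then 1 else 0) *
    ∏ j : Fin (G.horizon - 1),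
      (∏ i : {i // i ∈ G.playing (t.1 (G.before j))},
        (π i (G.historyAt t.1 (G.before j))).1 (t.2 j i)) *
      G.transProb (t.1 (G.before j)) (t.2 j) (t.1 (G.after j))

/-- The expected payoff of agent `i`: a play pays `1` if it visits the goal of `i`, else `0`. -/
noncomputable def payoff (G : ConcurrentGame) (π : (i : G.Agent) → G.Strategy i)
    (i : G.Agent) : ℝ :=
  ∑ t : G.Play, G.playProb π t * (if ∃ j, t.1 j ∈ G.goal i then 1 else 0)

/-- No agent has a profitable deviation to any strategy whatsoever. -/
def IsNash (G : ConcurrentGame) (π : (i : G.Agent) → G.Strategy i) : Prop :=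
  ∀ (i : G.Agent) (σ : G.Strategy i), G.payoff (Function.update π i σ) i ≤ G.payoff π i

/-- A probabilistic transducer for agent `i`, with a deterministic transition function and a
probabilistic output function. As in the game, `out s v a` is the integer whose `precision` bits
are those of the probability of `a`. -/
structure Transducer (G : ConcurrentGame) (i : G.Agent) where
  /-- the number of states of the transducer -/
  numStates : ℕ
  /-- the initial state -/
  init : Fin numStates
  /-- the transition function -/
  next : Fin numStates → G.State → Fin numStates
  /-- the output function -/
  out : Fin numStates → G.State → G.Action i → ℕ
  sum_out : ∀ s v, ∑ a, out s v a = 2 ^ (G.precision - 1)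

/-- The output of a transducer as a probability distribution. -/
noncomputable def Transducer.outDist {G : ConcurrentGame} {i : G.Agent} (T : G.Transducer i)
    (s : Fin T.numStates) (v : G.State) : stdSimplex ℝ (G.Action i) :=
  ⟨fun a => (T.out s v a : ℝ) / 2 ^ (G.precision - 1), fun a => by positivity, by
    rw [← Finset.sum_div, ← Nat.cast_sum, T.sum_out]
    simp⟩

/-- The strategy represented by a transducer: after `v₀ ⋯ vₙ` it outputs the distribution
attached to `vₙ` and to the transducer state reached by reading `v₀ ⋯ vₙ₋₁`. -/
noncomputable def Transducer.strategy {G : ConcurrentGame} {i : G.Agent} (T : G.Transducer i) :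
    G.Strategy i :=
  fun h => T.outDist (h.1.dropLast.foldl T.next T.init) (h.1.getLast h.2)

/-! ### Binary encoding of the input -/

/-- A number in unary, self-delimiting. -/
def encodeUnary (n : ℕ) : List Bool := List.replicate n true ++ [false]

/-- A number in binary (least significant bit first), preceded by its length in unary. -/
def encodeBinary (n : ℕ) : List Bool := encodeUnary n.bits.length ++ n.bits

/-- The `l` lowest bits of a number, least significant bit first. -/
def encodeBits (l n : ℕ) : List Bool := (List.range l).map n.testBit

/-- The enumeration of the joint actions at `v` in mixed radix, with the active agents in
increasing order. -/
def jointActionEquiv (G : ConcurrentGame) (v : G.State) :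
    Fin (∏ j, G.numActions ((G.playing v).orderIsoOfFin rfl j)) ≃ G.JointAction v :=
  finPiFinEquiv.symm.trans
    (Equiv.piCongrLeft (fun i : {i // i ∈ G.playing v} => G.Action i)
      ((G.playing v).orderIsoOfFin rfl).toEquiv)

/-- The encoding of a game by explicit tables. The bound and the time horizon are written in
binary, the number of bits of the probabilities in unary. -/
def encode (G : ConcurrentGame) : List Bool :=
  encodeBinary G.bound ++
  encodeUnary G.numStates ++
  encodeUnary G.init ++
  encodeUnary G.numAgents ++
  (List.finRange G.numAgents).flatMap (fun i => encodeUnary (G.numActions i)) ++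
  (List.finRange G.numStates).flatMap (fun v =>
    (List.finRange G.numAgents).map fun i => decide (i ∈ G.playing v)) ++
  encodeUnary G.precision ++
  (List.finRange G.numStates).flatMap (fun v =>
    (List.finRange (∏ j, G.numActions ((G.playing v).orderIsoOfFin rfl j))).flatMap fun n =>
      (List.finRange G.numStates).flatMap fun v' =>
        encodeBits G.precision (G.trans v (G.jointActionEquiv v n) v')) ++
  (List.finRange G.numAgents).flatMap (fun i =>
    (List.finRange G.numStates).map fun v => decide (v ∈ G.goal i)) ++
  encodeBinary G.horizon

/-- The encoding of a transducer by explicit tables. -/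
def Transducer.encode {G : ConcurrentGame} {i : G.Agent} (T : G.Transducer i) : List Bool :=
  encodeUnary T.numStates ++
  encodeUnary T.init ++
  (List.finRange T.numStates).flatMap (fun s =>
    (List.finRange G.numStates).flatMap fun v => encodeUnary (T.next s v)) ++
  (List.finRange T.numStates).flatMap (fun s =>
    (List.finRange G.numStates).flatMap fun v =>
      (List.finRange (G.numActions i)).flatMap fun a => encodeBits G.precision (T.out s v a))

/-- The encoding of a game together with a profile of transducers, one for each agent. -/
def encodeInstance (G : ConcurrentGame) (T : (i : G.Agent) → G.Transducer i) : List Bool :=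
  G.encode ++ (List.finRange G.numAgents).flatMap fun i => (T i).encode

/-- The Nash-equilibrium verification problem: the words that encode a game and a profile of
transducers which is a Nash equilibrium of the game. -/
def nashVerification : Language Bool :=
  {w | ∃ (G : ConcurrentGame) (T : (i : G.Agent) → G.Transducer i),
    G.encodeInstance T = w ∧ G.IsNash fun i => (T i).strategy}

end ConcurrentGame

/-! ### Exponential time -/

open Classical in
/-- The class EXPTIME: some deterministic multi-stack Turing machine halts on every word `w`,
within `2 ^ p(|w|)` steps for a fixed polynomial `p`, with the output `true` if `w` belongs to the
language and `false` otherwise. -/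
def InEXPTIME (L : Language Bool) : Prop :=
  ∃ (p : Polynomial ℕ)
    (M : Turing.TM2ComputableInTime (id : List Bool → List Bool) Computability.encodeBool
      (fun w : List Bool => decide (w ∈ L))),
    ∀ n, M.time n ≤ 2 ^ p.eval n

/-! Fix the transducers of all agents other than `i`. Then `i` faces a Markov decision process with
finite horizon on the product states, which consist of a game state and the states of all
transducers. Backward induction computes its optimal value `optVal i True`; the same recursion
without optimisation, `optVal i False`, computes the payoff of the given profile.

Longer memory and randomisation give a deviator nothing more. One step is linear in its distribution
over actions, so a mixed action never beats the best pure one (`step_update`, `hitProb_update_le`),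
and playing a best action for the current product state and the number of remaining steps attains
the optimum (`exists_optimal`). Hence the profile is an equilibrium if and only if `optVal i True ≤
optVal i False` at the initial product state for every `i` (`isNash_iff`).

This comparison is feasible in exponential time. The numbers of product states and of joint actions
and the horizon, which is written in binary, are at most exponential in the length of the word. With
denominator `D = 2 ^ (precision - 1)`, each step contributes one factor `1 / D` per agent and one
for the transition, so the values with `t` steps left become integers after multiplication by `D ^
((numAgents + 1) * t)`. A whole table of values is thus a single number with exponentially many
bits, and the arithmetic is exact (`look_tab_codeX`). Whether a word is an encoding at all is
decided by reading every field at its computed position (`encodeInstance_eq_iff`,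
`bad_eq_zero_iff`).

On the machine side, programs on stacks of bits compile to Turing machines with one instruction per
step (`Run.steps`). The functions that such programs compute in polynomial time are closed under
composition and under recursion on notation with bounded values (`PTn.comp`, `PT.natRec_size`),
hence under sums, products and maxima over ranges of polynomially bounded length. Exponential time
is reached by padding: a word is accompanied by a number of exponential bit length, so that
polynomial time in both together is exponential time in the word (`inEXPTIME_of_pt`). -/

open Function

/-! ### Structured stack programs -/


/-- Structured programs that operate on stacks of bits indexed by natural numbers. -/
inductive Cmd
  | skip
  | push (k : ℕ) (b : Bool)
  | seq (c d : Cmd)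
  | case (k : ℕ) (cN cF cT : Cmd)
  | loop (k : ℕ) (cF cT : Cmd)

namespace Cmd

/-- The contents of all stacks. -/
abbrev Store := ℕ → List Bool

/-- `Run c S S' t`: the program `c` turns the store `S` into `S'` in `t` steps. The program
`case k` pops the stack `k` and branches on the result; `loop k` pops the stack `k` until it is
empty and executes one of its bodies for every symbol popped. -/
inductive Run : Cmd → Store → Store → ℕ → Prop
  | skip (S) : Run skip S S 0
  | push (S k b) : Run (push k b) S (update S k (b :: S k)) 1
  | seq {c d S S' S'' t t'} : Run c S S' t → Run d S' S'' t' → Run (seq c d) S S'' (t + t')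
  | caseN {k cN cF cT S S' t} : S k = [] → Run cN S S' t → Run (case k cN cF cT) S S' (t + 1)
  | caseF {k cN cF cT S S' t l} : S k = false :: l → Run cF (update S k l) S' t →
      Run (case k cN cF cT) S S' (t + 1)
  | caseT {k cN cF cT S S' t l} : S k = true :: l → Run cT (update S k l) S' t →
      Run (case k cN cF cT) S S' (t + 1)
  | loopN {k cF cT S} : S k = [] → Run (loop k cF cT) S S 1
  | loopF {k cF cT S S' S'' t t' l} : S k = false :: l → Run cF (update S k l) S' t →
      Run (loop k cF cT) S' S'' t' → Run (loop k cF cT) S S'' (t + t' + 1)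
  | loopT {k cF cT S S' S'' t t' l} : S k = true :: l → Run cT (update S k l) S' t →
      Run (loop k cF cT) S' S'' t' → Run (loop k cF cT) S S'' (t + t' + 1)

/-- A step pushes at most one symbol. This is how time bounds later become bounds on the sizes of
results. -/
theorem Run.length_le {c : Cmd} {S S' : Store} {t : ℕ} (h : Run c S S' t) (k : ℕ) :
    (S' k).length ≤ (S k).length + t := by
  have key : ∀ (S : Store) (j : ℕ) (l : List Bool) (b : Bool), S j = b :: l →
      (update S j l k).length ≤ (S k).length := by
    intro S j l b h
    by_cases hk : k = j
    · subst hk; simp [h]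
    · simp [hk]
  induction h with
  | skip => simp
  | push S j b =>
    by_cases hk : k = j
    · subst hk; simp
    · simp [hk]
  | seq _ _ ih1 ih2 => omega
  | caseN _ _ ih => omega
  | caseF h _ ih => have := key _ _ _ _ h; omega
  | caseT h _ ih => have := key _ _ _ _ h; omega
  | loopN => omega
  | loopF h _ _ ih1 ih2 => have := key _ _ _ _ h; omega
  | loopT h _ _ ih1 ih2 => have := key _ _ _ _ h; omega

/-! ### Compilation to flowcharts and Turing machines -/

/-- The labels of the flowchart of a program. -/
def Lab : Cmd → Type
  | skip => Empty
  | push _ _ => Unit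
  | seq c d => Lab c ⊕ Lab d
  | case _ a b c => Option (Lab a ⊕ Lab b ⊕ Lab c)
  | loop _ a b => Option (Lab a ⊕ Lab b)

instance fintypeLab : (c : Cmd) → Fintype (Lab c)
  | skip => inferInstanceAs (Fintype Empty)
  | push _ _ => inferInstanceAs (Fintype Unit)
  | seq c d =>
    have := fintypeLab c
    have := fintypeLab d
    inferInstanceAs (Fintype (Lab c ⊕ Lab d))
  | case _ a b c =>
    have := fintypeLab a
    have := fintypeLab b
    have := fintypeLab c
    inferInstanceAs (Fintype (Option (Lab a ⊕ Lab b ⊕ Lab c)))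
  | loop _ a b =>
    have := fintypeLab a
    have := fintypeLab b
    inferInstanceAs (Fintype (Option (Lab a ⊕ Lab b)))

/-- A strict upper bound for the stacks that a program uses. -/
def width : Cmd → ℕ
  | skip => 0
  | push k _ => k + 1
  | seq c d => max (width c) (width d)
  | case k a b c => max (k + 1) (max (width a) (max (width b) (width c)))
  | loop k a b => max (k + 1) (max (width a) (width b))

/-- The instructions of a flowchart with labels in `Λ`. -/
inductive Instr (Λ : Type)
  | push (k : ℕ) (b : Bool) (next : Λ)
  | pop (k : ℕ) (nN nF nT : Λ)

variable {Λ : Type}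

/-- The label at which the flowchart of a program is entered, where `emb` embeds its labels into
`Λ` and `exit` is the label to which it leads. -/
def entry : (c : Cmd) → (Lab c → Λ) → Λ → Λ
  | skip, _, exit => exit
  | push _ _, emb, _ => emb ()
  | seq c d, emb, exit => entry c (emb ∘ Sum.inl) (entry d (emb ∘ Sum.inr) exit)
  | case _ _ _ _, emb, _ => emb none
  | loop _ _ _, emb, _ => emb none

/-- The flowchart of a program. -/
def flow : (c : Cmd) → (Lab c → Λ) → Λ → Lab c → Instr Λ
  | skip, _, _, x => nomatch x
  | push k b, _, exit, _ => .push k b exit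
  | seq c d, emb, exit, .inl x => flow c (emb ∘ Sum.inl) (entry d (emb ∘ Sum.inr) exit) x
  | seq _ d, emb, exit, .inr x => flow d (emb ∘ Sum.inr) exit x
  | case k a b c, emb, exit, none =>
    .pop k (entry a (emb ∘ some ∘ Sum.inl) exit) (entry b (emb ∘ some ∘ Sum.inr ∘ Sum.inl) exit)
      (entry c (emb ∘ some ∘ Sum.inr ∘ Sum.inr) exit)
  | case _ a _ _, emb, exit, some (.inl x) => flow a (emb ∘ some ∘ Sum.inl) exit x
  | case _ _ b _, emb, exit, some (.inr (.inl x)) =>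
    flow b (emb ∘ some ∘ Sum.inr ∘ Sum.inl) exit x
  | case _ _ _ c, emb, exit, some (.inr (.inr x)) =>
    flow c (emb ∘ some ∘ Sum.inr ∘ Sum.inr) exit x
  | loop k a b, emb, exit, none =>
    .pop k exit (entry a (emb ∘ some ∘ Sum.inl) (emb none))
      (entry b (emb ∘ some ∘ Sum.inr) (emb none))
  | loop _ a _, emb, _, some (.inl x) => flow a (emb ∘ some ∘ Sum.inl) (emb none) x
  | loop _ _ b, emb, _, some (.inr x) => flow b (emb ∘ some ∘ Sum.inr) (emb none) x

/-- An instruction as a statement of a Turing machine with `R + 1` stacks. -/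
def Instr.toStmt (R : ℕ) : Instr Λ → Turing.TM2.Stmt (fun _ : Fin (R + 1) => Bool) Λ (Option Bool)
  | push k b n => .push (Fin.ofNat (R + 1) k) (fun _ => b) (.goto fun _ => n)
  | pop k nN nF nT => .pop (Fin.ofNat (R + 1) k) (fun _ o => o)
      (.goto fun o => match o with
        | none => nN
        | some false => nF
        | some true => nT)

/-- The first stacks of a store. -/
def restrict (R : ℕ) (S : Store) : Fin (R + 1) → List Bool := fun i => S i

theorem restrict_ofNat {R k : ℕ} (hk : k < R + 1) (S : Store) :
    restrict R S (Fin.ofNat (R + 1) k) = S k := by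
  simp [restrict, Nat.mod_eq_of_lt hk]

theorem restrict_update {R k : ℕ} (hk : k < R + 1) (S : Store) (l : List Bool) :
    restrict R (update S k l) = update (restrict R S) (Fin.ofNat (R + 1) k) l := by
  funext i
  by_cases h : (i : ℕ) = k
  · have : i = Fin.ofNat (R + 1) k := by ext; simp [h, Nat.mod_eq_of_lt hk]
    subst this
    simp [restrict, Nat.mod_eq_of_lt hk]
  · have : i ≠ Fin.ofNat (R + 1) k := by
      intro h'; apply h; rw [h']; simp [Nat.mod_eq_of_lt hk]
    rw [update_of_ne this]
    exact update_of_ne h _ _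

/-! ### Simulation of programs by their machines -/

section Simulation

variable {R : ℕ} (M : Λ → Turing.TM2.Stmt (fun _ : Fin (R + 1) => Bool) Λ (Option Bool))

/-- The machine `M` gets from label `l` and store `S` to label `l'` and store `S'` in `t` steps,
whatever its internal state is. -/
def Steps (l : Λ) (S : Store) (t : ℕ) (l' : Λ) (S' : Store) : Prop :=
  ∀ v, ∃ v', (flip bind (Turing.TM2.step M))^[t] (some ⟨some l, v, restrict R S⟩) =
    some ⟨some l', v', restrict R S'⟩

variable {M}

theorem Steps.refl (l : Λ) (S : Store) : Steps M l S 0 l S := fun v => ⟨v, rfl⟩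

theorem Steps.trans {l l' l'' : Λ} {S S' S'' : Store} {t t' : ℕ} (h : Steps M l S t l' S')
    (h' : Steps M l' S' t' l'' S'') : Steps M l S (t + t') l'' S'' := by
  intro v
  obtain ⟨v', hv⟩ := h v
  obtain ⟨v'', hv'⟩ := h' v'
  exact ⟨v'', by rw [Nat.add_comm t t', iterate_add_apply, hv, hv']⟩

theorem steps_push {l n : Λ} {k : ℕ} {b : Bool} (hk : k < R + 1)
    (h : M l = (Instr.push k b n).toStmt R) (S : Store) :
    Steps M l S 1 n (update S k (b :: S k)) := by
  intro v
  refine ⟨v, ?_⟩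
  simp [flip, h, Instr.toStmt, restrict_update hk, ← restrict_ofNat hk S, Turing.TM2.step,
    Turing.TM2.stepAux]

theorem steps_popN {l nN nF nT : Λ} {k : ℕ} (hk : k < R + 1)
    (h : M l = (Instr.pop k nN nF nT).toStmt R) {S : Store} (hS : S k = []) :
    Steps M l S 1 nN S := by
  intro v
  have h1 : restrict R S (Fin.ofNat (R + 1) k) = [] := by rw [restrict_ofNat hk, hS]
  refine ⟨none, ?_⟩
  simp only [flip, iterate_one, Option.bind_eq_bind, Option.bind_some, Turing.TM2.step, h,
    Instr.toStmt, Turing.TM2.stepAux, h1, List.head?_nil, List.tail_nil]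
  rw [← h1, update_eq_self]

theorem steps_popB {l nN nF nT : Λ} {k : ℕ} (hk : k < R + 1)
    (h : M l = (Instr.pop k nN nF nT).toStmt R) {S : Store} {b : Bool} {r : List Bool}
    (hS : S k = b :: r) :
    Steps M l S 1 (cond b nT nF) (update S k r) := by
  intro v
  have h1 : restrict R S (Fin.ofNat (R + 1) k) = b :: r := by rw [restrict_ofNat hk, hS]
  refine ⟨some b, ?_⟩
  simp only [flip, iterate_one, Option.bind_eq_bind, Option.bind_some, Turing.TM2.step, h,
    Instr.toStmt, Turing.TM2.stepAux, h1, List.head?_cons, List.tail_cons, restrict_update hk]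
  cases b <;> rfl

/-- Induction on the run. The embedding and the exit label are arbitrary because a subprogram is
simulated inside the flowchart of the whole program; the bodies of a loop exit to the label of the
loop itself. -/
theorem Run.steps {c : Cmd} {S S' : Store} {t : ℕ} (h : Run c S S' t) :
    ∀ (emb : Lab c → Λ) (exit : Λ), c.width ≤ R + 1 →
      (∀ x, M (emb x) = (flow c emb exit x).toStmt R) →
      Steps M (entry c emb exit) S t exit S' := by
  induction h with
  | skip S => intro emb exit _ _; exact Steps.refl _ _
  | push S k b =>
    intro emb exit hw hM
    exact steps_push (by simpa [width] using hw) (hM ()) S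
  | @seq c d S S' S'' t t' _ _ ih1 ih2 =>
    intro emb exit hw hM
    simp only [width, max_le_iff] at hw
    exact (ih1 _ _ hw.1 fun x => hM (Sum.inl x)).trans (ih2 _ _ hw.2 fun x => hM (Sum.inr x))
  | @caseN k a b c S S' t h0 _ ih =>
    intro emb exit hw hM
    simp only [width, max_le_iff] at hw
    rw [Nat.add_comm]
    exact (steps_popN (by omega) (hM none) h0).trans
      (ih _ _ hw.2.1 fun x => hM (some (Sum.inl x)))
  | @caseF k a b c S S' t l h0 _ ih =>
    intro emb exit hw hM
    simp only [width, max_le_iff] at hw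
    rw [Nat.add_comm]
    exact (steps_popB (by omega) (hM none) h0).trans
      (ih _ _ hw.2.2.1 fun x => hM (some (Sum.inr (Sum.inl x))))
  | @caseT k a b c S S' t l h0 _ ih =>
    intro emb exit hw hM
    simp only [width, max_le_iff] at hw
    rw [Nat.add_comm]
    exact (steps_popB (by omega) (hM none) h0).trans
      (ih _ _ hw.2.2.2 fun x => hM (some (Sum.inr (Sum.inr x))))
  | @loopN k a b S h0 =>
    intro emb exit hw hM
    simp only [width, max_le_iff] at hw
    exact steps_popN (by omega) (hM none) h0
  | @loopF k a b S S' S'' t t' l h0 _ _ ih1 ih2 =>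
    intro emb exit hw hM
    have hw' := hw
    simp only [width, max_le_iff] at hw
    rw [Nat.add_comm]
    exact (steps_popB (by omega) (hM none) h0).trans
      ((ih1 _ _ hw.2.1 fun x => hM (some (Sum.inl x))).trans (ih2 _ _ hw' hM))
  | @loopT k a b S S' S'' t t' l h0 _ _ ih1 ih2 =>
    intro emb exit hw hM
    have hw' := hw
    simp only [width, max_le_iff] at hw
    rw [Nat.add_comm]
    exact (steps_popB (by omega) (hM none) h0).trans
      ((ih1 _ _ hw.2.2 fun x => hM (some (Sum.inr x))).trans (ih2 _ _ hw' hM))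

end Simulation

/-- The Turing machine of a program; input and output are on the stack `0`. -/
def machine (c : Cmd) : Turing.FinTM2 where
  K := Fin (c.width + 1)
  k₀ := 0
  k₁ := 0
  Γ _ := Bool
  Λ := Option (Lab c)
  main := entry c some none
  σ := Option Bool
  initialState := none
  Γk₀Fin := inferInstanceAs (Fintype Bool)
  -- A halting configuration must carry the initial internal state, so the exit label resets it.
  -- This costs one extra step.
  m l := match l with
    | none => .load (fun _ => none) .halt
    | some x => (flow c some none x).toStmt c.width

/-- The store with contents `w` on the stack `0` and nothing elsewhere. -/
def single (w : List Bool) : Store := update (fun _ => []) 0 w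

theorem restrict_single (R : ℕ) (w : List Bool) (i : Fin (R + 1)) :
    restrict R (single w) i = if i = 0 then w else [] := by
  by_cases h : i = 0
  · subst h; simp [restrict, single]
  · have : (i : ℕ) ≠ 0 := fun h' => h (Fin.ext h')
    simp [restrict, single, h, this]

end Cmd

-- Compilation gives the machine, and the extra halting step is absorbed by adding one to the
-- polynomial in the exponent.
open Cmd in
open Classical in
theorem inEXPTIME_of_run {L : Language Bool} (c : Cmd) (p : Polynomial ℕ)
    (h : ∀ w : List Bool, ∃ t ≤ 2 ^ p.eval w.length,
      Run c (single w) (single [decide (w ∈ L)]) t) : InEXPTIME L := by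
  choose t ht hrun using h
  have key : ∀ w w' o : List Bool, w' = w → o = [decide (w ∈ L)] →
      (flip bind (Turing.TM2.step c.machine.m))^[t w + 1]
        (some (Turing.initList c.machine w')) = some (Turing.haltList c.machine o) := by
    rintro w _ _ rfl rfl
    rename_i w
    obtain ⟨v, hv⟩ := (hrun w).steps (R := c.width) (M := c.machine.m) some none (by omega)
      (fun x => rfl) none
    have h1 : Turing.initList c.machine w = ⟨some (entry c some none), none,
        restrict c.width (single w)⟩ := by
      have : (fun k => restrict c.width (single w) k) = restrict c.width (single w) := rfl
      rw [← this]
      simp only [restrict_single]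
      rfl
    have h2 : Turing.haltList c.machine [decide (w ∈ L)] = ⟨none, none,
        restrict c.width (single [decide (w ∈ L)])⟩ := by
      have : (fun k => restrict c.width (single [decide (w ∈ L)]) k) =
        restrict c.width (single [decide (w ∈ L)]) := rfl
      rw [← this]
      simp only [restrict_single]
      rfl
    refine (congrArg (fun x => (flip bind (Turing.TM2.step c.machine.m))^[t w + 1] (some x))
      h1).trans ?_
    refine (iterate_succ_apply' _ _ _).trans ?_
    refine (congrArg (flip bind (Turing.TM2.step c.machine.m)) hv).trans ?_
    exact congrArg some h2.symm
  refine ⟨p + 1, ⟨⟨c.machine, Equiv.refl _, Equiv.refl _⟩, fun n => 2 ^ (p.eval n + 1), ?_⟩, ?_⟩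
  · intro w
    refine ⟨⟨t w + 1, ?_⟩, ?_⟩
    · exact key w _ _ (List.map_id _) (List.map_id _)
    · have h1 := ht w
      have h2 : 1 ≤ 2 ^ p.eval w.length := Nat.one_le_two_pow
      simp only [id, pow_succ]
      omega
  · intro n; simp

namespace Cmd

/-! ### Operations on stacks -/

/-- The program `c` turns `S` into `S'` in at most `T` steps. -/
def Runs (c : Cmd) (S S' : Store) (T : ℕ) : Prop := ∃ t ≤ T, Run c S S' t

theorem Run.runs {c : Cmd} {S S' : Store} {t : ℕ} (h : Run c S S' t) : Runs c S S' t :=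
  ⟨t, le_rfl, h⟩

theorem Runs.mono {c : Cmd} {S S' : Store} {T T' : ℕ} (h : Runs c S S' T) (hT : T ≤ T') :
    Runs c S S' T' := by
  obtain ⟨t, ht, h⟩ := h
  exact ⟨t, ht.trans hT, h⟩

theorem Runs.congr {c : Cmd} {S S₁ S' S₁' : Store} {T T' : ℕ} (h : Runs c S S' T) (h₁ : S = S₁)
    (h₂ : S' = S₁') (hT : T ≤ T') : Runs c S₁ S₁' T' := by
  subst h₁ h₂; exact h.mono hT

theorem Runs.seq {c d : Cmd} {S S' S'' : Store} {T T' : ℕ} (h : Runs c S S' T)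
    (h' : Runs d S' S'' T') : Runs (seq c d) S S'' (T + T') := by
  obtain ⟨t, ht, h⟩ := h
  obtain ⟨t', ht', h'⟩ := h'
  exact ⟨t + t', by omega, .seq h h'⟩

theorem Runs.skip (S : Store) : Runs skip S S 0 := (Run.skip S).runs

theorem Runs.push (S : Store) (k : ℕ) (b : Bool) :
    Runs (push k b) S (update S k (b :: S k)) 1 := (Run.push S k b).runs

theorem Runs.caseN {k : ℕ} {cN cF cT : Cmd} {S S' : Store} {T : ℕ} (h : S k = [])
    (hr : Runs cN S S' T) : Runs (case k cN cF cT) S S' (T + 1) := by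
  obtain ⟨t, ht, hr⟩ := hr
  exact ⟨t + 1, by omega, .caseN h hr⟩

theorem Runs.caseB {k : ℕ} {cN cF cT : Cmd} {S S' : Store} {T : ℕ} {b : Bool} {l : List Bool}
    (h : S k = b :: l) (hr : Runs (if b then cT else cF) (update S k l) S' T) :
    Runs (case k cN cF cT) S S' (T + 1) := by
  obtain ⟨t, ht, hr⟩ := hr
  cases b
  · exact ⟨t + 1, by omega, .caseF h hr⟩
  · exact ⟨t + 1, by omega, .caseT h hr⟩

theorem Runs.loopN {k : ℕ} {cF cT : Cmd} {S : Store} (h : S k = []) :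
    Runs (loop k cF cT) S S 1 := (Run.loopN h).runs

theorem Runs.loopB {k : ℕ} {cF cT : Cmd} {S S' S'' : Store} {T T' : ℕ} {b : Bool}
    {l : List Bool} (h : S k = b :: l) (hr : Runs (if b then cT else cF) (update S k l) S' T)
    (hr' : Runs (loop k cF cT) S' S'' T') : Runs (loop k cF cT) S S'' (T + T' + 1) := by
  obtain ⟨t, ht, hr⟩ := hr
  obtain ⟨t', ht', hr'⟩ := hr'
  cases b
  · exact ⟨t + t' + 1, by omega, .loopF h hr hr'⟩
  · exact ⟨t + t' + 1, by omega, .loopT h hr hr'⟩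

/-- Move a stack to another one, reversing it. -/
def moveRev (a b : ℕ) : Cmd := loop a (push b false) (push b true)

theorem runs_moveRev {a b : ℕ} (hab : a ≠ b) (S : Store) :
    Runs (moveRev a b) S (update (update S a []) b ((S a).reverse ++ S b))
      (2 * (S a).length + 1) := by
  generalize hl : S a = l
  induction l generalizing S with
  | nil =>
    refine (Runs.loopN hl).congr rfl ?_ (by simp)
    funext i
    simp only [List.reverse_nil, List.nil_append, update_apply]
    split_ifs with h1 h2 <;> simp_all
  | cons x l ih =>
    have h1 : Runs (if x then push b true else push b false) (update S a l)
        (update (update S a l) b (x :: S b)) 1 := by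
      cases x <;> exact (Runs.push _ _ _).congr rfl (by simp [hab.symm]) le_rfl
    refine (Runs.loopB hl h1 (ih _ ?_)).congr rfl ?_ ?_
    · simp [hab]
    · funext i
      simp only [update_apply]
      split_ifs <;> simp_all
    · simp; omega

/-- Move a stack to two other ones, reversing it. -/
def fork (a b c : ℕ) : Cmd :=
  loop a (seq (push b false) (push c false)) (seq (push b true) (push c true))

theorem runs_fork {a b c : ℕ} (hab : a ≠ b) (hac : a ≠ c) (hbc : b ≠ c) (S : Store) :
    Runs (fork a b c) S (update (update (update S a []) b ((S a).reverse ++ S b)) c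
      ((S a).reverse ++ S c)) (3 * (S a).length + 1) := by
  generalize hl : S a = l
  induction l generalizing S with
  | nil =>
    refine (Runs.loopN hl).congr rfl ?_ (by simp)
    funext i
    simp only [List.reverse_nil, List.nil_append, update_apply]
    split_ifs with h1 h2 <;> simp_all
  | cons x l ih =>
    have h1 : Runs (if x then (push b true).seq (push c true) else
        (push b false).seq (push c false)) (update S a l)
        (update (update (update S a l) b (x :: S b)) c (x :: S c)) 2 := by
      cases x <;> exact ((Runs.push _ _ _).seq (Runs.push _ _ _)).congr rfl
        (by simp [hab.symm, hac.symm, hbc.symm]) le_rfl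
    refine (Runs.loopB hl h1 (ih _ ?_)).congr rfl ?_ ?_
    · simp [hab, hac]
    · funext i
      simp only [update_apply]
      split_ifs <;> simp_all
    · simp; omega

/-- Empty a stack. -/
def clear (a : ℕ) : Cmd := loop a skip skip

theorem runs_clear (a : ℕ) (S : Store) :
    Runs (clear a) S (update S a []) ((S a).length + 1) := by
  generalize hl : S a = l
  induction l generalizing S with
  | nil =>
    refine (Runs.loopN hl).congr rfl ?_ (by simp)
    rw [← hl, update_eq_self]
  | cons x l ih =>
    have h1 : Runs (if x then skip else skip) (update S a l) (update S a l) 0 := by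
      cases x <;> exact Runs.skip _
    refine (Runs.loopB hl h1 (ih _ (by simp))).congr rfl (by simp) (by simp)

/-- Copy the stack `i` to `r`, with the auxiliary stack `r + 1`. -/
def copyStack (i r : ℕ) : Cmd := seq (moveRev i (r + 1)) (fork (r + 1) i r)

theorem runs_copyStack {i r : ℕ} (hi : i < r) {S : Store} (hr : S r = []) (hr' : S (r + 1) = []) :
    Runs (copyStack i r) S (update S r (S i)) (5 * (S i).length + 2) := by
  refine ((runs_moveRev (by omega) S).seq (runs_fork (by omega) (by omega) (by omega) _)).congr
    rfl ?_ ?_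
  · funext j
    simp only [update_apply]
    grind
  · simp [hr']; omega

/-- Move the stack `r` to `i`, with the auxiliary stack `r + 1`. -/
def storeStack (i r : ℕ) : Cmd := seq (clear i) (seq (moveRev r (r + 1)) (moveRev (r + 1) i))

theorem runs_storeStack {i r : ℕ} (hi : i < r) {S : Store} (hr' : S (r + 1) = []) :
    Runs (storeStack i r) S (update (update S i (S r)) r [])
      (4 * ((S i).length + (S r).length) + 3) := by
  refine ((runs_clear i S).seq ((runs_moveRev (by omega) _).seq
    (runs_moveRev (by omega) _))).congr rfl ?_ ?_
  · funext j
    simp only [update_apply]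
    grind
  · have h1 : r ≠ i := by omega
    have h2 : r + 1 ≠ i := by omega
    simp [hr', h1, h2]
    omega

/-- Push a list of bits on a stack. -/
def pushList (r : ℕ) (l : List Bool) : Cmd := l.foldr (fun b c => seq c (push r b)) skip

theorem runs_pushList (r : ℕ) (l : List Bool) (S : Store) :
    Runs (pushList r l) S (update S r (l ++ S r)) l.length := by
  induction l with
  | nil => exact (Runs.skip S).congr rfl (by simp) le_rfl
  | cons b l ih => exact (ih.seq (Runs.push _ _ _)).congr rfl (by simp) (by simp)

/-! ### Addition and subtraction -/

/-- The value of a list of bits, least significant bit first. -/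
def val : List Bool → ℕ
  | [] => 0
  | b :: l => b.toNat + 2 * val l

/-- The value of a list of bits, most significant bit first. -/
def valRev : List Bool → ℕ
  | [] => 0
  | b :: l => b.toNat * 2 ^ l.length + valRev l

theorem valRev_lt (l : List Bool) : valRev l < 2 ^ l.length := by
  induction l with
  | nil => simp [valRev]
  | cons b l ih => cases b <;> simp [valRev, pow_succ] <;> omega

theorem val_bits (n : ℕ) : val n.bits = n := by
  induction n using Nat.binaryRec' with
  | zero => simp [val]
  | bit b n h ih =>
    rw [Nat.bits_append_bit n b h, val, ih]
    cases b <;> simp [Nat.bit, two_mul, Nat.add_comm]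

/-- The stacks of the serial adder: the operands, the output and the carry. -/
def adderStore (S : Store) (r : ℕ) (x y o : List Bool) (c : Bool) : Store :=
  update (update (update (update S r x) (r + 1) y) (r + 2) o) (r + 3) (if c then [true] else [])

/-! ### The serial adder -/

section Adder

variable (δ : Bool → Bool → Bool → Bool × Bool)

/-- Write one output bit and the carry. -/
def adderEmit (r : ℕ) (p : Bool × Bool) : Cmd :=
  seq (push (r + 2) p.1) (if p.2 then push (r + 3) true else skip)

/-- Read the carry and process one pair of bits. -/
def adderBit (r : ℕ) (x y : Bool) : Cmd :=
  case (r + 3) (adderEmit r (δ x y false)) skip (adderEmit r (δ x y true))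

/-- Read the second operand and the carry and process one pair of bits. -/
def adderBits (r : ℕ) (x : Bool) : Cmd :=
  case (r + 1) (adderBit δ r x false) (adderBit δ r x false) (adderBit δ r x true)

/-- Process the first operand, with the corresponding bits of the second one. -/
def consumeFst : List Bool → List Bool → List Bool → Bool → List Bool × List Bool × Bool
  | [], y, o, c => (y, o, c)
  | a :: x, y, o, c => consumeFst x y.tail ((δ a (y.headD false) c).1 :: o)
      (δ a (y.headD false) c).2

/-- Process the rest of the second operand. -/
def consumeSnd : List Bool → List Bool → Bool → List Bool × Bool
  | [], o, c => (o, c)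
  | b :: y, o, c => consumeSnd y ((δ false b c).1 :: o) (δ false b c).2

theorem runs_adderBit (S : Store) (r : ℕ) (x y o : List Bool) (c a b : Bool) :
    Runs (adderBit δ r a b) (adderStore S r x y o c)
      (adderStore S r x y ((δ a b c).1 :: o) (δ a b c).2) 3 := by
  have key : ∀ p : Bool × Bool, Runs (adderEmit r p) (adderStore S r x y o false)
      (adderStore S r x y (p.1 :: o) p.2) 2 := by
    rintro ⟨p, q⟩
    cases q
    · refine ((Runs.push _ _ _).seq (Runs.skip _)).congr rfl ?_ (by omega)
      funext i
      simp only [adderStore, update_apply]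
      grind
    · refine ((Runs.push _ _ _).seq (Runs.push _ _ _)).congr rfl ?_ (by omega)
      funext i
      simp only [adderStore, update_apply]
      grind
  cases c
  · exact (Runs.caseN (by simp [adderStore]) (key _)).mono le_rfl
  · refine (Runs.caseB (b := true) (l := []) (by simp [adderStore]) ?_).mono le_rfl
    simp only [if_true]
    refine (key _).congr ?_ rfl le_rfl
    simp [adderStore]

theorem runs_adderBits (S : Store) (r : ℕ) (x y o : List Bool) (c a : Bool) :
    Runs (adderBits δ r a) (adderStore S r x y o c)
      (adderStore S r x y.tail ((δ a (y.headD false) c).1 :: o) (δ a (y.headD false) c).2) 4 := by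
  cases y with
  | nil => exact (Runs.caseN (by simp [adderStore]) (runs_adderBit δ _ _ _ _ _ _ _ _)).mono le_rfl
  | cons b y =>
    refine (Runs.caseB (b := b) (l := y) (by simp [adderStore]) ?_).mono (le_refl (3 + 1))
    have : update (adderStore S r x (b :: y) o c) (r + 1) y = adderStore S r x y o c := by
      funext i
      simp only [adderStore, update_apply]
      split_ifs <;> simp_all
    rw [this]
    cases b <;> exact runs_adderBit δ _ _ _ _ _ _ _ _

theorem runs_consumeFst (S : Store) (r : ℕ) (x y o : List Bool) (c : Bool) :
    Runs (loop r (adderBits δ r false) (adderBits δ r true)) (adderStore S r x y o c)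
      (adderStore S r [] (consumeFst δ x y o c).1 (consumeFst δ x y o c).2.1
        (consumeFst δ x y o c).2.2) (5 * x.length + 1) := by
  induction x generalizing y o c with
  | nil => exact (Runs.loopN (by simp [adderStore])).mono (by simp)
  | cons a x ih =>
    have h1 : update (adderStore S r (a :: x) y o c) r x = adderStore S r x y o c := by
      funext i
      simp only [adderStore, update_apply]
      split_ifs <;> simp_all
    refine (Runs.loopB (b := a) (l := x) (by simp [adderStore]) ?_ (ih _ _ _)).mono
      (T := 4 + (5 * x.length + 1) + 1) (by simp; omega)
    rw [h1]
    cases a <;> exact runs_adderBits δ _ _ _ _ _ _ _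

theorem runs_consumeSnd (S : Store) (r : ℕ) (y o : List Bool) (c : Bool) :
    Runs (loop (r + 1) (adderBit δ r false false) (adderBit δ r false true))
      (adderStore S r [] y o c)
      (adderStore S r [] [] (consumeSnd δ y o c).1 (consumeSnd δ y o c).2)
        (4 * y.length + 1) := by
  induction y generalizing o c with
  | nil => exact (Runs.loopN (by simp [adderStore])).mono (by simp)
  | cons a y ih =>
    have h1 : update (adderStore S r [] (a :: y) o c) (r + 1) y = adderStore S r [] y o c := by
      funext i
      simp only [adderStore, update_apply]
      split_ifs <;> simp_all
    refine (Runs.loopB (b := a) (l := y) (by simp [adderStore]) ?_ (ih _ _)).mono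
      (T := 3 + (4 * y.length + 1) + 1) (by simp; omega)
    rw [h1]
    cases a <;> exact runs_adderBit δ _ _ _ _ _ _ _ _

theorem consumeFst_length (x y o : List Bool) (c : Bool) :
    (consumeFst δ x y o c).1.length ≤ y.length ∧
      (consumeFst δ x y o c).2.1.length = o.length + x.length := by
  induction x generalizing y o c with
  | nil => simp [consumeFst]
  | cons a x ih =>
    have := ih y.tail ((δ a (y.headD false) c).1 :: o) (δ a (y.headD false) c).2
    simp only [consumeFst, List.length_tail, List.length_cons] at this ⊢
    omega

theorem consumeSnd_length (y o : List Bool) (c : Bool) :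
    (consumeSnd δ y o c).1.length = o.length + y.length := by
  induction y generalizing o c with
  | nil => simp [consumeSnd]
  | cons a y ih =>
    have := ih ((δ false a c).1 :: o) (δ false a c).2
    simp only [consumeSnd, List.length_cons] at this ⊢
    omega

end Adder

/-- Move the output `r + 2` to `r`, dropping leading zeros. -/
def normalize (r : ℕ) : Cmd :=
  loop (r + 2) (case r skip (seq (push r false) (push r false)) (seq (push r true) (push r false)))
    (push r true)

/-- Horner's scheme: the most significant bit lies on top of the output, and `n` is the number read
so far. A zero is pushed only if the target is nonempty, since `Nat.bits` has no leading zeros; the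
bit popped for this test is put back. -/
theorem runs_normalize (S : Store) (r n : ℕ) (o : List Bool) :
    Runs (normalize r) (adderStore S r n.bits [] o false)
      (adderStore S r (n * 2 ^ o.length + valRev o).bits [] [] false) (4 * o.length + 1) := by
  induction o generalizing n with
  | nil => exact (Runs.loopN (by simp [adderStore])).congr rfl (by simp [valRev]) (by simp)
  | cons b o ih =>
    have h1 : ∀ x y, update (update (adderStore S r x [] y false) (r + 2) o) r n.bits =
        adderStore S r n.bits [] o false := by
      intro x y
      funext i
      simp only [adderStore, update_apply]
      split_ifs <;> simp_all
    have h2 : ∀ x x' y, update (adderStore S r x [] y false) r x' =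
        adderStore S r x' [] y false := by
      intro x x' y
      funext i
      simp only [adderStore, update_apply]
      split_ifs <;> simp_all
    have h3 : ∀ x y y', update (adderStore S r x [] y false) (r + 2) y' =
        adderStore S r x [] y' false := by
      intro x x' y
      funext i
      simp only [adderStore, update_apply]
      split_ifs <;> simp_all
    have h4 : ∀ x y, adderStore S r x [] y false r = x := by
      intro x y
      simp [adderStore]
    have step : Runs (if b then push r true else
        (case r skip (seq (push r false) (push r false)) (seq (push r true) (push r false))))
        (adderStore S r n.bits [] o false) (adderStore S r (2 * n + b.toNat).bits [] o false) 3 := by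
      cases b
      · simp only [Bool.false_eq_true, if_false, Bool.toNat_false, Nat.add_zero]
        rcases Nat.eq_zero_or_pos n with rfl | hn
        · exact ((Runs.caseN (h4 _ _) (Runs.skip _))).mono (by omega)
        · rw [Nat.bit0_bits n (by omega)]
          rcases hb : n.bits with _ | ⟨a, l⟩
          · have := val_bits n
            rw [hb] at this
            simp [val] at this
            omega
          · refine (Runs.caseB (b := a) (l := l) (h4 _ _) (S' := adderStore S r
              (false :: a :: l) [] o false) (T := 2) ?_).mono (by omega)
            rw [h2]
            cases a
            · exact ((Runs.push _ _ _).seq (Runs.push _ _ _)).congr rfl (by simp [h2, h4]) le_rfl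
            · exact ((Runs.push _ _ _).seq (Runs.push _ _ _)).congr rfl (by simp [h2, h4]) le_rfl
      · simp only [if_true, Bool.toNat_true]
        exact (Runs.push _ _ _).congr rfl (by rw [h2, h4, Nat.bit1_bits]) (by omega)
    refine (Runs.loopB (b := b) (l := o) (by simp [adderStore]) ?_ (ih (2 * n + b.toNat))).congr
      (T := 3 + (4 * o.length + 1) + 1) rfl ?_ (by simp; omega)
    · rw [h3]; exact step
    · congr 2
      simp only [valRev, List.length_cons, pow_succ]
      ring

/-- The serial adder. -/
def adder (δ : Bool → Bool → Bool → Bool × Bool) (last : Cmd) (r : ℕ) : Cmd :=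
  seq (loop r (adderBits δ r false) (adderBits δ r true))
    (seq (loop (r + 1) (adderBit δ r false false) (adderBit δ r false true))
      (seq (case (r + 3) skip skip last) (normalize r)))

/-- Addition and subtraction differ only in the bit table `δ` and in the treatment `f` of a final
carry: it is appended to the output of an addition, and it erases the output of a subtraction. -/
theorem runs_adder (δ : Bool → Bool → Bool → Bool × Bool) (last : Cmd) (S : Store) (r : ℕ)
    (x y : ℕ) (f : List Bool → List Bool) (hf : ∀ l, (f l).length ≤ l.length + 1)
    (hlast : ∀ o, Runs last (adderStore S r [] [] o false) (adderStore S r [] [] (f o) false)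
      (o.length + 1)) (z : ℕ)
    (hz : ∀ y' o c o' c', consumeFst δ x.bits y.bits [] false = (y', o, c) →
      consumeSnd δ y' o c = (o', c') → valRev (if c' then f o' else o') = z) :
    Runs (adder δ last r) (adderStore S r x.bits y.bits [] false)
      (adderStore S r z.bits [] [] false) (14 * (x.size + y.size) + 10) := by
  rcases h1 : consumeFst δ x.bits y.bits [] false with ⟨y', o, c⟩
  rcases h2 : consumeSnd δ y' o c with ⟨o', c'⟩
  have hl1 := consumeFst_length δ x.bits y.bits [] false
  have hl2 := consumeSnd_length δ y' o c
  have r1 := runs_consumeFst δ S r x.bits y.bits [] false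
  have r2 := runs_consumeSnd δ S r y' o c
  rw [h1] at hl1 r1
  rw [h2] at hl2 r2
  have h3 := hz _ _ _ _ _ h1 h2
  simp only [List.length_nil, Nat.zero_add] at hl1 hl2 r1 r2
  have r3 : Runs (case (r + 3) skip skip last) (adderStore S r [] [] o' c')
      (adderStore S r [] [] (if c' then f o' else o') false) (o'.length + 2) := by
    cases c'
    · exact (Runs.caseN (by simp [adderStore]) (Runs.skip _)).mono (by omega)
    · refine (Runs.caseB (b := true) (l := []) (by simp [adderStore]) ?_).mono
        (T := o'.length + 1 + 1) (by omega)
      simp only [if_true]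
      refine (hlast o').congr ?_ rfl le_rfl
      simp [adderStore]
  have r4 := runs_normalize S r 0 (if c' then f o' else o')
  rw [Nat.zero_bits] at r4
  refine (r1.seq (r2.seq (r3.seq r4))).congr rfl (by simp [h3]) ?_
  have h5 : (if c' then f o' else o').length ≤ o'.length + 1 := by
    split_ifs
    · exact hf _
    · omega
  rw [← Nat.size_eq_bits_len, ← Nat.size_eq_bits_len]
  omega

/-- One bit of an addition. -/
def fullAdder (a b c : Bool) : Bool × Bool := (xor (xor a b) c, (a && b) || (c && (a || b)))

/-- One bit of a subtraction. -/
def fullSubtractor (a b c : Bool) : Bool × Bool := (xor (xor a b) c, (!a && (b || c)) || (b && c))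

/-- Invariant of the serial adder: the bits written so far, plus the unread operands and the carry
at their place value, keep the same total. -/
theorem consumeFst_fullAdder (x y o : List Bool) (c : Bool) {y' o' : List Bool} {c' : Bool}
    (h : consumeFst fullAdder x y o c = (y', o', c')) :
    valRev o' + 2 ^ o'.length * (val y' + c'.toNat) =
      valRev o + 2 ^ o.length * (val x + val y + c.toNat) := by
  induction x generalizing y o c with
  | nil => simp only [consumeFst, Prod.mk.injEq] at h; obtain ⟨rfl, rfl, rfl⟩ := h; simp [val]
  | cons a x ih =>
    rw [ih _ _ _ h]
    rcases y with _ | ⟨b, y⟩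
    · cases a <;> cases c <;> simp [fullAdder, valRev, val, pow_succ] <;> ring
    · cases a <;> cases c <;> cases b <;> simp [fullAdder, valRev, val, pow_succ] <;> ring

theorem consumeSnd_fullAdder (y o : List Bool) (c : Bool) {o' : List Bool} {c' : Bool}
    (h : consumeSnd fullAdder y o c = (o', c')) :
    valRev o' + 2 ^ o'.length * c'.toNat = valRev o + 2 ^ o.length * (val y + c.toNat) := by
  induction y generalizing o c with
  | nil => simp only [consumeSnd, Prod.mk.injEq] at h; obtain ⟨rfl, rfl⟩ := h; simp [val]
  | cons a y ih =>
    rw [ih _ _ h]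
    cases a <;> cases c <;> simp [fullAdder, valRev, val, pow_succ] <;> ring

/-- Here the carry is a borrow and counts with the subtrahend. The invariant is arranged without
subtraction so that it makes sense in `ℕ`. -/
theorem consumeFst_fullSubtractor (x y o : List Bool) (c : Bool) {y' o' : List Bool} {c' : Bool}
    (h : consumeFst fullSubtractor x y o c = (y', o', c')) :
    valRev o' + 2 ^ o.length * (val y + c.toNat) =
      valRev o + 2 ^ o.length * val x + 2 ^ o'.length * (val y' + c'.toNat) := by
  induction x generalizing y o c with
  | nil => simp only [consumeFst, Prod.mk.injEq] at h; obtain ⟨rfl, rfl, rfl⟩ := h; simp [val]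
  | cons a x ih =>
    have := ih _ _ _ h
    rcases y with _ | ⟨b, y⟩
    · cases a <;> cases c <;> simp [fullSubtractor, valRev, val, pow_succ] at this ⊢ <;> linarith
    · cases a <;> cases c <;> cases b <;>
        simp [fullSubtractor, valRev, val, pow_succ] at this ⊢ <;> linarith

theorem consumeSnd_fullSubtractor (y o : List Bool) (c : Bool) {o' : List Bool} {c' : Bool}
    (h : consumeSnd fullSubtractor y o c = (o', c')) :
    valRev o' + 2 ^ o.length * (val y + c.toNat) = valRev o + 2 ^ o'.length * c'.toNat := by
  induction y generalizing o c with
  | nil => simp only [consumeSnd, Prod.mk.injEq] at h; obtain ⟨rfl, rfl⟩ := h; simp [val]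
  | cons a y ih =>
    have := ih _ _ h
    cases a <;> cases c <;> simp [fullSubtractor, valRev, val, pow_succ] at this ⊢ <;> linarith

/-- Addition. -/
def addStack (r : ℕ) : Cmd := adder fullAdder (push (r + 2) true) r

theorem runs_addStack (S : Store) (r x y : ℕ) :
    Runs (addStack r) (adderStore S r x.bits y.bits [] false)
      (adderStore S r (x + y).bits [] [] false) (14 * (x.size + y.size) + 10) := by
  refine runs_adder _ _ S r x y (fun o => true :: o) (by simp) ?_ _ ?_
  · intro o
    refine (Runs.push _ _ _).congr rfl ?_ (by omega)
    funext i
    simp only [adderStore, update_apply]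
    split_ifs <;> simp_all
  · intro y' o c o' c' h1 h2
    have e1 := consumeFst_fullAdder _ _ _ _ h1
    have e2 := consumeSnd_fullAdder _ _ _ h2
    simp only [valRev, val_bits, List.length_nil, pow_zero, Bool.toNat_false] at e1
    cases c' <;> simp [valRev] at e2 ⊢ <;> omega

/-- Truncated subtraction. -/
def subStack (r : ℕ) : Cmd := adder fullSubtractor (clear (r + 2)) r

theorem runs_subStack (S : Store) (r x y : ℕ) :
    Runs (subStack r) (adderStore S r x.bits y.bits [] false)
      (adderStore S r (x - y).bits [] [] false) (14 * (x.size + y.size) + 10) := by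
  refine runs_adder _ _ S r x y (fun o => []) (by simp) ?_ _ ?_
  · intro o
    refine (runs_clear _ _).congr rfl ?_ (by simp [adderStore])
    funext i
    simp only [adderStore, update_apply]
    split_ifs <;> simp_all
  · intro y' o c o' c' h1 h2
    have e1 := consumeFst_fullSubtractor _ _ _ _ h1
    have e2 := consumeSnd_fullSubtractor _ _ _ h2
    have hl := consumeSnd_length fullSubtractor y' o c
    have hlt := valRev_lt o'
    rw [h2] at hl
    simp only [valRev, val_bits, List.length_nil, pow_zero, Bool.toNat_false] at e1
    -- Since `valRev o'` is below `2 ^ o'.length`, a final borrow occurs only if `x < y`, and then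
    -- the truncated difference is the empty output.
    have e3 : valRev o' + y = x + 2 ^ o'.length * c'.toNat := by linarith
    cases c' <;> simp [valRev] at e3 ⊢ <;> omega

end Cmd

namespace Cmd

/-! ### Stacks as registers for natural numbers -/

/-- The store that holds the binary digits of the numbers of a list. -/
def St (l : List ℕ) : Store := fun i => (l.getD i 0).bits

theorem St_of_le {l : List ℕ} {i : ℕ} (h : l.length ≤ i) : St l i = [] := by
  simp [St, List.getElem?_eq_none h]

theorem St_append (l : List ℕ) (x : ℕ) : St (l ++ [x]) = update (St l) l.length x.bits := by
  funext i
  simp only [update_apply]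
  split_ifs with h
  · subst h; simp [St]
  · rcases lt_or_gt_of_ne h with h | h
    · simp [St, List.getElem?_append_left h]
    · rw [St_of_le h.le, St_of_le (by simp; omega)]

theorem St_set {l : List ℕ} {i : ℕ} (h : i < l.length) (x : ℕ) :
    St (l.set i x) = update (St l) i x.bits := by
  funext j
  simp only [update_apply]
  split_ifs with hj
  · subst hj; simp [St, h]
  · simp [St, List.getElem?_set_ne (Ne.symm hj)]

/-- Zero is the empty stack, so scratch registers above the list need no initialisation. -/
theorem St_append_zero (l : List ℕ) : St (l ++ [0]) = St l := by
  rw [St_append, Nat.zero_bits, ← St_of_le le_rfl, update_eq_self]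

theorem adderStore_St (l : List ℕ) (x y : ℕ) :
    adderStore (St l) l.length x.bits y.bits [] false = St (l ++ [x] ++ [y]) := by
  rw [St_append, St_append]
  funext i
  simp only [adderStore, update_apply, List.length_append, List.length_singleton]
  have := @St_of_le l i
  grind

theorem adderStore_St_nil (l : List ℕ) (x : ℕ) :
    adderStore (St l) l.length x.bits [] [] false = St (l ++ [x]) := by
  rw [← St_append_zero (l ++ [x]), ← adderStore_St, Nat.zero_bits]

theorem runs_copy {l : List ℕ} {i : ℕ} (hi : i < l.length) :
    Runs (copyStack i l.length) (St l) (St (l ++ [l.getD i 0])) (5 * (l.getD i 0).size + 2) := by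
  refine (runs_copyStack hi (St_of_le le_rfl) (St_of_le (by omega))).congr rfl ?_ ?_
  · rw [St_append]; rfl
  · simp [St, ← Nat.size_eq_bits_len]

theorem runs_store {l : List ℕ} {i : ℕ} (hi : i < l.length) (x : ℕ) :
    Runs (storeStack i l.length) (St (l ++ [x])) (St (l.set i x))
      (4 * ((l.getD i 0).size + x.size) + 3) := by
  refine (runs_storeStack hi (St_of_le (by simp))).congr rfl ?_ ?_
  · rw [St_append, St_set hi]
    funext j
    simp only [update_apply]
    have := @St_of_le l j
    grind
  · simp [St, List.getElem?_append_left hi, ← Nat.size_eq_bits_len]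

theorem runs_const (l : List ℕ) (x : ℕ) :
    Runs (pushList l.length x.bits) (St l) (St (l ++ [x])) x.size := by
  refine (runs_pushList _ _ _).congr rfl ?_ (Nat.size_eq_bits_len x).le
  rw [St_append, St_of_le le_rfl, List.append_nil]

theorem runs_drop (l : List ℕ) (x : ℕ) :
    Runs (clear l.length) (St (l ++ [x])) (St l) (x.size + 1) := by
  refine (runs_clear _ _).congr rfl ?_ (by simp [St, ← Nat.size_eq_bits_len])
  rw [St_append, update_idem, ← St_of_le le_rfl, update_eq_self]

theorem runs_add (l : List ℕ) (x y : ℕ) :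
    Runs (addStack l.length) (St (l ++ [x] ++ [y])) (St (l ++ [x + y]))
      (14 * (x.size + y.size) + 10) := by
  refine (runs_addStack (St l) l.length x y).congr (adderStore_St _ _ _) ?_ le_rfl
  exact adderStore_St_nil _ _

theorem runs_sub (l : List ℕ) (x y : ℕ) :
    Runs (subStack l.length) (St (l ++ [x] ++ [y])) (St (l ++ [x - y]))
      (14 * (x.size + y.size) + 10) := by
  refine (runs_subStack (St l) l.length x y).congr (adderStore_St _ _ _) ?_ le_rfl
  exact adderStore_St_nil _ _

theorem bits_eq_cons {n : ℕ} (h : n ≠ 0) : ∃ b, n.bits = b :: (n / 2).bits := by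
  rcases hb : n.bits with _ | ⟨b, l⟩
  · have := val_bits n
    rw [hb] at this
    exact absurd this.symm h
  · have := Nat.div2_bits_eq_tail n
    rw [hb, Nat.div2_val] at this
    exact ⟨b, by rw [this, List.tail_cons]⟩

theorem size_eq_succ {n : ℕ} (h : n ≠ 0) : n.size = (n / 2).size + 1 := by
  obtain ⟨b, hb⟩ := bits_eq_cons h
  rw [← Nat.size_eq_bits_len, hb, List.length_cons, Nat.size_eq_bits_len]

theorem runs_halve (l : List ℕ) (x : ℕ) :
    Runs (case l.length skip skip skip) (St (l ++ [x])) (St (l ++ [x / 2])) 1 := by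
  rcases eq_or_ne x 0 with rfl | h
  · exact Runs.caseN (by simp [St]) (Runs.skip _)
  · obtain ⟨b, hb⟩ := bits_eq_cons h
    refine Runs.caseB (b := b) (l := (x / 2).bits) (by simp [St, hb]) ?_
    rw [St_append, update_idem, ← St_append]
    cases b <;> exact Runs.skip _

/-- Every round pops one bit of `Y`, so the number of rounds is the bit length of `Y`. The family
`P` describes the registers above it after `k` rounds, and the body must work for whatever is left
of `Y`. -/
theorem runs_loop {l : List ℕ} {c : Cmd} {P : ℕ → List ℕ} {T : ℕ → ℕ} {n : ℕ}
    (h : ∀ Y k, k < n → Runs c (St (l ++ Y :: P k)) (St (l ++ Y :: P (k + 1))) (T k))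
    (Y k : ℕ) (hk : k + Y.size ≤ n) :
    Runs (loop l.length c c) (St (l ++ Y :: P k)) (St (l ++ 0 :: P (k + Y.size)))
      (∑ j ∈ Finset.range Y.size, (T (k + j) + 1) + 1) := by
  induction hs : Y.size generalizing Y k with
  | zero =>
    rw [Nat.size_eq_zero] at hs
    subst hs
    exact Runs.loopN (by simp [St])
  | succ s ih =>
    have hY : Y ≠ 0 := by rintro rfl; simp at hs
    obtain ⟨b, hb⟩ := bits_eq_cons hY
    have h2 := size_eq_succ hY
    have hs' : (Y / 2).size = s := by omega
    have h3 : update (St (l ++ Y :: P k)) l.length (Y / 2).bits = St (l ++ (Y / 2) :: P k) := by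
      rw [← St_set (by simp)]
      simp
    have r1 := ih (Y / 2) (k + 1) (by omega) hs'
    refine (Runs.loopB (b := b) (l := (Y / 2).bits) (by simp [St, hb]) ?_ r1).congr (T := T k +
      (∑ j ∈ Finset.range s, (T (k + 1 + j) + 1) + 1) + 1) rfl (by rw [Nat.add_right_comm]; rfl) ?_
    · rw [h3]
      cases b <;> exact h _ _ (by omega)
    · rw [Finset.sum_range_succ']
      simp only [Nat.add_zero, Nat.add_assoc, Nat.add_comm 1]
      omega

/-! ### Contexts and computable functions -/

end Cmd

/-- Types whose elements are represented by lists of natural numbers of a fixed length. -/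
class Ctx (α : Type) where
  /-- the number of components -/
  arity : ℕ
  /-- the components -/
  toList : α → List ℕ
  length_toList : ∀ a, (toList a).length = arity

namespace Ctx

instance : Ctx ℕ := ⟨1, fun n => [n], fun _ => rfl⟩

instance {α β : Type} [Ctx α] [Ctx β] : Ctx (α × β) :=
  ⟨arity α + arity β, fun p => toList p.1 ++ toList p.2, fun p => by simp [length_toList]⟩

/-- The number of bits of the components. -/
def sz {α : Type} [Ctx α] (a : α) : ℕ := ((toList a).map Nat.size).sum

@[simp] theorem sz_nat (n : ℕ) : sz n = n.size := by simp [sz, toList]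

@[simp] theorem sz_prod {α β : Type} [Ctx α] [Ctx β] (p : α × β) : sz p = sz p.1 + sz p.2 := by
  simp [sz, toList]

theorem size_getD_le {α : Type} [Ctx α] (a : α) (i : ℕ) : ((toList a).getD i 0).size ≤ sz a := by
  rcases lt_or_ge i (toList a).length with h | h
  · rw [List.getD_eq_getElem _ _ h]
    exact List.single_le_sum (by simp) _ (List.mem_map_of_mem (List.getElem_mem h))
  · simp [List.getElem?_eq_none h]

end Ctx

open Ctx Cmd

section Complexity

variable {α β γ : Type} [Ctx α] [Ctx β] [Ctx γ]

/-- `Comp f T`: for all places `ps` of the components of an argument `a` among `m` registers there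
is a program that computes `f a` in time `T a` and puts it into the next register. -/
def Comp (f : α → ℕ) (T : α → ℕ) : Prop :=
  ∀ (ps : List ℕ) (m : ℕ), ps.length = arity α → (∀ p ∈ ps, p < m) →
    ∃ c : Cmd, ∀ (a : α) (l : List ℕ), l.length = m → ps.map (l.getD · 0) = toList a →
      Runs c (St l) (St (l ++ [f a])) (T a)

theorem map_getD_append {ps : List ℕ} {m : ℕ} (hp : ∀ p ∈ ps, p < m) {l : List ℕ}
    (hl : l.length = m) (l' : List ℕ) :
    ps.map ((l ++ l').getD · 0) = ps.map (l.getD · 0) := by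
  apply List.map_congr_left
  intro p h
  have := hp p h
  simp [List.getElem?_append_left (hl ▸ this)]

/-- Primitive recursion. -/
def primRec (g : ℕ) (h : ℕ → ℕ → ℕ) : ℕ → ℕ
  | 0 => g
  | k + 1 => h k (primRec g h k)

/-! ### Closure properties of computation on registers -/

namespace Comp

theorem mono {f T T' : α → ℕ} (h : Comp f T) (hT : ∀ a, T a ≤ T' a) : Comp f T' := by
  intro ps m hps hp
  obtain ⟨c, hc⟩ := h ps m hps hp
  exact ⟨c, fun a l hl ha => (hc a l hl ha).mono (hT a)⟩

theorem var (i : ℕ) (hi : i < arity α) :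
    Comp (fun a : α => (toList a).getD i 0) (fun a => 5 * sz a + 2) := by
  intro ps m hps hp
  have hi' : i < ps.length := by omega
  refine ⟨copyStack ps[i] m, fun a l hl ha => ?_⟩
  subst hl
  have h1 : l.getD ps[i] 0 = (toList a).getD i 0 := by
    rw [← ha]; simp [hi']
  have h2 := size_getD_le a i
  refine (runs_copy (hp _ (List.getElem_mem hi'))).congr rfl (by rw [h1])
    (by rw [h1]; change _ ≤ 5 * sz a + 2; omega)

theorem const (n : ℕ) : Comp (fun _ : α => n) (fun _ => n.size) := by
  intro ps m _ _
  refine ⟨pushList m n.bits, fun a l hl _ => ?_⟩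
  subst hl
  exact runs_const l n

theorem binary {f g T T' : α → ℕ} {op : ℕ → ℕ → ℕ} {cmd : ℕ → Cmd}
    (hop : ∀ (l : List ℕ) (x y : ℕ), Runs (cmd l.length) (St (l ++ [x] ++ [y]))
      (St (l ++ [op x y])) (14 * (x.size + y.size) + 10)) (hf : Comp f T) (hg : Comp g T') :
    Comp (fun a => op (f a) (g a))
      (fun a => T a + (T' a + (14 * ((f a).size + (g a).size) + 10))) := by
  intro ps m hps hp
  obtain ⟨c, hc⟩ := hf ps m hps hp
  obtain ⟨d, hd⟩ := hg ps (m + 1) hps (fun p h => (hp p h).trans (Nat.lt_succ_self m))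
  refine ⟨c.seq (d.seq (cmd m)), fun a l hl ha => ?_⟩
  refine (hc a l hl ha).seq ((hd a (l ++ [f a]) (by simp [hl]) ?_).seq ?_)
  · rw [map_getD_append hp hl, ha]
  · subst hl; exact hop l _ _

theorem add {f g T T' : α → ℕ} (hf : Comp f T) (hg : Comp g T') : Comp (fun a => f a + g a)
      (fun a => T a + (T' a + (14 * ((f a).size + (g a).size) + 10))) := binary runs_add hf hg

theorem sub {f g T T' : α → ℕ} (hf : Comp f T) (hg : Comp g T') : Comp (fun a => f a - g a)
      (fun a => T a + (T' a + (14 * ((f a).size + (g a).size) + 10))) := binary runs_sub hf hg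

theorem half {f T : α → ℕ} (hf : Comp f T) : Comp (fun a => f a / 2) (fun a => T a + 1) := by
  intro ps m hps hp
  obtain ⟨c, hc⟩ := hf ps m hps hp
  refine ⟨c.seq (case m skip skip skip), fun a l hl ha => (hc a l hl ha).seq ?_⟩
  subst hl
  exact runs_halve l _

/-- The output register is empty at the start and gains at most one bit per step. -/
theorem size_le {f T : α → ℕ} (hf : Comp f T) (a : α) : (f a).size ≤ T a := by
  obtain ⟨c, hc⟩ := hf (List.range (arity α)) (arity α) (by simp) (by simp)
  have h1 : (List.range (arity α)).map ((toList a).getD · 0) = toList a := by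
    apply List.ext_getElem
    · simp [length_toList]
    · intro i h1 h2; simp [h2]
  obtain ⟨t, ht, h⟩ := hc a (toList a) (length_toList a) h1
  have := h.length_le (arity α)
  rw [St_of_le (length_toList a).le, ← length_toList a] at this
  simp [St, Nat.size_eq_bits_len] at this
  omega

/-- Remove the registers below the top one, down to height `m`. -/
def squash (m : ℕ) : ℕ → Cmd
  | 0 => skip
  | n + 1 => (storeStack (m + n) (m + n + 1)).seq (squash m n)

/-- Each store moves the result `z` one register down, overwriting an intermediate value. -/
theorem runs_squash (l L : List ℕ) (z B : ℕ) (hB : ∀ x ∈ L, x.size ≤ B) :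
    Runs (squash l.length L.length) (St (l ++ L ++ [z])) (St (l ++ [z]))
      (L.length * (4 * (B + z.size) + 3)) := by
  induction L using List.reverseRecOn with
  | nil => exact (Runs.skip _).congr rfl (by simp) (by simp)
  | append_singleton L x ih =>
    have h1 := runs_store (l := l ++ L ++ [x]) (i := l.length + L.length) (by simp) z
    have h2 := ih fun y hy => hB y (by simp [hy])
    have hx := hB x (by simp)
    rw [List.length_append, List.length_singleton, squash]
    have h3 : (l ++ L ++ [x]).set (l.length + L.length) z = l ++ L ++ [z] := by
      rw [← List.length_append, List.set_append_right _ _ le_rfl]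
      simp
    have h4 : (l ++ L ++ [x]).getD (l.length + L.length) 0 = x := by
      simp only [List.getD_eq_getElem?_getD, ← List.length_append, List.getElem?_concat_length,
        Option.getD_some]
    rw [h3, h4, List.length_append, List.length_append, List.length_singleton] at h1
    refine (h1.seq h2).congr (by simp) rfl ?_
    have : 4 * (x.size + z.size) ≤ 4 * (B + z.size) := by omega
    rw [Nat.add_mul]
    omega

/-- The components of `f a` are computed into consecutive new registers, `g` runs on these places,
and the intermediate registers are squashed. This is why `Comp` quantifies over all places of the
arguments. -/
theorem comp {f : α → β} {g : β → ℕ} {T : α → ℕ} {T' : β → ℕ}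
    (hf : ∀ i < arity β, Comp (fun a => (toList (f a)).getD i 0) T) (hg : Comp g T') :
    Comp (fun a => g (f a)) (fun a => arity β * T a + (T' (f a) +
      arity β * (4 * (sz (f a) + (g (f a)).size) + 3))) := by
  intro ps m hps hp
  have key : ∀ n ≤ arity β, ∃ c : Cmd, ∀ (a : α) (l : List ℕ), l.length = m →
      ps.map (l.getD · 0) = toList a →
      Runs c (St l) (St (l ++ (toList (f a)).take n)) (n * T a) := by
    intro n
    induction n with
    | zero => intro _; exact ⟨skip, fun a l _ _ => (Runs.skip _).congr rfl (by simp) (by simp)⟩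
    | succ n ih =>
      intro hn
      obtain ⟨c, hc⟩ := ih (by omega)
      obtain ⟨d, hd⟩ := hf n (by omega) ps (m + n) hps fun p h => (hp p h).trans_le (by omega)
      refine ⟨c.seq d, fun a l hl ha => ?_⟩
      have hlen : n < (toList (f a)).length := by rw [length_toList]; omega
      refine ((hc a l hl ha).seq (hd a _ ?_ ?_)).congr rfl ?_ ?_
      · simp only [List.length_append, hl, List.length_take]
        omega
      · rw [map_getD_append hp hl, ha]
      · congr 1
        rw [List.append_assoc, List.take_add_one, List.getElem?_eq_getElem hlen]
        simp [hlen]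
      · ring_nf; omega
  obtain ⟨c, hc⟩ := key _ le_rfl
  obtain ⟨d, hd⟩ := hg ((List.range (arity β)).map (m + ·)) (m + arity β) (by simp) (by simp)
  refine ⟨c.seq (d.seq (squash m (arity β))), fun a l hl ha => ?_⟩
  have hlen := length_toList (f a)
  have h1 := hc a l hl ha
  rw [← hlen, List.take_length, hlen] at h1
  refine h1.seq ((hd (f a) (l ++ toList (f a)) (by simp [hl, hlen]) ?_).seq ?_)
  · apply List.ext_getElem
    · simp [hlen]
    · intro i h1 h2
      simp only [List.map_map, List.getElem_map, List.getElem_range, comp_apply, ← hl]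
      simp [h2]
  · have h2 := runs_squash l (toList (f a)) (g (f a)) (sz (f a)) (fun x hx => ?_)
    · rw [hl, hlen] at h2; exact h2
    · exact List.single_le_sum (by simp) _ (List.mem_map_of_mem hx)

/-- The registers `m`, `m + 1` and `m + 2` hold the loop word, the accumulator and the counter. A
round puts the result of `h` into `m + 3`, stores it in the accumulator and increments the counter.
-/
theorem natRec {y g Ty Tg : α → ℕ} {h : α → ℕ → ℕ → ℕ} {Th : α × ℕ × ℕ → ℕ} (hy : Comp y Ty)
    (hg : Comp g Tg) (hh : Comp (fun p : α × ℕ × ℕ => h p.1 p.2.1 p.2.2) Th) :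
    Comp (fun a => primRec (g a) (h a) (y a).size)
      (fun a => Ty a + (Tg a + (0 + ((∑ k ∈ Finset.range (y a).size,
        ((Th (a, k, primRec (g a) (h a) k) + (4 * ((primRec (g a) (h a) k).size +
          (primRec (g a) (h a) (k + 1)).size) + 3 + (1 + (14 * (k.size + 1) + 10)))) + 1) + 1) +
        ((y a).size.size + 1 + (4 * (primRec (g a) (h a) (y a).size).size + 3)))))) := by
  intro ps m hps hp
  obtain ⟨cy, hcy⟩ := hy ps m hps hp
  obtain ⟨cg, hcg⟩ := hg ps (m + 1) hps fun p h => (hp p h).trans_le (by omega)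
  -- The step function takes the counter before the accumulator, while the registers hold them in
  -- the opposite order.
  obtain ⟨ch, hch⟩ := hh (ps ++ [m + 2, m + 1]) (m + 3) (by simp [hps]; rfl) (by
    intro p h
    simp only [List.mem_append, List.mem_cons, List.not_mem_nil, or_false] at h
    rcases h with h | h | h
    · have := hp p h; omega
    · omega
    · omega)
  refine ⟨cy.seq (cg.seq ((pushList (m + 2) (Nat.bits 0)).seq
    ((loop m (ch.seq ((storeStack (m + 1) (m + 3)).seq
      ((pushList (m + 3) (Nat.bits 1)).seq (addStack (m + 2)))))
      (ch.seq ((storeStack (m + 1) (m + 3)).seq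
      ((pushList (m + 3) (Nat.bits 1)).seq (addStack (m + 2)))))).seq
      ((clear (m + 2)).seq (storeStack m (m + 1)))))), fun a l hl ha => ?_⟩
  set A : ℕ → ℕ := primRec (g a) (h a) with hA
  have hA0 : A 0 = g a := rfl
  have hA1 : ∀ k, A (k + 1) = h a k (A k) := fun k => rfl
  refine (hcy a l hl ha).seq ((hcg a (l ++ [y a]) (by simp [hl]) ?_).seq
    (Runs.seq (S' := St (l ++ y a :: [A 0, 0])) ?_ (Runs.seq
      (S' := St (l ++ 0 :: [A (y a).size, (y a).size])) ?_ (Runs.seq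
      (S' := St (l ++ [0] ++ [A (y a).size])) ?_ ?_))))
  · rw [map_getD_append hp hl, ha]
  · have := runs_const (l ++ [y a] ++ [g a]) 0
    simpa [hl, hA0] using this
  · have hbody : ∀ Y k, k < (y a).size → Runs (ch.seq ((storeStack (m + 1) (m + 3)).seq
      ((pushList (m + 3) (Nat.bits 1)).seq (addStack (m + 2))))) (St (l ++ Y :: [A k, k]))
        (St (l ++ Y :: [A (k + 1), k + 1]))
        (Th (a, k, A k) + (4 * ((A k).size + (A (k + 1)).size) + 3 +
            (1 + (14 * (k.size + 1) + 10)))) := by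
      intro Y k hk
      refine (hch (a, k, A k) (l ++ Y :: [A k, k]) (by simp [hl]) ?_).seq
        (Runs.seq (S' := St (l ++ Y :: [A (k + 1), k])) ?_
          (Runs.seq (S' := St (l ++ Y :: [A (k + 1), k] ++ [1])) ?_ ?_))
      · rw [List.map_append, map_getD_append hp hl, ha]
        subst hl
        simp [toList]
      · have := runs_store (l := l ++ Y :: [A k, k]) (i := m + 1) (by simp [hl]) (h a k (A k))
        refine (this.congr ?_ ?_ ?_ : Runs _ (St (l ++ Y :: [A k, k] ++ [h a k (A k)]))
          (St (l ++ Y :: [A (k + 1), k])) _) |> fun z => by simpa [hl] using z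
        · rfl
        · subst hl; simp [hA1]
        · subst hl; simp [hA1]
      · have := runs_const (l ++ Y :: [A (k + 1), k]) 1
        simpa [hl] using this
      · have := runs_add (l ++ Y :: [A (k + 1)]) k 1
        simpa [hl] using this
    have := runs_loop (l := l) (P := fun k => [A k, k]) hbody (y a) 0 (by omega)
    simpa only [hl, Nat.zero_add] using this
  · have := runs_drop (l ++ [0] ++ [A (y a).size]) (y a).size
    simpa [hl] using this
  · have := runs_store (l := l ++ [0]) (i := m) (by simp [hl]) (A (y a).size)
    subst hl
    simpa using this

end Comp

/-! ### Polynomial time -/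

/-- The values of `T` are polynomially bounded in the number of bits of the argument. -/
def PolyBdd (T : α → ℕ) : Prop := ∃ d, ∀ a, T a ≤ (sz a + 2) ^ d

namespace PolyBdd

variable {T U : α → ℕ}

theorem mono (h : PolyBdd U) (hT : ∀ a, T a ≤ U a) : PolyBdd T := by
  obtain ⟨d, hd⟩ := h
  exact ⟨d, fun a => (hT a).trans (hd a)⟩

theorem const (n : ℕ) : PolyBdd (fun _ : α => n) :=
  ⟨n, fun a => (Nat.lt_two_pow_self (n := n)).le.trans (Nat.pow_le_pow_left (by omega) n)⟩

theorem sz : PolyBdd (fun a : α => sz a) := ⟨1, fun a => by simp⟩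

theorem add (h : PolyBdd T) (h' : PolyBdd U) : PolyBdd (fun a => T a + U a) := by
  obtain ⟨d, hd⟩ := h
  obtain ⟨e, he⟩ := h'
  -- The base of the power is at least two, so one more factor absorbs the sum of two bounds.
  refine ⟨max d e + 1, fun a => ?_⟩
  have h1 := (hd a).trans (Nat.pow_le_pow_right (by omega) (le_max_left d e))
  have h2 := (he a).trans (Nat.pow_le_pow_right (by omega) (le_max_right d e))
  calc T a + U a ≤ (Ctx.sz a + 2) ^ max d e * 2 := by omega
    _ ≤ (Ctx.sz a + 2) ^ max d e * (Ctx.sz a + 2) := Nat.mul_le_mul_left _ (by omega)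
    _ = _ := (pow_succ _ _).symm

theorem mul (h : PolyBdd T) (h' : PolyBdd U) : PolyBdd (fun a => T a * U a) := by
  obtain ⟨d, hd⟩ := h
  obtain ⟨e, he⟩ := h'
  exact ⟨d + e, fun a => (Nat.mul_le_mul (hd a) (he a)).trans (pow_add _ _ _).ge⟩

theorem pow (h : PolyBdd T) (n : ℕ) : PolyBdd (fun a => T a ^ n) := by
  induction n with
  | zero => simpa using const 1
  | succ n ih => simpa [pow_succ] using ih.mul h

theorem comp {V : β → ℕ} (h : PolyBdd V) {f : α → β} (hf : PolyBdd (fun a => Ctx.sz (f a))) :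
    PolyBdd (fun a => V (f a)) := by
  obtain ⟨d, hd⟩ := h
  exact ((hf.add (const 2)).pow d).mono fun a => hd (f a)

end PolyBdd

/-- The function `f` is computable in polynomial time. -/
def PTn (f : α → ℕ) : Prop := ∃ T, PolyBdd T ∧ Comp f T

/-- All components of the function `f` are computable in polynomial time. -/
@[fun_prop]
def PT (f : α → β) : Prop := ∀ i < arity β, PTn (fun a => (toList (f a)).getD i 0)

theorem PTn.polyBdd_size {f : α → ℕ} (hf : PTn f) : PolyBdd (fun a => (f a).size) := by
  obtain ⟨T, hT, h⟩ := hf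
  exact hT.mono h.size_le

theorem pt_iff {f : α → ℕ} : PT f ↔ PTn f := by
  constructor
  · intro h; simpa [toList] using h 0 Nat.one_pos
  · intro h i hi
    have : i = 0 := Nat.lt_one_iff.mp hi
    subst this
    simpa [toList] using h

theorem PT.polyBdd_sz {f : α → β} (hf : PT f) : PolyBdd (fun a => sz (f a)) := by
  have key : ∀ n ≤ arity β, PolyBdd (fun a => (((toList (f a)).take n).map Nat.size).sum) := by
    intro n
    induction n with
    | zero => intro _; simpa using PolyBdd.const 0
    | succ n ih =>
      intro hn
      refine ((ih (by omega)).add (hf n (by omega)).polyBdd_size).mono fun a => ?_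
      have hlen : n < (toList (f a)).length := by rw [length_toList]; omega
      rw [List.take_add_one, List.getElem?_eq_getElem hlen]
      simp [hlen]
  refine (key _ le_rfl).mono fun a => ?_
  rw [← length_toList (f a), List.take_length]
  exact le_rfl

theorem PolyBdd.comp_pt {V : β → ℕ} (h : PolyBdd V) {f : α → β} (hf : PT f) :
    PolyBdd (fun a => V (f a)) := h.comp hf.polyBdd_sz

/-- The finitely many components of `f` share a time bound, the sum of their own ones. -/
theorem PTn.comp {f : α → β} {g : β → ℕ} (hg : PTn g) (hf : PT f) : PTn (fun a => g (f a)) := by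
  have hT : ∃ T : α → ℕ, PolyBdd T ∧
      ∀ i < arity β, Comp (fun a => (toList (f a)).getD i 0) T := by
    have key : ∀ n ≤ arity β, ∃ T : α → ℕ, PolyBdd T ∧
        ∀ i < n, Comp (fun a => (toList (f a)).getD i 0) T := by
      intro n
      induction n with
      | zero => intro _; exact ⟨_, PolyBdd.const 0, by simp⟩
      | succ n ih =>
        intro hn
        obtain ⟨T, hT, h⟩ := ih (by omega)
        obtain ⟨T', hT', h'⟩ := hf n (by omega)
        refine ⟨_, hT.add hT', fun i hi => ?_⟩
        rcases Nat.lt_succ_iff_lt_or_eq.mp hi with hi | rfl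
        · exact (h i hi).mono fun a => Nat.le_add_right _ _
        · exact h'.mono fun a => Nat.le_add_left _ _
    exact key _ le_rfl
  obtain ⟨T, hT, h⟩ := hT
  obtain ⟨T', hT', h'⟩ := id hg
  refine ⟨_, ?_, h'.comp h⟩
  have h1 := hf.polyBdd_sz
  have h2 := hg.polyBdd_size.comp_pt hf
  have h3 := hT'.comp_pt hf
  exact ((PolyBdd.const _).mul hT).add (h3.add ((PolyBdd.const _).mul
    (((PolyBdd.const 4).mul (h1.add h2)).add (PolyBdd.const 3))))

/-! ### Closure of polynomial time under composition, arithmetic and bounded recursion -/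

namespace PT

@[fun_prop]
theorem id : PT (fun a : α => a) := fun i hi =>
  ⟨_, ((PolyBdd.const 5).mul PolyBdd.sz).add (PolyBdd.const 2), Comp.var i hi⟩

@[fun_prop]
theorem const (b : β) : PT (fun _ : α => b) := fun _ _ =>
  ⟨_, PolyBdd.const _, Comp.const _⟩

@[fun_prop]
theorem comp {f : α → β} {g : β → γ} (hg : PT g) (hf : PT f) : PT (fun a => g (f a)) :=
  fun i hi => (hg i hi).comp hf

@[fun_prop]
theorem prodMk {f : α → β} {g : α → γ} (hf : PT f) (hg : PT g) : PT (fun a => (f a, g a)) := by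
  intro i hi
  rcases lt_or_ge i (arity β) with h | h
  · have := hf i h
    simpa [toList, List.getElem?_append_left, length_toList, h] using this
  · have := hg (i - arity β) (by change i < arity β + arity γ at hi; omega)
    simpa [toList, List.getElem?_append_right, length_toList, h] using this

@[fun_prop]
theorem fst {f : α → β × γ} (hf : PT f) : PT (fun a => (f a).1) := by
  intro i hi
  have := hf i (show i < arity β + arity γ by omega)
  simpa [toList, List.getElem?_append_left, length_toList, hi] using this

@[fun_prop]
theorem snd {f : α → β × γ} (hf : PT f) : PT (fun a => (f a).2) := by
  intro i hi
  have := hf (arity β + i) (show _ < arity β + arity γ by omega)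
  simpa [toList, List.getElem?_append_right, length_toList] using this

theorem component (i : ℕ) (hi : i < arity α) : PT (fun a : α => (toList a).getD i 0) :=
  pt_iff.mpr ⟨_, ((PolyBdd.const 5).mul PolyBdd.sz).add (PolyBdd.const 2), Comp.var i hi⟩

theorem polyBdd_size {f : α → ℕ} (hf : PT f) : PolyBdd (fun a => (f a).size) :=
  (pt_iff.mp hf).polyBdd_size

@[fun_prop]
theorem add {f g : α → ℕ} (hf : PT f) (hg : PT g) : PT (fun a => f a + g a) := by
  have h1 := hf.polyBdd_size
  have h2 := hg.polyBdd_size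
  obtain ⟨T, hT, hf⟩ := pt_iff.mp hf
  obtain ⟨T', hT', hg⟩ := pt_iff.mp hg
  exact pt_iff.mpr ⟨_, hT.add (hT'.add (((PolyBdd.const 14).mul (h1.add h2)).add
    (PolyBdd.const 10))), hf.add hg⟩

@[fun_prop]
theorem sub {f g : α → ℕ} (hf : PT f) (hg : PT g) : PT (fun a => f a - g a) := by
  have h1 := hf.polyBdd_size
  have h2 := hg.polyBdd_size
  obtain ⟨T, hT, hf⟩ := pt_iff.mp hf
  obtain ⟨T', hT', hg⟩ := pt_iff.mp hg
  exact pt_iff.mpr ⟨_, hT.add (hT'.add (((PolyBdd.const 14).mul (h1.add h2)).add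
    (PolyBdd.const 10))), hf.sub hg⟩

theorem half {f : α → ℕ} (hf : PT f) : PT (fun a => f a / 2) := by
  obtain ⟨T, hT, hf⟩ := pt_iff.mp hf
  exact pt_iff.mpr ⟨_, hT.add (PolyBdd.const 1), hf.half⟩

/-- Recursion on notation, with one round per bit of `y a`. The a priori bound `B` on the sizes of
all intermediate values is essential: iterated squaring, for example, would leave polynomial time.
-/
theorem natRec_size {y g : α → ℕ} {h : α → ℕ → ℕ → ℕ} (hy : PT y) (hg : PT g)
    (hh : PT (fun p : α × ℕ × ℕ => h p.1 p.2.1 p.2.2)) (B : α → ℕ) (hB : PolyBdd B)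
    (hle : ∀ a k, k ≤ (y a).size → (primRec (g a) (h a) k).size ≤ B a) :
    PT (fun a => primRec (g a) (h a) (y a).size) := by
  have hy' := hy.polyBdd_size
  obtain ⟨Ty, hTy, hy⟩ := pt_iff.mp hy
  obtain ⟨Tg, hTg, hg⟩ := pt_iff.mp hg
  obtain ⟨Th, ⟨d, hd⟩, hh⟩ := pt_iff.mp hh
  -- In each round, `8 * B a + 3` pays for storing the accumulator and `14 * (y a).size + 26` for
  -- the counter and the loop itself.
  have hsum : ∀ a, (∑ k ∈ Finset.range (y a).size, ((Th (a, k, primRec (g a) (h a) k) +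
      (4 * ((primRec (g a) (h a) k).size + (primRec (g a) (h a) (k + 1)).size) + 3 +
        (1 + (14 * (k.size + 1) + 10)))) + 1)) ≤ (y a).size *
      ((sz a + ((y a).size + B a) + 2) ^ d + ((8 * B a + 3) + (14 * (y a).size + 26))) := by
    intro a
    refine (Finset.sum_le_card_nsmul _ _ _ fun k hk => ?_).trans (by simp; rfl)
    rw [Finset.mem_range] at hk
    have h1 := hle a k hk.le
    have h2 := hle a (k + 1) hk
    have h3 : k.size ≤ k := Nat.size_le.mpr Nat.lt_two_pow_self
    have h4 : sz (a, k, primRec (g a) (h a) k) + 2 ≤ sz a + ((y a).size + B a) + 2 := by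
      simp only [sz_prod, sz_nat]
      omega
    have h5 := (hd (a, k, primRec (g a) (h a) k)).trans (Nat.pow_le_pow_left h4 d)
    omega
  refine pt_iff.mpr ⟨fun a => Ty a + (Tg a + (0 + (((y a).size *
      ((sz a + ((y a).size + B a) + 2) ^ d + ((8 * B a + 3) + (14 * (y a).size + 26))) + 1) +
      ((y a).size + 1 + (4 * B a + 3))))), ?_, (hy.natRec hg hh).mono fun a => ?_⟩
  · refine hTy.add (hTg.add ((PolyBdd.const 0).add (PolyBdd.add (PolyBdd.add ?_ (PolyBdd.const 1))
      ((hy'.add (PolyBdd.const 1)).add (((PolyBdd.const 4).mul hB).add (PolyBdd.const 3))))))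
    exact hy'.mul ((((PolyBdd.sz.add (hy'.add hB)).add (PolyBdd.const 2)).pow d).add
      ((((PolyBdd.const 8).mul hB).add (PolyBdd.const 3)).add
        (((PolyBdd.const 14).mul hy').add (PolyBdd.const 26))))
  · have h1 := hle a _ le_rfl
    have h3 : (y a).size.size ≤ (y a).size := Nat.size_le.mpr Nat.lt_two_pow_self
    have h4 := hsum a
    omega

end PT

/-! ### A library of polynomial-time functions -/

theorem size_add_le (x y : ℕ) : (x + y).size ≤ x.size + y.size + 1 := by
  rw [Nat.size_le, pow_succ, pow_add]
  have h1 := Nat.lt_size_self x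
  have h2 := Nat.lt_size_self y
  nlinarith [Nat.one_le_two_pow (n := x.size), Nat.one_le_two_pow (n := y.size)]

theorem size_mul_le (x y : ℕ) : (x * y).size ≤ x.size + y.size := by
  rw [Nat.size_le, pow_add]
  exact Nat.mul_lt_mul'' (Nat.lt_size_self x) (Nat.lt_size_self y)

theorem size_le_self (n : ℕ) : n.size ≤ n := Nat.size_le.mpr Nat.lt_two_pow_self

/-- Case distinction by whether a number is zero. -/
def ifz (c x y : ℕ) : ℕ := if c = 0 then x else y

/-- The truth value of `x < y`. -/
def ltb (x y : ℕ) : ℕ := if x < y then 1 else 0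

/-- The truth value of `x = y`. -/
def eqb (x y : ℕ) : ℕ := if x = y then 1 else 0

namespace PT

-- A recursion over the bits of `c` makes no round exactly if `c` is zero, and its step returns `y`
-- regardless of the accumulator.
@[fun_prop]
theorem ifz {c x y : α → ℕ} (hc : PT c) (hx : PT x) (hy : PT y) :
    PT (fun a => ifz (c a) (x a) (y a)) := by
  have key : ∀ a k, primRec (x a) (fun _ _ => y a) k = if k = 0 then x a else y a := by
    intro a k; cases k <;> rfl
  have := natRec_size (h := fun a _ _ => y a) hc hx (by fun_prop)
    (fun a => (x a).size + (y a).size) (hx.polyBdd_size.add hy.polyBdd_size) (by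
      intro a k _
      rw [key]
      split_ifs <;> omega)
  simpa only [key, _root_.ifz, Nat.size_eq_zero] using this

@[fun_prop]
theorem ltb {x y : α → ℕ} (hx : PT x) (hy : PT y) : PT (fun a => ltb (x a) (y a)) := by
  have : PT (fun a => _root_.ifz (y a - x a) 0 1) := by fun_prop
  convert this using 2 with a
  unfold _root_.ifz _root_.ltb
  split_ifs <;> omega

@[fun_prop]
theorem eqb {x y : α → ℕ} (hx : PT x) (hy : PT y) : PT (fun a => eqb (x a) (y a)) := by
  have : PT (fun a => 1 - (_root_.ltb (x a) (y a) + _root_.ltb (y a) (x a))) := by fun_prop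
  convert this using 2 with a
  unfold _root_.eqb _root_.ltb
  split_ifs <;> omega

@[fun_prop]
theorem max {x y : α → ℕ} (hx : PT x) (hy : PT y) : PT (fun a => max (x a) (y a)) := by
  have : PT (fun a => x a + (y a - x a)) := by fun_prop
  convert this using 2 with a
  omega

@[fun_prop]
theorem min {x y : α → ℕ} (hx : PT x) (hy : PT y) : PT (fun a => min (x a) (y a)) := by
  have : PT (fun a => x a - (x a - y a)) := by fun_prop
  convert this using 2 with a
  omega

@[fun_prop]
theorem size {x : α → ℕ} (hx : PT x) : PT (fun a => (x a).size) := by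
  have key : ∀ k, primRec 0 (fun _ r => r + 1) k = k := by
    intro k; induction k with
    | zero => rfl
    | succ k ih => rw [primRec, ih]
  have := natRec_size (g := fun _ : α => 0) (h := fun a _ r => r + 1) hx (by fun_prop)
    (by fun_prop) (fun a => (x a).size) hx.polyBdd_size (by
      intro a k hk
      rw [key]
      exact (size_le_self k).trans hk)
  simpa only [key] using this

theorem shift_size {x y : α → ℕ} (hx : PT x) (hy : PT y) :
    PT (fun a => x a * 2 ^ (y a).size) := by
  have key : ∀ a k, primRec (x a) (fun _ r => r + r) k = x a * 2 ^ k := by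
    intro a k; induction k with
    | zero => simp [primRec]
    | succ k ih => rw [primRec, ih, pow_succ]; ring
  have := natRec_size (g := x) (h := fun a _ r => r + r) hy hx
    (by fun_prop) (fun a => (x a).size + ((y a).size + 1))
    (hx.polyBdd_size.add (hy.polyBdd_size.add (PolyBdd.const 1))) (by
      intro a k hk
      rw [key]
      refine (size_mul_le _ _).trans (Nat.add_le_add le_rfl (Nat.size_pow.le.trans ?_))
      omega)
  simpa only [key] using this

theorem smash {x y : α → ℕ} (hx : PT x) (hy : PT y) :
    PT (fun a => 2 ^ ((x a).size * (y a).size)) := by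
  have key : ∀ a k, primRec 1 (fun _ r => r * 2 ^ (y a).size) k = 2 ^ (k * (y a).size) := by
    intro a k; induction k with
    | zero => simp [primRec]
    | succ k ih => rw [primRec, ih, ← pow_add, Nat.succ_mul]
  have := natRec_size (g := fun _ => 1) (h := fun a _ r => r * 2 ^ (y a).size) hx (by fun_prop)
    (shift_size (by fun_prop) (by fun_prop)) (fun a => (x a).size * (y a).size + 1)
    ((hx.polyBdd_size.mul hy.polyBdd_size).add (PolyBdd.const 1)) (by
      intro a k hk
      rw [key, Nat.size_pow]
      exact Nat.add_le_add (Nat.mul_le_mul_right _ hk) le_rfl)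
  simpa only [key] using this

/-- Shifting by the bit length of a component adds bit lengths; the starting number `2 ^ 1` has two
bits. -/
theorem exists_sz_le_size : ∃ y : α → ℕ, PT y ∧ ∀ a, sz a + 2 ≤ (y a).size := by
  have key : ∀ n ≤ arity α, ∃ y : α → ℕ, PT y ∧
      ∀ a, (((toList a).take n).map Nat.size).sum + 2 ≤ (y a).size := by
    intro n
    induction n with
    | zero => intro _; exact ⟨fun _ => 2 ^ 1, by fun_prop, fun a => by
      rw [Nat.size_pow]; simp⟩
    | succ n ih =>
      intro hn
      obtain ⟨y, hy, h⟩ := ih (by omega)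
      refine ⟨_, shift_size hy (component n (by omega)), fun a => ?_⟩
      have hlen : n < (toList a).length := by rw [length_toList]; omega
      have hy0 : y a ≠ 0 := by
        intro h0
        have := h a
        rw [h0, Nat.size_zero] at this
        omega
      rw [List.take_add_one, List.getElem?_eq_getElem hlen, ← Nat.shiftLeft_eq,
        Nat.size_shiftLeft hy0]
      have := h a
      simp only [List.map_append, List.sum_append, Option.toList_some, List.map_cons, List.map_nil,
        List.sum_cons, List.sum_nil, List.getD_eq_getElem _ _ hlen]
      omega
  obtain ⟨y, hy, h⟩ := key _ le_rfl
  refine ⟨y, hy, fun a => (h a).trans' ?_⟩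
  rw [← length_toList a, List.take_length]
  exact le_rfl

/-- Recursion on notation is as long as the bit length of a computed number. By `smash`, which
multiplies bit lengths, any polynomial number of rounds is available. -/
theorem exists_le_size {n : α → ℕ} (hn : PolyBdd n) : ∃ y : α → ℕ, PT y ∧ ∀ a, n a ≤ (y a).size := by
  obtain ⟨d, hd⟩ := hn
  have key : ∀ d, ∃ y : α → ℕ, PT y ∧ ∀ a, (sz a + 2) ^ d ≤ (y a).size := by
    intro d
    induction d with
    | zero => exact ⟨fun _ => 1, by fun_prop, by simp⟩
    | succ d ih =>
      obtain ⟨y, hy, h⟩ := ih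
      obtain ⟨z, hz, h'⟩ := exists_sz_le_size (α := α)
      refine ⟨_, smash hy hz, fun a => ?_⟩
      rw [Nat.size_pow, pow_succ]
      exact (Nat.mul_le_mul (h a) (h' a)).trans (Nat.le_succ _)
  obtain ⟨y, hy, h⟩ := key d
  exact ⟨y, hy, fun a => (hd a).trans (h a)⟩

/-- A sufficiently long recursion on notation idles once its counter has reached `n a`. -/
theorem natRec {n g : α → ℕ} {h : α → ℕ → ℕ → ℕ} (hn : PT n) (hn' : PolyBdd n) (hg : PT g)
    (hh : PT (fun p : α × ℕ × ℕ => h p.1 p.2.1 p.2.2)) (B : α → ℕ) (hB : PolyBdd B)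
    (hle : ∀ a k, k ≤ n a → (primRec (g a) (h a) k).size ≤ B a) :
    PT (fun a => primRec (g a) (h a) (n a)) := by
  obtain ⟨y, hy, hny⟩ := exists_le_size hn'
  have key : ∀ a k, primRec (g a) (fun k r => _root_.ifz (_root_.ltb k (n a)) r (h a k r)) k =
      primRec (g a) (h a) (Min.min k (n a)) := by
    intro a k
    induction k with
    | zero => simp [primRec]
    | succ k ih =>
      rw [primRec, ih]
      rcases lt_or_ge k (n a) with hk | hk
      · rw [min_eq_left hk.le, min_eq_left (show k + 1 ≤ n a from hk), primRec]
        simp [_root_.ifz, _root_.ltb, hk]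
      · rw [min_eq_right hk, min_eq_right (show n a ≤ k + 1 by omega)]
        simp [_root_.ifz, _root_.ltb, Nat.not_lt.mpr hk]
  have := natRec_size (g := g) (h := fun a k r => _root_.ifz (_root_.ltb k (n a)) r (h a k r)) hy hg
    (by fun_prop) B hB (by
      intro a k hk
      rw [key]
      exact hle a _ (min_le_right _ _))
  simpa only [key, min_eq_right (hny _)] using this

-- As many rounds as `x` has bits suffice even for huge `j`, because further shifts leave zero.
@[fun_prop]
theorem shiftRight {x j : α → ℕ} (hx : PT x) (hj : PT j) : PT (fun a => x a >>> j a) := by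
  have key : ∀ a k, primRec (x a) (fun k r => _root_.ifz (_root_.ltb k (j a)) r (r / 2)) k =
      x a >>> Min.min k (j a) := by
    intro a k
    induction k with
    | zero => simp [primRec]
    | succ k ih =>
      rw [primRec, ih]
      rcases lt_or_ge k (j a) with hk | hk
      · rw [min_eq_left hk.le, min_eq_left (show k + 1 ≤ j a from hk), Nat.shiftRight_succ]
        simp [_root_.ifz, _root_.ltb, hk]
      · rw [min_eq_right hk, min_eq_right (show j a ≤ k + 1 by omega)]
        simp [_root_.ifz, _root_.ltb, Nat.not_lt.mpr hk]
  have := natRec_size (g := x) (h := fun a k r => _root_.ifz (_root_.ltb k (j a)) r (r / 2)) hx hx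
    (by have : PT (fun p : α × ℕ × ℕ => p.2.2 / 2) := half (by fun_prop)
        fun_prop) (fun a => (x a).size) hx.polyBdd_size (by
      intro a k hk
      rw [key]
      exact Nat.size_le_size (by rw [Nat.shiftRight_eq_div_pow]; exact Nat.div_le_self _ _))
  simp only [key] at this
  convert this using 2 with a
  rcases le_total (x a).size (j a) with h | h
  · rw [min_eq_left h, Nat.shiftRight_eq_div_pow, Nat.shiftRight_eq_div_pow,
      Nat.div_eq_of_lt (Nat.size_le.mp h), Nat.div_eq_of_lt (Nat.lt_size_self _)]
  · rw [min_eq_right h]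

@[fun_prop]
theorem mod_two {x : α → ℕ} (hx : PT x) : PT (fun a => x a % 2) := by
  have h := half hx
  have : PT (fun a => x a - (x a / 2 + x a / 2)) := by fun_prop
  convert this using 2 with a
  omega

-- Horner's scheme over the bits of `y` from the top: after `k` rounds the accumulator is `x` times
-- the number formed by the top `k` bits.
@[fun_prop]
theorem mul {x y : α → ℕ} (hx : PT x) (hy : PT y) : PT (fun a => x a * y a) := by
  have key : ∀ a k, k ≤ (y a).size → primRec 0 (fun k r => r + r +
      _root_.ifz ((y a >>> ((y a).size - 1 - k)) % 2) 0 (x a)) k =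
        x a * (y a >>> ((y a).size - k)) := by
    intro a k
    induction k with
    | zero =>
      intro _
      rw [Nat.sub_zero, Nat.shiftRight_eq_div_pow, Nat.div_eq_of_lt (Nat.lt_size_self _)]
      rfl
    | succ k ih =>
      intro hk
      rw [primRec, ih (by omega)]
      have e : (y a).size - k = ((y a).size - 1 - k) + 1 := by omega
      rw [e, Nat.shiftRight_succ, show (y a).size - (k + 1) = (y a).size - 1 - k by omega]
      set z := y a >>> ((y a).size - 1 - k)
      have h1 := Nat.div_add_mod z 2
      have h2 : _root_.ifz (z % 2) 0 (x a) = x a * (z % 2) := by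
        unfold _root_.ifz
        rcases Nat.mod_two_eq_zero_or_one z with h | h <;> simp [h]
      rw [h2]
      conv_rhs => rw [← h1]
      ring
  have := natRec_size (g := fun _ => 0) (h := fun a k r => r + r +
    _root_.ifz ((y a >>> ((y a).size - 1 - k)) % 2) 0 (x a)) hy (by fun_prop) (by fun_prop)
    (fun a => (x a).size + (y a).size) (hx.polyBdd_size.add hy.polyBdd_size) (by
      intro a k hk
      rw [key a k hk]
      refine (size_mul_le _ _).trans (Nat.add_le_add le_rfl (Nat.size_le_size ?_))
      rw [Nat.shiftRight_eq_div_pow]; exact Nat.div_le_self _ _)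
  convert this using 2 with a
  rw [key a _ le_rfl]
  simp

/-- An index below `n a` adds at most `n a` to the size of the argument, so one polynomial bound
serves all terms of a sum, product or maximum. -/
theorem exists_size_bound {h : α → ℕ → ℕ} {n : α → ℕ} (hh : PT (fun p : α × ℕ => h p.1 p.2))
    (hn : PolyBdd n) : ∃ B : α → ℕ, PolyBdd B ∧ ∀ a k, k < n a → (h a k).size ≤ B a := by
  obtain ⟨d, hd⟩ := hh.polyBdd_size
  refine ⟨fun a => (sz a + n a + 2) ^ d,
    ((PolyBdd.sz.add hn).add (PolyBdd.const 2)).pow d, fun a k hk => ?_⟩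
  refine (hd (a, k)).trans (Nat.pow_le_pow_left ?_ d)
  have := size_le_self k
  simp only [sz_prod, sz_nat]
  omega

/-- The length of the range must be polynomially bounded in value, not only in bit length. For
padded words this still allows exponentially many terms. -/
theorem sum {n : α → ℕ} {h : α → ℕ → ℕ} (hn : PT n) (hn' : PolyBdd n)
    (hh : PT (fun p : α × ℕ => h p.1 p.2)) : PT (fun a => ∑ k ∈ Finset.range (n a), h a k) := by
  have key : ∀ a k, primRec 0 (fun k r => r + h a k) k = ∑ k ∈ Finset.range k, h a k := by
    intro a k; induction k with
    | zero => rfl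
    | succ k ih => rw [primRec, ih, Finset.sum_range_succ]
  obtain ⟨B, hB, hle⟩ := exists_size_bound hh hn'
  have hh' : PT (fun p : α × ℕ × ℕ => h p.1 p.2.1) :=
    hh.comp (f := fun p : α × ℕ × ℕ => (p.1, p.2.1)) (by fun_prop)
  have := natRec (g := fun _ => 0) (h := fun a k r => r + h a k) hn hn' (by fun_prop)
    (by fun_prop) (fun a => n a + B a) (hn'.add hB) (by
      intro a k hk
      rw [key, Nat.size_le, pow_add]
      have h1 : ∑ j ∈ Finset.range k, h a j ≤ k * 2 ^ B a := by
        refine (Finset.sum_le_card_nsmul _ _ (2 ^ B a) fun j hj => ?_).trans (by simp)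
        rw [Finset.mem_range] at hj
        exact (Nat.size_le.mp (hle a j (by omega))).le
      refine h1.trans_lt (Nat.mul_lt_mul_of_pos_right ?_ (by positivity))
      exact hk.trans_lt Nat.lt_two_pow_self)
  simpa only [key] using this

theorem prod {n : α → ℕ} {h : α → ℕ → ℕ} (hn : PT n) (hn' : PolyBdd n)
    (hh : PT (fun p : α × ℕ => h p.1 p.2)) : PT (fun a => ∏ k ∈ Finset.range (n a), h a k) := by
  have key : ∀ a k, primRec 1 (fun k r => r * h a k) k = ∏ k ∈ Finset.range k, h a k := by
    intro a k; induction k with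
    | zero => rfl
    | succ k ih => rw [primRec, ih, Finset.prod_range_succ]
  obtain ⟨B, hB, hle⟩ := exists_size_bound hh hn'
  have hh' : PT (fun p : α × ℕ × ℕ => h p.1 p.2.1) :=
    hh.comp (f := fun p : α × ℕ × ℕ => (p.1, p.2.1)) (by fun_prop)
  have := natRec (g := fun _ => 1) (h := fun a k r => r * h a k) hn hn' (by fun_prop)
    (by fun_prop) (fun a => n a * B a + 1) ((hn'.mul hB).add (PolyBdd.const 1)) (by
      intro a k hk
      rw [key]
      have h1 : ∏ j ∈ Finset.range k, h a j ≤ 2 ^ (k * B a) := by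
        refine (Finset.prod_le_prod' (g := fun _ => 2 ^ B a) fun j hj => ?_).trans ?_
        · rw [Finset.mem_range] at hj
          exact (Nat.size_le.mp (hle a j (by omega))).le
        · rw [Finset.prod_const, Finset.card_range, ← pow_mul, Nat.mul_comm]
      refine (Nat.size_le_size h1).trans (Nat.size_pow.le.trans ?_)
      exact Nat.add_le_add (Nat.mul_le_mul_right _ hk) le_rfl)
  simpa only [key] using this

theorem sup {n : α → ℕ} {h : α → ℕ → ℕ} (hn : PT n) (hn' : PolyBdd n)
    (hh : PT (fun p : α × ℕ => h p.1 p.2)) : PT (fun a => (Finset.range (n a)).sup (h a)) := by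
  have key : ∀ a k, primRec 0 (fun k r => Max.max r (h a k)) k = (Finset.range k).sup (h a) := by
    intro a k; induction k with
    | zero => rfl
    | succ k ih => rw [primRec, ih, Finset.range_add_one, Finset.sup_insert, max_comm]
  obtain ⟨B, hB, hle⟩ := exists_size_bound hh hn'
  have hh' : PT (fun p : α × ℕ × ℕ => h p.1 p.2.1) :=
    hh.comp (f := fun p : α × ℕ × ℕ => (p.1, p.2.1)) (by fun_prop)
  have := natRec (g := fun _ => 0) (h := fun a k r => Max.max r (h a k)) hn hn' (by fun_prop)
    (by fun_prop) (fun a => B a) hB (by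
      intro a k hk
      rw [key, Nat.size_le, Finset.sup_lt_iff (by positivity)]
      intro j hj
      rw [Finset.mem_range] at hj
      exact Nat.size_le.mp (hle a j (by omega)))
  simpa only [key] using this

theorem two_pow {n : α → ℕ} (hn : PT n) (hn' : PolyBdd n) : PT (fun a => 2 ^ n a) := by
  have := prod (h := fun _ _ => 2) hn hn' (by fun_prop)
  simpa using this

theorem mod_two_pow {x n : α → ℕ} (hx : PT x) (hn : PT n) (hn' : PolyBdd n) :
    PT (fun a => x a % 2 ^ n a) := by
  have h := two_pow hn hn'
  have : PT (fun a => x a - (x a >>> n a) * 2 ^ n a) := by fun_prop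
  convert this using 2 with a
  rw [Nat.shiftRight_eq_div_pow]
  have := Nat.div_add_mod' (x a) (2 ^ n a)
  omega

/-- The quotient is the number of `z < x` with `(z + 1) * y ≤ x`. Counting them takes `x` rounds,
hence the bound on the value of `x`. -/
theorem div {x y : α → ℕ} (hx : PT x) (hy : PT y) (hx' : PolyBdd x) :
    PT (fun a => x a / y a) := by
  have key : PT (fun a => _root_.ifz (y a) 0 (∑ z ∈ Finset.range (x a),
      (1 - _root_.ltb (x a) ((z + 1) * y a)))) := by
    have := sum (h := fun a z => 1 - _root_.ltb (x a) ((z + 1) * y a)) hx hx' (by fun_prop)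
    fun_prop
  convert key using 2 with a
  unfold _root_.ifz
  split_ifs with h
  · simp [h]
  · have h1 : ∀ z, 1 - _root_.ltb (x a) ((z + 1) * y a) = if z < x a / y a then 1 else 0 := by
      intro z
      have h2 := Nat.le_div_iff_mul_le (x := z + 1) (y := x a) (Nat.pos_of_ne_zero h)
      unfold _root_.ltb
      by_cases h3 : x a < (z + 1) * y a
      · rw [if_pos h3, if_neg (by rw [← Nat.succ_le_iff, Nat.succ_eq_add_one, h2]; omega)]
      · rw [if_neg h3, if_pos (by rw [← Nat.succ_le_iff, Nat.succ_eq_add_one, h2]; omega)]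
    have h4 := Nat.div_le_self (x a) (y a)
    simp only [h1, Finset.sum_boole]
    have h5 : (Finset.range (x a)).filter (· < x a / y a) = Finset.range (x a / y a) := by
      ext z
      simp only [Finset.mem_filter, Finset.mem_range]
      omega
    rw [h5]
    simp

theorem mod {x y : α → ℕ} (hx : PT x) (hy : PT y) (hx' : PolyBdd x) :
    PT (fun a => x a % y a) := by
  have h := div hx hy hx'
  have : PT (fun a => x a - (x a / y a) * y a) := by fun_prop
  convert this using 2 with a
  have := Nat.div_add_mod' (x a) (y a)
  omega

end PT

/-! ### Exponential time from polynomial time with padding -/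

/-- A word as a number, with a leading one. -/
def code (w : List Bool) : ℕ := val (w ++ [true])

theorem bits_code (w : List Bool) : (code w).bits = w ++ [true] := by
  unfold code
  induction w with
  | nil => simp [val]
  | cons b w ih =>
    have h0 : val (w ++ [true]) ≠ 0 := by
      intro h
      rw [h, Nat.zero_bits] at ih
      simp at ih
    rw [List.cons_append, val]
    cases b
    · simp [Nat.bit0_bits _ h0, ih]
    · rw [Nat.add_comm]
      simp [Nat.bit1_bits, ih]

theorem size_code (w : List Bool) : (code w).size = w.length + 1 := by
  rw [← Nat.size_eq_bits_len, bits_code]; simp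

/-- A number of exponential length. -/
def pad (w : List Bool) : ℕ := 2 ^ 2 ^ ((w.length + 1) * (w.length + 1) + 1)

/-- The padding trick: with `pad w` as a second component, the size of a word is exponential in its
length, so `PT` for functions of words means exponential time. -/
instance : Ctx (List Bool) := ⟨2, fun w => [code w, pad w], fun _ => rfl⟩

theorem sz_word (w : List Bool) :
    sz w = w.length + 1 + (2 ^ ((w.length + 1) * (w.length + 1) + 1) + 1) := by
  simp [sz, toList, size_code, pad, Nat.size_pow]

theorem pt_code : PT code := by
  have := PT.component (α := List Bool) 0 (by decide)
  simpa [toList] using this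

theorem PolyBdd.le_two_pow {T : List Bool → ℕ} (hT : PolyBdd T) :
    ∃ p : Polynomial ℕ, ∀ w, T w ≤ 2 ^ p.eval w.length := by
  obtain ⟨d, hd⟩ := hT
  refine ⟨(((Polynomial.X + 1) * (Polynomial.X + 1) + 4 : Polynomial ℕ)) * d, fun w => ?_⟩
  refine (hd w).trans ?_
  rw [Polynomial.eval_mul, Polynomial.eval_natCast, pow_mul]
  refine Nat.pow_le_pow_left ?_ d
  rw [sz_word]
  have h1 : (((Polynomial.X + 1) * (Polynomial.X + 1) + 4 : Polynomial ℕ)).eval w.length =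
      (w.length + 1) * (w.length + 1) + 4 := by simp
  rw [h1]
  set m := (w.length + 1) * (w.length + 1)
  have h2 : w.length + 1 ≤ m := Nat.le_mul_self _
  have h3 : m < 2 ^ m := Nat.lt_two_pow_self
  simp only [pow_succ]
  omega

theorem polyBdd_two_pow : PolyBdd (fun w : List Bool => 2 ^ ((w.length + 1) * (w.length + 1))) := by
  refine PolyBdd.sz.mono fun w => ?_
  rw [sz_word, pow_succ]
  omega

/-- The padding is obtained by squaring `2` repeatedly, once per bit of a number of `(w.length + 1)
* (w.length + 1) + 1` bits. The time is not polynomial in the size of `code w`, but it is polynomial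
in the size of the padded word. -/
theorem comp_pad : ∃ (f T : ℕ → ℕ), Comp f T ∧ (∀ w, f (code w) = pad w) ∧
    PolyBdd (fun w : List Bool => T (code w)) := by
  have h1 : PT (fun W : ℕ => 2 ^ (W.size * W.size)) := PT.smash (by fun_prop) (by fun_prop)
  have h2 : PT (fun _ : ℕ => 2) := by fun_prop
  have h3 : PT (fun p : ℕ × ℕ × ℕ => p.2.2 * p.2.2) := by fun_prop
  obtain ⟨T1, hT1, h1⟩ := pt_iff.mp h1
  obtain ⟨T2, hT2, h2⟩ := pt_iff.mp h2
  obtain ⟨T3, ⟨d, hd⟩, h3⟩ := pt_iff.mp h3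
  have key : ∀ k, primRec 2 (fun _ r => r * r) k = 2 ^ 2 ^ k := by
    intro k
    induction k with
    | zero => simp [primRec]
    | succ k ih => rw [primRec, ih, ← pow_add, pow_succ 2 k, mul_two]
  refine ⟨_, _, h1.natRec (h := fun _ _ r => r * r) h2 h3, fun w => ?_, ?_⟩
  · rw [key, size_code, Nat.size_pow, pad]
  · simp only [key, size_code, Nat.size_pow]
    have hcode : PolyBdd (fun w : List Bool => sz (code w)) := by
      simpa using pt_code.polyBdd_size
    have hs : PolyBdd (fun w : List Bool => (w.length + 1) * (w.length + 1) + 1) := by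
      refine (polyBdd_two_pow.add (PolyBdd.const 1)).mono fun w => ?_
      exact Nat.add_le_add Nat.lt_two_pow_self.le le_rfl
    have hsz := PolyBdd.sz (α := List Bool)
    refine (hT1.comp hcode).add ((hT2.comp hcode).add ((PolyBdd.const 0).add (PolyBdd.add
      (PolyBdd.add ?_ (PolyBdd.const 1)) (PolyBdd.add ?_ ?_))))
    · refine (hs.mul ((((hsz.mul (PolyBdd.const 2)).add (hs.add (PolyBdd.const 2))).pow d).add
        (((hsz.mul (PolyBdd.const 8)).add (hs.mul (PolyBdd.const 14))).add
          (PolyBdd.const 40)))).mono fun w => ?_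
      refine (Finset.sum_le_card_nsmul _ _ ((sz w * 2 +
        ((w.length + 1) * (w.length + 1) + 1 + 2)) ^ d + (sz w * 8 +
          ((w.length + 1) * (w.length + 1) + 1) * 14 + 40)) fun k hk => ?_).trans (by simp)
      rw [Finset.mem_range] at hk
      have e1 := size_le_self k
      -- The accumulator after any round has at most as many bits as the final padding.
      have e2 : 2 ^ (k + 1) + 1 ≤ sz w := by
        rw [sz_word]
        have := Nat.pow_le_pow_right (show 2 > 0 by omega) (show k + 1 ≤ _ from hk)
        omega
      have e3 : 2 ^ k ≤ 2 ^ (k + 1) := Nat.pow_le_pow_right (by omega) (by omega)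
      have e4 : w.length + 1 ≤ sz w := by rw [sz_word]; exact Nat.le_add_right _ _
      have h4 : sz (code w, k, 2 ^ 2 ^ k) + 2 ≤
          sz w * 2 + ((w.length + 1) * (w.length + 1) + 1 + 2) := by
        simp only [sz_prod, sz_nat, Nat.size_pow, size_code]
        omega
      have h5 := (hd (code w, k, 2 ^ 2 ^ k)).trans (Nat.pow_le_pow_left h4 d)
      omega
    · refine (hs.add (PolyBdd.const 1)).mono fun w => Nat.add_le_add (size_le_self _) le_rfl
    · refine ((hsz.mul (PolyBdd.const 4)).add (PolyBdd.const 3)).mono fun w => ?_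
      rw [sz_word]
      omega

theorem runs_init (w : List Bool) :
    Runs ((moveRev 0 1).seq ((push 0 true).seq (moveRev 1 0))) (single w) (St [code w])
      (4 * w.length + 3) := by
  refine ((runs_moveRev (a := 0) (b := 1) (by omega) (single w)).seq
      ((Runs.push _ 0 true).seq (runs_moveRev (a := 1) (b := 0) (by omega) _))).congr rfl ?_ ?_
  · funext i
    rcases i with _ | _ | i <;> simp [single, St, bits_code]
  · simp [single]
    omega

theorem runs_final (W P : ℕ) (b : Bool) :
    Runs ((clear 0).seq ((clear 1).seq (case 2 (push 0 false) skip (push 0 true))))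
      (St [W, P, b.toNat]) (single [b]) (W.size + P.size + 4) := by
  refine ((runs_clear 0 _).seq ((runs_clear 1 _).seq
    (S'' := single [b]) (T' := 2) ?_)).congr rfl rfl ?_
  · cases b
    · refine (Runs.caseN (by simp [St]) (Runs.push _ _ _)).congr rfl ?_ le_rfl
      funext i
      rcases i with _ | _ | _ | i <;> simp [single, St]
    · refine (Runs.caseB (b := true) (l := []) (by simp [St]) (Runs.push _ _ _)).congr rfl ?_ le_rfl
      funext i
      rcases i with _ | _ | _ | i <;> simp [single, St]
  · simp [St, Nat.size_eq_bits_len]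
    omega

/-- The program marks the end of the word, computes the padding, then the truth value, and clears
the two auxiliary registers. Its time is polynomial in the padded size. -/
theorem inEXPTIME_of_pt {L : Language Bool} {f : List Bool → ℕ} (hf : PT f)
    (hL : ∀ w, f w ≠ 0 ↔ w ∈ L) : InEXPTIME L := by
  classical
  obtain ⟨fp, Tp, hp, hfp, hTp⟩ := comp_pad
  -- Normalised to a truth value, so that the answer register is empty or holds a single one.
  have hf' : PT (fun w => ifz (f w) 0 1) := by fun_prop
  obtain ⟨Tf, hTf, hf'⟩ := pt_iff.mp hf'
  obtain ⟨cp, hcp⟩ := hp [0] 1 rfl (by simp)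
  obtain ⟨cf, hcf⟩ := hf' [0, 1] 2 rfl (by simp)
  have hlen : PolyBdd (fun w : List Bool => w.length) :=
    pt_code.polyBdd_size.mono fun w => by rw [size_code]; omega
  have hpad : PolyBdd (fun w : List Bool => (pad w).size) :=
    PolyBdd.sz.mono fun w => by simp [sz, toList]
  obtain ⟨p, hp⟩ := ((((PolyBdd.const 4).mul hlen).add (PolyBdd.const 3)).add
    (hTp.add (hTf.add ((hlen.add (PolyBdd.const 1)).add hpad |>.add
      (PolyBdd.const 4))))).le_two_pow
  refine inEXPTIME_of_run _ p fun w => Runs.mono ((runs_init w).seq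
    ((hcp (code w) [code w] rfl (by simp [toList])).seq (Runs.seq (c := cf)
      (S' := St [code w, pad w, (decide (w ∈ L)).toNat]) ?_
      (runs_final (code w) (pad w) (decide (w ∈ L)))))) (by rw [size_code]; exact hp w)
  refine (hcf w [code w, pad w] rfl (by simp [toList])).congr ?_ ?_ le_rfl
  · rw [hfp]; rfl
  · have : ifz (f w) 0 1 = (decide (w ∈ L)).toNat := by
      by_cases h : f w = 0
      · have hw : w ∉ L := fun h' => (hL w).mpr h' h
        simp [ifz, h, hw]
      · have hw : w ∈ L := (hL w).mp h
        simp [ifz, h, hw]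
    simp only [this]
    rfl

/-! ### Reading words -/

namespace Word

/-- A bound for all indices that occur for the word `w`. -/
def cap (w : List Bool) : ℕ := 2 ^ ((w.length + 1) * (w.length + 1))

/-- An index, cut off at `cap w`. -/
def clamp (w : List Bool) (x : ℕ) : ℕ := min x (cap w)

/-- The bit at position `p`, or zero beyond the end of the word. -/
def bitAt (w : List Bool) (p : ℕ) : ℕ := (w.getD p false).toNat

/-- The number of ones from position `p` on, that is, the number written there in unary. -/
def lead (w : List Bool) (p : ℕ) : ℕ :=
  ∑ j ∈ Finset.range w.length, ∏ i ∈ Finset.range (clamp w (j + 1)), bitAt w (p + i)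

/-- The position after `k` unary numbers from position `p` on. -/
def skip (w : List Bool) (p k : ℕ) : ℕ := primRec p (fun _ r => r + lead w r + 1) (clamp w k)

/-- The binary number with `l` bits at position `p`. -/
def num (w : List Bool) (p l : ℕ) : ℕ :=
  ∑ i ∈ Finset.range (clamp w l), bitAt w (p + i) * 2 ^ clamp w i

/-- The binary number at position `p` that is preceded by its length in unary. -/
def binVal (w : List Bool) (p : ℕ) : ℕ := num w (p + lead w p + 1) (lead w p)

/-- The position after a binary number that is preceded by its length. -/
def binEnd (w : List Bool) (p : ℕ) : ℕ := p + 2 * lead w p + 1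

theorem bitAt_le (w : List Bool) (p : ℕ) : bitAt w p ≤ 1 := Bool.toNat_le _

theorem lead_le (w : List Bool) (p : ℕ) : lead w p ≤ w.length := by
  refine (Finset.sum_le_card_nsmul _ _ 1 fun j _ => ?_).trans (by simp)
  exact Finset.prod_le_one' fun i _ => bitAt_le _ _

theorem clamp_le (w : List Bool) (x : ℕ) : clamp w x ≤ cap w := min_le_right _ _

theorem clamp_of_le {w : List Bool} {x : ℕ} (h : x ≤ cap w) : clamp w x = x := min_eq_left h

theorem sq_le_cap (w : List Bool) : (w.length + 1) * (w.length + 1) ≤ cap w :=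
  Nat.lt_two_pow_self.le

theorem len_le_cap (w : List Bool) : w.length ≤ cap w :=
  ((Nat.le_succ _).trans (Nat.le_mul_self _)).trans (sq_le_cap w)

theorem clamp_of_le_length {w : List Bool} {x : ℕ} (h : x ≤ w.length) : clamp w x = x :=
  clamp_of_le (h.trans (len_le_cap w))

end Word

open Word

theorem val_shiftRight (l : List Bool) (p : ℕ) : val l >>> p % 2 = (l.getD p false).toNat := by
  induction l generalizing p with
  | nil => simp [val]
  | cons b l ih =>
    cases p with
    | zero => cases b <;> simp [val]
    | succ p =>
      have : val (b :: l) >>> (p + 1) = val l >>> p := by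
        rw [Nat.add_comm, Nat.shiftRight_add]
        congr 1
        cases b
        · simp [val, Nat.shiftRight_succ]
        · simp [val, Nat.shiftRight_succ]; omega
      rw [this, ih]
      simp

namespace PolyBdd

theorem of_length {w : α → List Bool} (hw : PT w) {f : α → ℕ} (h : ∀ a, f a ≤ (w a).length) :
    PolyBdd f :=
  ((pt_code.comp hw).polyBdd_size).mono fun a => by
    rw [size_code]; exact (h a).trans (Nat.le_succ _)

/-- The cap is exponential in the length of the word, but no larger than its padded size. -/
theorem of_cap {w : α → List Bool} (hw : PT w) {f : α → ℕ} (h : ∀ a, f a ≤ cap (w a)) :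
    PolyBdd f :=
  (polyBdd_two_pow.comp_pt hw).mono h

end PolyBdd

/-! ### Reading words in polynomial time -/

namespace PT

variable {w : α → List Bool} {p k x : α → ℕ}

@[fun_prop]
theorem length (hw : PT w) : PT (fun a => (w a).length) := by
  have h := pt_code.comp hw
  have : PT (fun a => (code (w a)).size - 1) := by fun_prop
  convert this using 2 with a
  rw [size_code]; rfl

@[fun_prop]
theorem cap (hw : PT w) : PT (fun a => cap (w a)) := by
  refine two_pow (by fun_prop) (PolyBdd.of_cap hw fun _ => sq_le_cap _)

@[fun_prop]
theorem clamp (hw : PT w) (hx : PT x) : PT (fun a => clamp (w a) (x a)) :=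
  min hx (cap hw)

/-- Ranges and exponents must be bounded on malformed words as well. Clamping achieves this; for
encodings it is removed again by `clamp_of_le`. -/
theorem polyBdd_clamp (hw : PT w) (x : α → ℕ) : PolyBdd (fun a => Word.clamp (w a) (x a)) :=
  PolyBdd.of_cap hw fun _ => clamp_le _ _

@[fun_prop]
theorem bitAt (hw : PT w) (hp : PT p) : PT (fun a => bitAt (w a) (p a)) := by
  have h := pt_code.comp hw
  have : PT (fun a => _root_.ifz (_root_.ltb (p a) (w a).length) 0 (code (w a) >>> p a % 2)) := by
    fun_prop
  convert this using 2 with a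
  unfold _root_.ifz _root_.ltb
  by_cases h : p a < (w a).length
  · rw [if_pos h, if_neg one_ne_zero, code, val_shiftRight, Word.bitAt]
    simp [List.getElem?_append_left h]
  · rw [if_neg h, if_pos rfl, Word.bitAt]
    simp [List.getElem?_eq_none (not_lt.mp h)]

@[fun_prop]
theorem lead (hw : PT w) (hp : PT p) : PT (fun a => lead (w a) (p a)) := by
  refine sum (by fun_prop) (PolyBdd.of_length hw fun _ => le_rfl) ?_
  exact prod (by fun_prop) (polyBdd_clamp (by fun_prop) _) (by fun_prop)

theorem two_pow_clamp (hw : PT w) (hx : PT x) : PT (fun a => 2 ^ Word.clamp (w a) (x a)) :=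
  two_pow (clamp hw hx) (polyBdd_clamp hw x)

@[fun_prop]
theorem num (hw : PT w) (hp : PT p) (hk : PT k) : PT (fun a => num (w a) (p a) (k a)) := by
  refine sum (by fun_prop) (polyBdd_clamp hw _) ?_
  have := two_pow_clamp (α := α × ℕ) (w := fun q => w q.1) (x := fun q => q.2) (by fun_prop)
    (by fun_prop)
  fun_prop

@[fun_prop]
theorem binVal (hw : PT w) (hp : PT p) : PT (fun a => binVal (w a) (p a)) := by
  unfold Word.binVal
  fun_prop

@[fun_prop]
theorem binEnd (hw : PT w) (hp : PT p) : PT (fun a => binEnd (w a) (p a)) := by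
  unfold Word.binEnd
  fun_prop

@[fun_prop]
theorem skip (hw : PT w) (hp : PT p) (hk : PT k) : PT (fun a => skip (w a) (p a) (k a)) := by
  -- Each round advances by at most `w.length + 1`, so positions grow only linearly in the number of
  -- rounds.
  have key : ∀ (w : List Bool) (p k : ℕ), primRec p (fun _ r => r + Word.lead w r + 1) k ≤
      p + k * (w.length + 1) := by
    intro w p k
    induction k with
    | zero => simp [primRec]
    | succ k ih =>
      rw [primRec]
      have := lead_le w (primRec p (fun _ r => r + Word.lead w r + 1) k)
      rw [Nat.succ_mul]
      omega
  have hl : PT (fun a => (w a).length) := by fun_prop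
  refine natRec (h := fun a _ r => r + Word.lead (w a) r + 1) (by fun_prop) (polyBdd_clamp hw _)
    hp (by fun_prop) (fun a => (p a).size + Word.cap (w a) * ((w a).length + 1) + 1)
    ((hp.polyBdd_size.add ((PolyBdd.of_cap hw fun _ => le_rfl).mul
      ((PolyBdd.of_length hw fun _ => le_rfl).add (PolyBdd.const 1)))).add (PolyBdd.const 1)) ?_
  intro a k' hk'
  refine (Nat.size_le_size (key _ _ _)).trans ((size_add_le _ _).trans ?_)
  have h1 := size_le_self (k' * ((w a).length + 1))
  have h2 := Nat.mul_le_mul_right ((w a).length + 1) (hk'.trans (clamp_le (w a) (k a)))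
  omega

end PT

/-! ### The data of a game and a profile of transducers -/

namespace Word

/-- The position of the number of states. -/
def posStates (w : List Bool) : ℕ := binEnd w 0
/-- The number of states. -/
def nS (w : List Bool) : ℕ := lead w (posStates w)
/-- The position of the initial state. -/
def posInit (w : List Bool) : ℕ := posStates w + nS w + 1
/-- The initial state. -/
def ini (w : List Bool) : ℕ := lead w (posInit w)
/-- The position of the number of agents. -/
def posAgents (w : List Bool) : ℕ := posInit w + ini w + 1
/-- The number of agents. -/
def nA (w : List Bool) : ℕ := lead w (posAgents w)
/-- The position of the numbers of actions. -/
def posActs (w : List Bool) : ℕ := posAgents w + nA w + 1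
/-- The number of actions of agent `i`. -/
def act (w : List Bool) (i : ℕ) : ℕ := lead w (skip w (posActs w) i)
/-- The position of the playing function. -/
def posPlay (w : List Bool) : ℕ := skip w (posActs w) (nA w)
/-- Whether agent `i` is active at `v`. -/
def play (w : List Bool) (v i : ℕ) : ℕ := bitAt w (posPlay w + (v * nA w + i))
/-- The position of the number of bits of the probabilities. -/
def posPrec (w : List Bool) : ℕ := posPlay w + nS w * nA w
/-- The number of bits of the probabilities. -/
def prec (w : List Bool) : ℕ := lead w (posPrec w)
/-- The denominator of the probabilities. -/
def den (w : List Bool) : ℕ := 2 ^ (prec w - 1)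
/-- The number of actions of agent `i` if it is active at `v`, and one otherwise. -/
def radix (w : List Bool) (v i : ℕ) : ℕ := ifz (play w v i) 1 (act w i)
/-- The number of joint actions at `v`. -/
def nJoint (w : List Bool) (v : ℕ) : ℕ := ∏ i ∈ Finset.range (nA w), radix w v i
/-- The position of the transitions from `v`. -/
def posTrans (w : List Bool) (v : ℕ) : ℕ :=
  posPrec w + prec w + 1 + ∑ u ∈ Finset.range (clamp w v), nJoint w u * (nS w * prec w)
/-- The probability of the transition from `v` to `v'` by the joint action number `m`. -/
def tr (w : List Bool) (v m v' : ℕ) : ℕ :=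
  num w (posTrans w v + (m * nS w + v') * prec w) (prec w)
/-- The position of the goals. -/
def posGoal (w : List Bool) : ℕ := posTrans w (nS w)
/-- Whether `v` is a goal of agent `i`. -/
def isGoal (w : List Bool) (i v : ℕ) : ℕ := bitAt w (posGoal w + (i * nS w + v))
/-- The position of the horizon. -/
def posHor (w : List Bool) : ℕ := posGoal w + nA w * nS w
/-- The horizon. -/
def hor (w : List Bool) : ℕ := binVal w (posHor w)

/-- The number of states of the transducer at position `t`. -/
def tS (w : List Bool) (t : ℕ) : ℕ := lead w t
/-- The initial state of the transducer at position `t`. -/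
def tI (w : List Bool) (t : ℕ) : ℕ := lead w (t + tS w t + 1)
/-- The position of the transition function of the transducer at position `t`. -/
def posNext (w : List Bool) (t : ℕ) : ℕ := t + tS w t + 1 + tI w t + 1
/-- The transition function of the transducer at position `t`. -/
def nx (w : List Bool) (t s v : ℕ) : ℕ := lead w (skip w (posNext w t) (s * nS w + v))
/-- The position of the output function of the transducer at position `t`. -/
def posOut (w : List Bool) (t : ℕ) : ℕ := skip w (posNext w t) (tS w t * nS w)
/-- The output function of the transducer of agent `i` at position `t`. -/
def ou (w : List Bool) (t i s v a : ℕ) : ℕ :=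
  num w (posOut w t + ((s * nS w + v) * act w i + a) * prec w) (prec w)
/-- The position after the transducer of agent `i` at position `t`. -/
def tEnd (w : List Bool) (t i : ℕ) : ℕ := posOut w t + tS w t * nS w * act w i * prec w
/-- The position of the transducer of agent `i`. -/
def posT (w : List Bool) (i : ℕ) : ℕ :=
  primRec (binEnd w (posHor w)) (fun j r => tEnd w r j) (clamp w i)

theorem num_lt (w : List Bool) (p l : ℕ) : num w p l < 2 ^ clamp w l := by
  have key : ∀ l ≤ cap w, ∑ i ∈ Finset.range l, bitAt w (p + i) * 2 ^ clamp w i < 2 ^ l := by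
    intro l
    induction l with
    | zero => simp
    | succ l ih =>
      intro hl
      rw [Finset.sum_range_succ, clamp_of_le (by omega), pow_succ]
      have h1 := ih (by omega)
      have h2 := Nat.mul_le_mul_right (2 ^ l) (bitAt_le w (p + l))
      omega
  exact key _ (clamp_le _ _)

theorem nS_le (w : List Bool) : nS w ≤ w.length := lead_le _ _
theorem nA_le (w : List Bool) : nA w ≤ w.length := lead_le _ _
theorem act_le (w : List Bool) (i : ℕ) : act w i ≤ w.length := lead_le _ _
theorem prec_le (w : List Bool) : prec w ≤ w.length := lead_le _ _
theorem tS_le (w : List Bool) (t : ℕ) : tS w t ≤ w.length := lead_le _ _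
theorem tI_le (w : List Bool) (t : ℕ) : tI w t ≤ w.length := lead_le _ _

/-- The square in the exponent of `cap` leaves room for all tuples of at most `w.length` entries
between zero and `w.length`. This covers the joint actions. -/
theorem length_pow_le (w : List Bool) {k : ℕ} (hk : k ≤ w.length) :
    (w.length + 1) ^ k ≤ cap w := by
  have h1 : w.length + 1 ≤ 2 ^ (w.length + 1) := Nat.lt_two_pow_self.le
  refine (Nat.pow_le_pow_left h1 k).trans ?_
  rw [← pow_mul]
  exact Nat.pow_le_pow_right (by omega) (Nat.mul_le_mul_left _ (by omega))

theorem nJoint_le (w : List Bool) (v : ℕ) : nJoint w v ≤ cap w := by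
  refine le_trans ?_ (length_pow_le w (nA_le w))
  refine (Finset.prod_le_prod' (g := fun _ => w.length + 1) fun i _ => ?_).trans (by simp)
  unfold radix ifz
  have := act_le w i
  split_ifs <;> omega

theorem hor_lt (w : List Bool) : hor w < cap w := by
  refine (num_lt _ _ _).trans_le ?_
  rw [clamp_of_le_length (lead_le _ _)]
  refine Nat.pow_le_pow_right (by omega) ((lead_le _ _).trans ?_)
  exact (Nat.le_succ _).trans (Nat.le_mul_self _)

end Word

/-! ### Access to the data of a game in polynomial time -/

namespace PT

variable {w : α → List Bool} {i v a t s m v' : α → ℕ}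

@[fun_prop]
theorem posStates (hw : PT w) : PT (fun a => posStates (w a)) := by
  unfold Word.posStates; fun_prop
@[fun_prop]
theorem nS (hw : PT w) : PT (fun a => nS (w a)) := by
  unfold Word.nS; fun_prop
@[fun_prop]
theorem posInit (hw : PT w) : PT (fun a => posInit (w a)) := by
  unfold Word.posInit; fun_prop
@[fun_prop]
theorem ini (hw : PT w) : PT (fun a => ini (w a)) := by
  unfold Word.ini; fun_prop
@[fun_prop]
theorem posAgents (hw : PT w) : PT (fun a => posAgents (w a)) := by
  unfold Word.posAgents; fun_prop
@[fun_prop]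
theorem nA (hw : PT w) : PT (fun a => nA (w a)) := by
  unfold Word.nA; fun_prop
@[fun_prop]
theorem posActs (hw : PT w) : PT (fun a => posActs (w a)) := by
  unfold Word.posActs; fun_prop
@[fun_prop]
theorem act (hw : PT w) (hi : PT i) : PT (fun a => act (w a) (i a)) := by
  unfold Word.act; fun_prop
@[fun_prop]
theorem posPlay (hw : PT w) : PT (fun a => posPlay (w a)) := by
  unfold Word.posPlay; fun_prop
@[fun_prop]
theorem play (hw : PT w) (hv : PT v) (hi : PT i) : PT (fun a => play (w a) (v a) (i a)) := by
  unfold Word.play; fun_prop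
@[fun_prop]
theorem posPrec (hw : PT w) : PT (fun a => posPrec (w a)) := by
  unfold Word.posPrec; fun_prop
@[fun_prop]
theorem prec (hw : PT w) : PT (fun a => prec (w a)) := by
  unfold Word.prec; fun_prop
@[fun_prop]
theorem den (hw : PT w) : PT (fun a => den (w a)) := by
  refine two_pow (by fun_prop) (PolyBdd.of_length hw fun a => ?_)
  exact (Nat.sub_le _ _).trans (prec_le _)
@[fun_prop]
theorem radix (hw : PT w) (hv : PT v) (hi : PT i) : PT (fun a => radix (w a) (v a) (i a)) := by
  unfold Word.radix; fun_prop

theorem polyBdd_nS (hw : PT w) : PolyBdd (fun a => Word.nS (w a)) :=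
  PolyBdd.of_length hw fun _ => nS_le _
theorem polyBdd_nA (hw : PT w) : PolyBdd (fun a => Word.nA (w a)) :=
  PolyBdd.of_length hw fun _ => nA_le _
theorem polyBdd_prec (hw : PT w) : PolyBdd (fun a => Word.prec (w a)) :=
  PolyBdd.of_length hw fun _ => prec_le _
theorem polyBdd_act (hw : PT w) (i : α → ℕ) : PolyBdd (fun a => Word.act (w a) (i a)) :=
  PolyBdd.of_length hw fun _ => act_le _ _
theorem polyBdd_tS (hw : PT w) (t : α → ℕ) : PolyBdd (fun a => Word.tS (w a) (t a)) :=
  PolyBdd.of_length hw fun _ => tS_le _ _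
theorem polyBdd_nJoint (hw : PT w) (v : α → ℕ) : PolyBdd (fun a => Word.nJoint (w a) (v a)) :=
  PolyBdd.of_cap hw fun _ => nJoint_le _ _
theorem polyBdd_hor (hw : PT w) : PolyBdd (fun a => Word.hor (w a)) :=
  PolyBdd.of_cap hw fun _ => (hor_lt _).le

@[fun_prop]
theorem nJoint (hw : PT w) (hv : PT v) : PT (fun a => nJoint (w a) (v a)) :=
  prod (by fun_prop) (polyBdd_nA hw) (by fun_prop)
@[fun_prop]
theorem posTrans (hw : PT w) (hv : PT v) : PT (fun a => posTrans (w a) (v a)) := by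
  have := sum (h := fun a u => Word.nJoint (w a) u * (Word.nS (w a) * Word.prec (w a)))
    (clamp hw hv) (polyBdd_clamp hw _) (by fun_prop)
  unfold Word.posTrans; fun_prop
@[fun_prop]
theorem tr (hw : PT w) (hv : PT v) (hm : PT m) (hv' : PT v') :
    PT (fun a => tr (w a) (v a) (m a) (v' a)) := by
  unfold Word.tr; fun_prop
@[fun_prop]
theorem posGoal (hw : PT w) : PT (fun a => posGoal (w a)) := by
  unfold Word.posGoal; fun_prop
@[fun_prop]
theorem isGoal (hw : PT w) (hi : PT i) (hv : PT v) : PT (fun a => isGoal (w a) (i a) (v a)) := by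
  unfold Word.isGoal; fun_prop
@[fun_prop]
theorem posHor (hw : PT w) : PT (fun a => posHor (w a)) := by
  unfold Word.posHor; fun_prop
@[fun_prop]
theorem hor (hw : PT w) : PT (fun a => hor (w a)) := by
  unfold Word.hor; fun_prop
@[fun_prop]
theorem tS (hw : PT w) (ht : PT t) : PT (fun a => tS (w a) (t a)) := by
  unfold Word.tS; fun_prop
@[fun_prop]
theorem tI (hw : PT w) (ht : PT t) : PT (fun a => tI (w a) (t a)) := by
  unfold Word.tI; fun_prop
@[fun_prop]
theorem posNext (hw : PT w) (ht : PT t) : PT (fun a => posNext (w a) (t a)) := by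
  unfold Word.posNext; fun_prop
@[fun_prop]
theorem nx (hw : PT w) (ht : PT t) (hs : PT s) (hv : PT v) :
    PT (fun a => nx (w a) (t a) (s a) (v a)) := by
  unfold Word.nx; fun_prop
@[fun_prop]
theorem posOut (hw : PT w) (ht : PT t) : PT (fun a => posOut (w a) (t a)) := by
  unfold Word.posOut; fun_prop
@[fun_prop]
theorem ou (hw : PT w) (ht : PT t) (hi : PT i) (hs : PT s) (hv : PT v) (ha : PT a) :
    PT (fun b => ou (w b) (t b) (i b) (s b) (v b) (a b)) := by
  unfold Word.ou; fun_prop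
@[fun_prop]
theorem tEnd (hw : PT w) (ht : PT t) (hi : PT i) : PT (fun a => tEnd (w a) (t a) (i a)) := by
  unfold Word.tEnd; fun_prop

theorem skip_le (w : List Bool) (p k : ℕ) : Word.skip w p k ≤ p + Word.clamp w k * (w.length + 1) := by
  unfold Word.skip
  induction Word.clamp w k with
  | zero => simp [primRec]
  | succ k ih =>
    rw [primRec]
    have := lead_le w (primRec p (fun _ r => r + Word.lead w r + 1) k)
    rw [Nat.succ_mul]
    omega

/-- The advance is bounded independently of the position `t`, also on malformed words. Iterating
over the transducers therefore adds these bounds instead of compounding them. -/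
theorem tEnd_le (w : List Bool) (t i : ℕ) :
    Word.tEnd w t i ≤ t + (w.length + Word.cap w + 4) * (w.length + Word.cap w + 4) *
      ((w.length + Word.cap w + 4) * (w.length + Word.cap w + 4)) := by
  set n := w.length + Word.cap w + 4 with hn
  have h1 := skip_le w (Word.posNext w t) (Word.tS w t * Word.nS w)
  have h2 := tS_le w t
  have h3 := tI_le w t
  have h4 := nS_le w
  have h5 := act_le w i
  have h6 := prec_le w
  have h7 : Word.clamp w (Word.tS w t * Word.nS w) * (w.length + 1) ≤ (n - 4) * n :=
    Nat.mul_le_mul ((clamp_le _ _).trans (by omega)) (by omega)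
  have h8 : Word.tS w t * Word.nS w * Word.act w i * Word.prec w ≤ (n - 4) * n * n * n :=
    Nat.mul_le_mul (Nat.mul_le_mul (Nat.mul_le_mul (by omega) (by omega)) (by omega)) (by omega)
  unfold Word.tEnd Word.posOut
  unfold Word.posNext at h1 ⊢
  obtain ⟨q, hq⟩ : ∃ q, n = q + 4 := ⟨_, hn⟩
  rw [hq] at h7 h8 hn ⊢
  simp only [Nat.add_sub_cancel] at h7 h8
  have h9 : q * (q + 4) + q * (q + 4) * (q + 4) * (q + 4) + 2 * q + 2 ≤
      (q + 4) * (q + 4) * ((q + 4) * (q + 4)) := by nlinarith [Nat.zero_le q]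
  omega

@[fun_prop]
theorem posT (hw : PT w) (hi : PT i) : PT (fun a => posT (w a) (i a)) := by
  set C : List Bool → ℕ := fun w => (w.length + Word.cap w + 4) * (w.length + Word.cap w + 4) *
      ((w.length + Word.cap w + 4) * (w.length + Word.cap w + 4)) with hC
  have key : ∀ (w : List Bool) (p k : ℕ), primRec p (fun j r => Word.tEnd w r j) k ≤
      p + k * C w := by
    intro w p k
    induction k with
    | zero => simp [primRec]
    | succ k ih =>
      rw [primRec]
      have : Word.tEnd w _ k ≤ _ + C w := tEnd_le w (primRec p (fun j r => Word.tEnd w r j) k) k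
      rw [Nat.succ_mul]
      omega
  have hb : PolyBdd (fun a => (w a).length + Word.cap (w a) + 4) :=
    ((PolyBdd.of_length hw fun _ => le_rfl).add (PolyBdd.of_cap hw fun _ => le_rfl)).add
      (PolyBdd.const 4)
  have h0 : PT (fun a => Word.binEnd (w a) (Word.posHor (w a))) := by fun_prop
  refine natRec (h := fun a j r => Word.tEnd (w a) r j) (by fun_prop) (polyBdd_clamp hw _)
    h0 (by fun_prop)
    (fun a => (Word.binEnd (w a) (Word.posHor (w a))).size + Word.cap (w a) * C (w a) + 1)
    ((h0.polyBdd_size.add ((PolyBdd.of_cap hw fun _ => le_rfl).mul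
      ((hb.mul hb).mul (hb.mul hb)))).add (PolyBdd.const 1)) ?_
  intro a k' hk'
  refine (Nat.size_le_size (key _ _ _)).trans ((size_add_le _ _).trans ?_)
  have h1 := size_le_self (k' * C (w a))
  have h2 := Nat.mul_le_mul_right (C (w a)) (hk'.trans (clamp_le (w a) (i a)))
  omega

end PT

/-! ### Validity of a word and backward induction on tables -/

namespace Word

/-- The failures of a binary number at position `p` to have no leading zeros. -/
def badBinary (w : List Bool) (p : ℕ) : ℕ := ifz (lead w p) 0 (1 - bitAt w (p + 2 * lead w p))

/-- The failures of the game to be well-formed at the state `v`. -/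
def badState (w : List Bool) (v : ℕ) : ℕ :=
  ltb (binVal w 0) (∑ i ∈ Finset.range (nA w), play w v i) +
  ∑ m ∈ Finset.range (nJoint w v), (1 - eqb (∑ v' ∈ Finset.range (nS w), tr w v m v') (den w))

/-- The failures of the transducer of agent `i` at position `t` to be well-formed at its
state `s`. -/
def badRow (w : List Bool) (t i s : ℕ) : ℕ :=
  ∑ v ∈ Finset.range (nS w), ((1 - ltb (nx w t s v) (tS w t)) +
    (1 - eqb (∑ a ∈ Finset.range (act w i), ou w t i s v a) (den w)))

/-- The failures of the transducer of agent `i` at position `t` to be well-formed. -/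
def badTransducer (w : List Bool) (t i : ℕ) : ℕ :=
  (1 - ltb (tI w t) (tS w t)) + ∑ s ∈ Finset.range (tS w t), badRow w t i s

/-- The number of failures of the word to encode a game and a profile of transducers. -/
def bad (w : List Bool) : ℕ :=
  ltb (binVal w 0) 1 + badBinary w 0 + badBinary w (posHor w) + ltb (hor w) 1 + ltb (prec w) 1 +
  (1 - ltb (ini w) (nS w)) + ∑ v ∈ Finset.range (nS w), badState w v +
  ∑ i ∈ Finset.range (nA w), badTransducer w (posT w i) i + (1 - eqb (posT w (nA w)) w.length)

/-- The state component of the number of a product state. -/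
def vOf (w : List Bool) (x : ℕ) : ℕ := x % 2 ^ w.length

/-- The component of the number of a product state that belongs to the transducer of agent `j`. -/
def qOf (w : List Bool) (x j : ℕ) : ℕ := (x >>> (w.length * (j + 1))) % 2 ^ w.length

/-- The product state that is reached from `x` when the game moves to `v'`. -/
def nextX (w : List Bool) (x v' : ℕ) : ℕ :=
  v' + ∑ j ∈ Finset.range (nA w),
    nx w (posT w j) (qOf w x j) (vOf w x) * 2 ^ clamp w (w.length * (j + 1))

/-- The initial product state. -/
def iniX (w : List Bool) : ℕ :=
  ini w + ∑ j ∈ Finset.range (nA w), tI w (posT w j) * 2 ^ clamp w (w.length * (j + 1))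

/-- The number of product states. -/
def nX (w : List Bool) : ℕ := 2 ^ (w.length * (nA w + 1))

/-- The action of agent `j` in the joint action number `m` at `v`. -/
def dig (w : List Bool) (v m j : ℕ) : ℕ :=
  clamp w (clamp w m / ∏ i ∈ Finset.range (clamp w j), radix w v i) % act w j

/-- The weight of the joint action number `m` at the product state `x`, where agent `i` plays the
action `a` if `e` is nonzero. -/
def wt (w : List Bool) (i e a x m : ℕ) : ℕ :=
  ∏ j ∈ Finset.range (nA w), ifz (play w (vOf w x) j) (den w)
    (ifz (e * eqb j i) (ou w (posT w j) j (qOf w x j) (vOf w x) (dig w (vOf w x) m j))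
      (den w * eqb (dig w (vOf w x) m j) a))

/-- The number of bits of the fields of a table. -/
def bw (w : List Bool) : ℕ := prec w * (nA w + 1) * hor w + 1

/-- The table of a function on the product states. -/
def table (w : List Bool) (f : ℕ → ℕ) : ℕ :=
  ∑ x ∈ Finset.range (nX w), (f x % 2 ^ bw w) * 2 ^ (bw w * clamp w x)

/-- An entry of a table. -/
def look (w : List Bool) (T x : ℕ) : ℕ := (T >>> (bw w * x)) % 2 ^ bw w

/-- The expected value in the next step, multiplied by a power of the denominator, when agent `i`
plays the action `a` if `e` is nonzero. -/
def expVal (w : List Bool) (i e T a x : ℕ) : ℕ :=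
  ∑ m ∈ Finset.range (nJoint w (vOf w x)), wt w i e a x m *
    ∑ v' ∈ Finset.range (nS w), tr w (vOf w x) m v' * look w T (nextX w x v')

/-- The value of a product state with `t + 1` steps left, given the table for `t` steps. -/
def stepVal (w : List Bool) (i e t T x : ℕ) : ℕ :=
  ifz (isGoal w i (vOf w x))
    ((Finset.range (act w i)).sup fun a => expVal w i e T a x)
    (2 ^ ((prec w - 1) * ((nA w + 1) * (clamp w t + 1))))

/-- The table of the values with `t` steps left. -/
def tab (w : List Bool) (i e t : ℕ) : ℕ :=
  primRec (table w fun x => isGoal w i (vOf w x)) (fun t T => table w (stepVal w i e t T)) t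

/-- The value of the game for agent `i`, which deviates if `e` is nonzero. -/
def value (w : List Bool) (i e : ℕ) : ℕ := look w (tab w i e (hor w - 1)) (iniX w)

/-- The decision function. -/
def decision (w : List Bool) : ℕ :=
  1 - (bad w + ∑ i ∈ Finset.range (nA w), ltb (value w i 0) (value w i 1))

theorem sum_fields_lt (b n : ℕ) (f : ℕ → ℕ) :
    ∑ x ∈ Finset.range n, (f x % 2 ^ b) * 2 ^ (b * x) < 2 ^ (b * n) := by
  induction n with
  | zero => simp
  | succ n ih =>
    rw [Finset.sum_range_succ, Nat.mul_succ, pow_add, Nat.mul_comm (2 ^ (b * n))]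
    have h1 : f n % 2 ^ b + 1 ≤ 2 ^ b := Nat.mod_lt _ (by positivity)
    have h2 := Nat.mul_le_mul_right (2 ^ (b * n)) h1
    rw [Nat.add_mul, Nat.one_mul] at h2
    omega

theorem nX_le (w : List Bool) : nX w ≤ cap w := by
  refine Nat.pow_le_pow_right (by omega) ?_
  exact Nat.mul_le_mul (Nat.le_succ _) (Nat.succ_le_succ (nA_le w))

theorem table_eq (w : List Bool) (f : ℕ → ℕ) :
    table w f = ∑ x ∈ Finset.range (nX w), (f x % 2 ^ bw w) * 2 ^ (bw w * x) := by
  refine Finset.sum_congr rfl fun x hx => ?_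
  rw [clamp_of_le ((Finset.mem_range.mp hx).le.trans (nX_le w))]

theorem table_lt (w : List Bool) (f : ℕ → ℕ) : table w f < 2 ^ (bw w * nX w) := by
  rw [table_eq]
  exact sum_fields_lt _ _ _

end Word

/-! ### The decision function is computable in polynomial time in the padded input -/

namespace PT

variable {w : α → List Bool} {i v a t s m v' p x j e T : α → ℕ}

@[fun_prop]
theorem badBinary (hw : PT w) (hp : PT p) : PT (fun a => badBinary (w a) (p a)) := by
  unfold Word.badBinary; fun_prop

@[fun_prop]
theorem badState (hw : PT w) (hv : PT v) : PT (fun a => badState (w a) (v a)) := by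
  have h1 := sum (h := fun a i => Word.play (w a) (v a) i) (by fun_prop) (polyBdd_nA hw)
    (by fun_prop)
  have h2 : PT (fun q : α × ℕ => ∑ v' ∈ Finset.range (Word.nS (w q.1)),
      Word.tr (w q.1) (v q.1) q.2 v') :=
    sum (by fun_prop) (polyBdd_nS (by fun_prop)) (by fun_prop)
  have h3 := sum (h := fun a m => 1 - _root_.eqb (∑ v' ∈ Finset.range (Word.nS (w a)),
    Word.tr (w a) (v a) m v') (Word.den (w a))) (nJoint hw hv) (polyBdd_nJoint hw v) (by fun_prop)
  unfold Word.badState; fun_prop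

@[fun_prop]
theorem badRow (hw : PT w) (ht : PT t) (hi : PT i) (hs : PT s) :
    PT (fun a => badRow (w a) (t a) (i a) (s a)) := by
  refine sum (by fun_prop) (polyBdd_nS hw) ?_
  have : PT (fun q : α × ℕ => ∑ b ∈ Finset.range (Word.act (w q.1) (i q.1)),
      Word.ou (w q.1) (t q.1) (i q.1) (s q.1) q.2 b) :=
    sum (by fun_prop) (polyBdd_act (by fun_prop) _) (by fun_prop)
  fun_prop

@[fun_prop]
theorem badTransducer (hw : PT w) (ht : PT t) (hi : PT i) :
    PT (fun a => badTransducer (w a) (t a) (i a)) := by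
  have := sum (h := fun a s => Word.badRow (w a) (t a) (i a) s) (tS hw ht) (polyBdd_tS hw t)
    (by fun_prop)
  unfold Word.badTransducer; fun_prop

@[fun_prop]
theorem bad (hw : PT w) : PT (fun a => bad (w a)) := by
  have h1 := sum (h := fun a v => Word.badState (w a) v) (nS hw) (polyBdd_nS hw) (by fun_prop)
  have h2 := sum (h := fun a i => Word.badTransducer (w a) (Word.posT (w a) i) i) (nA hw)
    (polyBdd_nA hw) (by fun_prop)
  unfold Word.bad; fun_prop

@[fun_prop]
theorem vOf (hw : PT w) (hx : PT x) : PT (fun a => vOf (w a) (x a)) :=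
  mod_two_pow hx (by fun_prop) (PolyBdd.of_length hw fun _ => le_rfl)

@[fun_prop]
theorem qOf (hw : PT w) (hx : PT x) (hj : PT j) : PT (fun a => qOf (w a) (x a) (j a)) :=
  mod_two_pow (by fun_prop) (by fun_prop) (PolyBdd.of_length hw fun _ => le_rfl)

@[fun_prop]
theorem nextX (hw : PT w) (hx : PT x) (hv' : PT v') : PT (fun a => nextX (w a) (x a) (v' a)) := by
  have h1 : PT (fun q : α × ℕ => 2 ^ Word.clamp (w q.1) ((w q.1).length * (q.2 + 1))) :=
    two_pow_clamp (by fun_prop) (by fun_prop)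
  have h2 := sum (h := fun a j => Word.nx (w a) (Word.posT (w a) j) (Word.qOf (w a) (x a) j)
    (Word.vOf (w a) (x a)) * 2 ^ Word.clamp (w a) ((w a).length * (j + 1))) (nA hw) (polyBdd_nA hw)
    (by fun_prop)
  unfold Word.nextX; fun_prop

@[fun_prop]
theorem iniX (hw : PT w) : PT (fun a => iniX (w a)) := by
  have h1 : PT (fun q : α × ℕ => 2 ^ Word.clamp (w q.1) ((w q.1).length * (q.2 + 1))) :=
    two_pow_clamp (by fun_prop) (by fun_prop)
  have h2 := sum (h := fun a j => Word.tI (w a) (Word.posT (w a) j) *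
    2 ^ Word.clamp (w a) ((w a).length * (j + 1))) (nA hw) (polyBdd_nA hw) (by fun_prop)
  unfold Word.iniX; fun_prop

theorem polyBdd_nX (hw : PT w) : PolyBdd (fun a => Word.nX (w a)) :=
  PolyBdd.of_cap hw fun _ => nX_le _

@[fun_prop]
theorem nX (hw : PT w) : PT (fun a => nX (w a)) := by
  refine two_pow (by fun_prop) (PolyBdd.mul (PolyBdd.of_length hw fun _ => le_rfl)
    ((polyBdd_nA hw).add (PolyBdd.const 1)))

@[fun_prop]
theorem dig (hw : PT w) (hv : PT v) (hm : PT m) (hj : PT j) :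
    PT (fun a => dig (w a) (v a) (m a) (j a)) := by
  have h1 := prod (h := fun a i => Word.radix (w a) (v a) i) (clamp hw hj) (polyBdd_clamp hw j)
    (by fun_prop)
  have h2 := div (clamp hw hm) h1 (polyBdd_clamp hw m)
  exact mod (by fun_prop) (by fun_prop) (polyBdd_clamp hw _)

@[fun_prop]
theorem wt (hw : PT w) (hi : PT i) (he : PT e) (ha : PT a) (hx : PT x) (hm : PT m) :
    PT (fun b => wt (w b) (i b) (e b) (a b) (x b) (m b)) :=
  prod (by fun_prop) (polyBdd_nA hw) (by fun_prop)

theorem polyBdd_bw (hw : PT w) : PolyBdd (fun a => Word.bw (w a)) :=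
  (((polyBdd_prec hw).mul ((polyBdd_nA hw).add (PolyBdd.const 1))).mul (polyBdd_hor hw)).add
    (PolyBdd.const 1)

@[fun_prop]
theorem bw (hw : PT w) : PT (fun a => bw (w a)) := by
  unfold Word.bw; fun_prop

theorem table {f : α → ℕ → ℕ} (hw : PT w) (hf : PT (fun q : α × ℕ => f q.1 q.2)) :
    PT (fun a => table (w a) (f a)) := by
  refine sum (by fun_prop) (polyBdd_nX hw) ?_
  have hw' : PT (fun q : α × ℕ => w q.1) := by fun_prop
  have h1 := mod_two_pow hf (bw hw') (polyBdd_bw hw')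
  have h2 : PT (fun q : α × ℕ => 2 ^ (Word.bw (w q.1) * Word.clamp (w q.1) q.2)) :=
    two_pow (by fun_prop) ((polyBdd_bw hw').mul (polyBdd_clamp hw' _))
  fun_prop

@[fun_prop]
theorem look (hw : PT w) (hT : PT T) (hx : PT x) : PT (fun a => look (w a) (T a) (x a)) :=
  mod_two_pow (by fun_prop) (by fun_prop) (polyBdd_bw hw)

@[fun_prop]
theorem expVal (hw : PT w) (hi : PT i) (he : PT e) (hT : PT T) (ha : PT a) (hx : PT x) :
    PT (fun b => expVal (w b) (i b) (e b) (T b) (a b) (x b)) := by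
  refine sum (by fun_prop) (polyBdd_nJoint hw _) ?_
  have : PT (fun q : α × ℕ => ∑ v' ∈ Finset.range (Word.nS (w q.1)),
      Word.tr (w q.1) (Word.vOf (w q.1) (x q.1)) q.2 v' *
        Word.look (w q.1) (T q.1) (Word.nextX (w q.1) (x q.1) v')) :=
    sum (by fun_prop) (polyBdd_nS (by fun_prop)) (by fun_prop)
  fun_prop

@[fun_prop]
theorem stepVal (hw : PT w) (hi : PT i) (he : PT e) (ht : PT t) (hT : PT T) (hx : PT x) :
    PT (fun b => stepVal (w b) (i b) (e b) (t b) (T b) (x b)) := by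
  have h1 := sup (h := fun b a => Word.expVal (w b) (i b) (e b) (T b) a (x b))
    (act hw hi) (polyBdd_act hw i) (by fun_prop)
  have h2 : PT (fun b => 2 ^ ((Word.prec (w b) - 1) * ((Word.nA (w b) + 1) *
      (Word.clamp (w b) (t b) + 1)))) := by
    refine two_pow (by fun_prop) (PolyBdd.mul ((polyBdd_prec hw).mono fun _ => Nat.sub_le _ _)
      (((polyBdd_nA hw).add (PolyBdd.const 1)).mul ((polyBdd_clamp hw t).add (PolyBdd.const 1))))
  unfold Word.stepVal; fun_prop

@[fun_prop]
theorem value (hw : PT w) (hi : PT i) (he : PT e) : PT (fun a => value (w a) (i a) (e a)) := by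
  have h0 : PT (fun a => Word.table (w a) fun x => Word.isGoal (w a) (i a) (Word.vOf (w a) x)) :=
    table hw (by fun_prop)
  have h1 : PT (fun q : α × ℕ × ℕ => Word.table (w q.1)
      (Word.stepVal (w q.1) (i q.1) (e q.1) q.2.1 q.2.2)) := table (by fun_prop) (by fun_prop)
  have : PT (fun a => Word.tab (w a) (i a) (e a) (Word.hor (w a) - 1)) := by
    refine natRec (h := fun a t T => Word.table (w a) (Word.stepVal (w a) (i a) (e a) t T))
      (by fun_prop) ((polyBdd_hor hw).mono fun _ => Nat.sub_le _ _) h0 h1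
      (fun a => Word.bw (w a) * Word.nX (w a)) ((polyBdd_bw hw).mul (polyBdd_nX hw)) ?_
    intro a k _
    -- The entries of a table are reduced modulo `2 ^ bw`, so its size is bounded whatever the word
    -- and the recursion produce.
    rw [Nat.size_le]
    cases k <;> exact table_lt _ _
  unfold Word.value; fun_prop

theorem decision : PT decision := by
  have := sum (α := List Bool) (h := fun w i => _root_.ltb (Word.value w i 0) (Word.value w i 1))
    (nA (w := fun w => w) PT.id) (polyBdd_nA (w := fun w => w) PT.id) (by fun_prop)
  unfold Word.decision; fun_prop

end PT

end Complexity

open Word ConcurrentGame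

/-! ### Parsing -/

namespace Word

variable {w : List Bool} {p q p' q' : ℕ} {l l' : List Bool} {P P' : Prop}

/-- The word `l` occurs in `w` at position `p`, where `w` is continued by `false`. -/
def Match (w : List Bool) (p : ℕ) (l : List Bool) : Prop :=
  ∀ k < l.length, w.getD (p + k) false = l.getD k false

/-- The word `l` occurs in `w` at position `p` if and only if `P` holds, and then it ends at
position `p'`. -/
def Parses (w : List Bool) (p : ℕ) (l : List Bool) (P : Prop) (p' : ℕ) : Prop :=
  (Match w p l ↔ P) ∧ (P → p' = p + l.length)

theorem match_append : Match w p (l ++ l') ↔ Match w p l ∧ Match w (p + l.length) l' := by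
  constructor
  · intro h
    refine ⟨fun k hk => ?_, fun k hk => ?_⟩
    · rw [h k (by simp; omega), List.getD_append _ _ _ _ hk]
    · rw [Nat.add_assoc, h _ (by simp; omega), List.getD_append_right _ _ _ _ (by omega),
        Nat.add_sub_cancel_left]
  · rintro ⟨h1, h2⟩ k hk
    by_cases hl : k < l.length
    · rw [h1 k hl, List.getD_append _ _ _ _ hl]
    · rw [List.length_append] at hk
      have := h2 (k - l.length) (by omega)
      rw [List.getD_append_right _ _ _ _ (by omega), ← this]
      congr 1
      omega

/-- `Match` continues `w` by `false` and could supply missing zeros at the end, so the lengths are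
compared separately. -/
theorem eq_iff_match : l = w ↔ Match w 0 l ∧ l.length = w.length := by
  constructor
  · rintro rfl
    exact ⟨fun k _ => by rw [Nat.zero_add], rfl⟩
  · rintro ⟨h, hl⟩
    refine List.ext_getElem hl fun k h1 h2 => ?_
    have := h k h1
    rw [Nat.zero_add, List.getD_eq_getElem _ _ h1, List.getD_eq_getElem _ _ h2] at this
    exact this.symm

namespace Parses

/-- The position of the second field may depend on numbers read in the first one. It is meaningful
only if these are correct, so the second hypothesis may assume `P`. -/
theorem append (h : Parses w p l P q) (h' : P → Parses w q l' P' p') :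
    Parses w p (l ++ l') (P ∧ P') p' := by
  constructor
  · rw [match_append, h.1]
    refine and_congr_right fun hP => ?_
    rw [← h.2 hP, (h' hP).1]
  · rintro ⟨hP, hP'⟩
    rw [(h' hP).2 hP', h.2 hP, List.length_append, Nat.add_assoc]

theorem congr (h : Parses w p l P p') (hp : p = q) (hl : l = l') (hP : P ↔ P') (hp' : p' = q') :
    Parses w q l' P' q' := by
  subst hp hl hp'
  exact ⟨h.1.trans hP, fun h' => h.2 (hP.mpr h')⟩

theorem nil : Parses w p [] True p := ⟨by simp [Match], fun _ => rfl⟩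

theorem flatMap {n : ℕ} {f : Fin n → List Bool} {P : Fin n → Prop} (pos : ℕ → ℕ)
    (h : ∀ i : Fin n, Parses w (pos i) (f i) (P i) (pos (i + 1))) :
    Parses w (pos 0) ((List.finRange n).flatMap f) (∀ i, P i) (pos n) := by
  induction n with
  | zero => exact nil.congr rfl rfl (by simp) rfl
  | succ n ih =>
    have h1 := ih fun i => h i.castSucc
    have h2 := h (Fin.last n)
    refine (h1.append fun _ => h2).congr rfl ?_ ?_ rfl
    · rw [List.finRange_succ_last]
      simp [List.flatMap_append, List.flatMap_map]
    · rw [Fin.forall_fin_succ']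

theorem bit {b : Bool} : Parses w p [b] (bitAt w p = b.toNat) (p + 1) := by
  refine ⟨?_, fun _ => rfl⟩
  simp only [Match, List.length_singleton, Nat.lt_one_iff, forall_eq, Nat.add_zero, bitAt]
  cases w.getD p false <;> cases b <;> simp

theorem map {n : ℕ} {f : Fin n → Bool} :
    Parses w p ((List.finRange n).map f) (∀ i : Fin n, bitAt w (p + i) = (f i).toNat) (p + n) := by
  have := flatMap (w := w) (f := fun i : Fin n => [f i]) (fun k => p + k) fun i => bit
  exact this.congr rfl (by induction List.finRange n <;> simp_all) Iff.rfl rfl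

end Parses

theorem prod_bitAt (w : List Bool) (p n : ℕ) :
    ∏ i ∈ Finset.range n, bitAt w (p + i) =
      if ∀ i < n, w.getD (p + i) false = true then 1 else 0 := by
  induction n with
  | zero => simp
  | succ n ih =>
    rw [Finset.prod_range_succ, ih]
    simp only [Nat.forall_lt_succ_right, bitAt]
    cases w.getD (p + n) false <;> simp

/-- The summand of index `j` in `lead` is one exactly if the `j + 1` bits from `p` on are all ones.
Every run of ones ends, since `w` is continued by `false`. -/
theorem lead_eq_iff (w : List Bool) (p n : ℕ) : lead w p = n ↔
    (∀ i < n, w.getD (p + i) false = true) ∧ w.getD (p + n) false = false := by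
  have key : ∀ n, (∀ i < n, w.getD (p + i) false = true) → w.getD (p + n) false = false →
      lead w p = n := by
    intro n h1 h2
    have hn : n ≤ w.length := by
      by_contra! hn
      have := h1 (n - 1) (by omega)
      rw [List.getD_eq_default _ _ (by omega)] at this
      simp at this
    have : lead w p = ∑ j ∈ Finset.range w.length, if j < n then 1 else 0 := by
      refine Finset.sum_congr rfl fun j hj => ?_
      rw [Finset.mem_range] at hj
      rw [clamp_of_le_length hj, prod_bitAt]
      congr 1
      refine propext ⟨fun h => ?_, fun h i hi => h1 i (by omega)⟩
      by_contra! hj'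
      rw [h n (by omega)] at h2
      simp at h2
    rw [this, Finset.sum_ite, Finset.sum_const_zero, Finset.sum_const, add_zero, smul_eq_mul,
      mul_one]
    have : (Finset.range w.length).filter (· < n) = Finset.range n := by
      ext j; simp; omega
    rw [this, Finset.card_range]
  refine ⟨?_, fun h => key n h.1 h.2⟩
  have hex : ∃ n, w.getD (p + n) false = false :=
    ⟨w.length, List.getD_eq_default _ _ (by omega)⟩
  classical
  have h1 : ∀ i < Nat.find hex, w.getD (p + i) false = true := fun i hi => by
    simpa using Nat.find_min hex hi
  have h2 := Nat.find_spec hex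
  rw [key _ h1 h2]
  rintro rfl
  exact ⟨h1, h2⟩

theorem parses_unary (w : List Bool) (p n : ℕ) :
    Parses w p (encodeUnary n) (lead w p = n) (p + lead w p + 1) := by
  refine ⟨?_, fun h => by simp [encodeUnary, h, Nat.add_assoc]⟩
  rw [lead_eq_iff, encodeUnary, match_append]
  refine and_congr ?_ ?_
  · simp only [Match, List.length_replicate]
    refine forall_congr' fun i => forall_congr' fun hi => ?_
    rw [List.getD_eq_getElem (l := List.replicate _ _) _ (by simpa using hi), List.getElem_replicate]
  · simp [Match]

theorem num_eq_iff {l : ℕ} (hl : l ≤ cap w) (n : ℕ) :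
    num w p l = n % 2 ^ l ↔ ∀ i < l, w.getD (p + i) false = n.testBit i := by
  rw [num, clamp_of_le hl]
  induction l with
  | zero => simp [Nat.mod_one]
  | succ l ih =>
    have hlt := num_lt w p l
    rw [num, clamp_of_le (by omega)] at hlt
    rw [Nat.forall_lt_succ_right, ← ih (by omega), Finset.sum_range_succ, clamp_of_le (by omega),
      Nat.mod_pow_succ, ← Nat.toNat_testBit, bitAt, Nat.mul_comm (2 ^ l)]
    have h := Nat.mod_lt n (show 2 ^ l > 0 by positivity)
    generalize n % 2 ^ l = b at *
    generalize ∑ i ∈ Finset.range l, bitAt w (p + i) * 2 ^ clamp w i = a at *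
    cases w.getD (p + l) false <;> cases n.testBit l <;> simp <;> omega

theorem parses_bits {l n : ℕ} (hl : l ≤ cap w) (hn : n < 2 ^ l) :
    Parses w p (encodeBits l n) (num w p l = n) (p + l) := by
  refine ⟨?_, fun _ => by simp [encodeBits]⟩
  have h := num_eq_iff (p := p) hl n
  rw [Nat.mod_eq_of_lt hn] at h
  rw [h, Match, encodeBits, List.length_map, List.length_range]
  refine forall_congr' fun i => forall_congr' fun hi => ?_
  rw [List.getD_eq_getElem (l := List.map _ _) _ (by simpa using hi), List.getElem_map,
    List.getElem_range]

theorem bits_eq_encodeBits (n : ℕ) : n.bits = encodeBits n.bits.length n := by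
  refine List.ext_getElem (by simp [encodeBits]) fun i h1 h2 => ?_
  simp [encodeBits, Nat.testBit_eq_inth, List.getI_eq_getElem _ h1]

/-- The unary prefix alone would allow leading zeros. The condition on `badBinary` makes the top bit
a one, and together with the value this forces the length to be `n.size`. -/
theorem parses_binary (w : List Bool) (p n : ℕ) :
    Parses w p (encodeBinary n) (binVal w p = n ∧ badBinary w p = 0) (binEnd w p) := by
  have h1 := parses_unary w p n.bits.length
  have h2 : lead w p = n.bits.length → Parses w (p + lead w p + 1) n.bits
      (num w (p + lead w p + 1) (lead w p) = n) (binEnd w p) := fun h => by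
    rw [bits_eq_encodeBits]
    refine (parses_bits (p := p + lead w p + 1) (l := lead w p)
      ((lead_le w p).trans (len_le_cap w)) (n := n) ?_).congr rfl (by rw [h]) Iff.rfl ?_
    · rw [h, Nat.size_eq_bits_len]; exact Nat.lt_size_self n
    · unfold binEnd; omega
  refine (h1.append h2).congr rfl rfl ?_ rfl
  rw [binVal, Nat.size_eq_bits_len]
  have hc : lead w p ≤ cap w := (lead_le w p).trans (len_le_cap w)
  constructor
  · rintro ⟨h, hn⟩
    refine ⟨hn, ?_⟩
    unfold badBinary ifz
    split_ifs with h0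
    · rfl
    · have hb := (num_eq_iff (p := p + lead w p + 1) hc n).mp (by
        rw [hn, h, Nat.mod_eq_of_lt (Nat.lt_size_self n)]) (lead w p - 1) (by omega)
      have : n.testBit (n.size - 1) = true := by
        rw [Nat.testBit_eq_inth]
        by_contra hf
        have hs : n.size ≤ n.size - 1 := by
          refine Nat.size_le.mpr (Nat.lt_pow_two_of_testBit n fun i hi => ?_)
          rcases hi.eq_or_lt with rfl | hi
          · rw [Nat.testBit_eq_inth]; simpa using hf
          · exact Nat.testBit_eq_false_of_lt ((Nat.lt_size_self n).trans_le
              (Nat.pow_le_pow_right (by omega) (by omega)))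
        omega
      rw [h, this] at hb
      rw [bitAt, show p + 2 * lead w p = p + n.size + 1 + (n.size - 1) by omega, hb]
      rfl
  · rintro ⟨hn, hb⟩
    refine ⟨le_antisymm ?_ ?_, hn⟩
    · rcases Nat.eq_zero_or_pos (lead w p) with h0 | h0
      · omega
      unfold badBinary ifz at hb
      rw [if_neg (by omega), bitAt] at hb
      have hbt : w.getD (p + lead w p + 1 + (lead w p - 1)) false = true := by
        rw [show p + lead w p + 1 + (lead w p - 1) = p + 2 * lead w p by omega]
        cases h : w.getD (p + 2 * lead w p) false
        · rw [h] at hb; simp at hb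
        · rfl
      have := (num_eq_iff (p := p + lead w p + 1) hc n).mp (by
        rw [hn, Nat.mod_eq_of_lt]
        rw [← hn]
        exact (num_lt _ _ _).trans_eq (by rw [clamp_of_le hc])) (lead w p - 1) (by omega)
      rw [hbt] at this
      have h3 := Nat.ge_two_pow_of_testBit this.symm
      have := Nat.lt_size.mpr h3
      omega
    · rw [Nat.size_le, ← hn]
      exact (num_lt _ _ _).trans_eq (by rw [clamp_of_le hc])

theorem parses_unaries {n : ℕ} (hn : n ≤ cap w) (f : Fin n → ℕ) :
    Parses w p ((List.finRange n).flatMap fun i => encodeUnary (f i))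
      (∀ i : Fin n, lead w (skip w p i) = f i) (skip w p n) := by
  refine (Parses.flatMap (P := fun i => lead w (skip w p i) = f i) (skip w p) fun i =>
    (parses_unary w (skip w p i) (f i)).congr rfl rfl Iff.rfl ?_).congr ?_ rfl Iff.rfl rfl
  · rw [skip, skip, clamp_of_le (by omega), clamp_of_le (by omega), primRec]
  · rw [skip, clamp_of_le (Nat.zero_le _), primRec]

/-- It allows the transition table of a transducer to be parsed row by row, although `nx` counts
entries from the start of the table. -/
theorem skip_add {k l : ℕ} (h : k + l ≤ cap w) : skip w (skip w p k) l = skip w p (k + l) := by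
  induction l with
  | zero => rw [skip, clamp_of_le (Nat.zero_le _), primRec, Nat.add_zero]
  | succ l ih =>
    have h1 : ∀ q k, k + 1 ≤ cap w → skip w q (k + 1) = skip w q k + lead w (skip w q k) + 1 :=
      fun q k hk => by rw [skip, skip, clamp_of_le hk, clamp_of_le (by omega), primRec]
    rw [h1 _ _ (by omega), ih (by omega), ← Nat.add_assoc, h1 _ _ (by omega)]

end Word

/-! ### Parsing the encodings -/

namespace Word

variable {w : List Bool} {G : ConcurrentGame}

/-- The data of the game `G` are those read off from the word `w`. -/
structure GameData (w : List Bool) (G : ConcurrentGame) : Prop where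
  bound : binVal w 0 = G.bound
  nS : nS w = G.numStates
  ini : ini w = G.init
  nA : nA w = G.numAgents
  act : ∀ i : G.Agent, act w i = G.numActions i
  play : ∀ (v : G.State) (i : G.Agent), play w v i = (decide (i ∈ G.playing v)).toNat
  prec : prec w = G.precision
  tr : ∀ (v : G.State) (m : Fin (∏ j, G.numActions ((G.playing v).orderIsoOfFin rfl j)))
    (v' : G.State), tr w v m v' = G.trans v (G.jointActionEquiv v m) v'
  isGoal : ∀ (i : G.Agent) (v : G.State), isGoal w i v = (decide (v ∈ G.goal i)).toNat
  hor : hor w = G.horizon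

/-- The data of the transducer `T` are those read off from the word `w` at position `t`. -/
structure TransducerData (w : List Bool) (t : ℕ) {i : G.Agent} (T : G.Transducer i) : Prop where
  tS : tS w t = T.numStates
  tI : tI w t = T.init
  nx : ∀ (s : Fin T.numStates) (v : G.State), nx w t s v = T.next s v
  ou : ∀ (s : Fin T.numStates) (v : G.State) (a : G.Action i), ou w t i s v a = T.out s v a

/-- Inactive agents have radix one, so the product over the active agents in increasing order equals
the product over all agents. -/
theorem prod_orderIso_eq_nJoint {n v : ℕ} {c : Fin n → ℕ} {S : Finset (Fin n)} (hA : nA w = n)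
    (hact : ∀ i : Fin n, act w i = c i)
    (hplay : ∀ i : Fin n, play w v i = (decide (i ∈ S)).toNat) :
    ∏ j, c (S.orderIsoOfFin rfl j) = nJoint w v := by
  refine (Equiv.prod_comp (S.orderIsoOfFin rfl).toEquiv fun i => c i).trans ?_
  rw [nJoint, hA, ← Fin.prod_univ_eq_prod_range]
  have : ∀ i : Fin n, radix w v i = if i ∈ S then c i else 1 := by
    intro i
    rw [radix, hplay, hact, ifz]
    by_cases h : i ∈ S <;> simp [h]
  rw [Finset.prod_congr rfl fun i _ => this i, Finset.prod_ite_mem, Finset.univ_inter,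
    Finset.prod_coe_sort]

/-- A numerator is at most the denominator `2 ^ (l - 1)`; even probability one fits into `l` bits,
and writing only the `l` lowest bits loses nothing. -/
theorem lt_two_pow_of_sum_eq {ι : Type*} [Fintype ι] {f : ι → ℕ} {l : ℕ} (hl : 1 ≤ l)
    (h : ∑ i, f i = 2 ^ (l - 1)) (i : ι) : f i < 2 ^ l := by
  have h1 := Finset.single_le_sum (fun i _ => Nat.zero_le (f i)) (Finset.mem_univ i)
  rw [h] at h1
  exact h1.trans_lt (Nat.pow_lt_pow_right (by omega) (by omega))

theorem posTrans_succ {v : ℕ} (hv : v + 1 ≤ cap w) :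
    posTrans w (v + 1) = posTrans w v + nJoint w v * (nS w * prec w) := by
  rw [posTrans, posTrans, clamp_of_le hv, clamp_of_le (by omega), Finset.sum_range_succ]
  omega

/-- The fields are chained in the order of the encoding. Each position is computed from numbers in
`w`, which may be replaced by those of `G` once the earlier fields have been matched. -/
theorem parses_game (w : List Bool) (G : ConcurrentGame) :
    Parses w 0 G.encode (GameData w G ∧ badBinary w 0 = 0 ∧ badBinary w (posHor w) = 0)
      (binEnd w (posHor w)) := by
  have h1 := parses_binary w 0 G.bound
  have h2 := h1.append fun _ => parses_unary w (posStates w) G.numStates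
  have h3 := h2.append fun _ => parses_unary w (posInit w) G.init
  have h4 := h3.append fun _ => parses_unary w (posAgents w) G.numAgents
  have h5 := h4.append fun h =>
    (parses_unaries (w := w) (p := posActs w)
      (h.2.symm.le.trans ((nA_le w).trans (len_le_cap w))) G.numActions).congr rfl rfl
      Iff.rfl (show _ = posPlay w by rw [posPlay, ← h.2]; rfl)
  have h6 := h5.append fun h =>
    (Parses.flatMap (w := w) (fun v => posPlay w + v * nA w) fun v =>
      (Parses.map (f := fun i => decide (i ∈ G.playing v))).congr rfl rfl
        (show _ ↔ ∀ i : G.Agent, play w v i = (decide (i ∈ G.playing v)).toNat by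
          simp only [play, Nat.add_assoc])
        (show _ = _ by rw [← show nA w = _ from h.1.2, Nat.add_mul, Nat.one_mul, Nat.add_assoc])).congr
      (by rw [Nat.zero_mul, Nat.add_zero]) rfl Iff.rfl
      (show _ = posPrec w by rw [posPrec, ← show nS w = _ from h.1.1.1.2])
  have h7 := h6.append fun _ => parses_unary w (posPrec w) G.precision
  have h8 := h7.append fun h => by
    have hP : prec w = _ := h.2
    have hplay := h.1.2
    have hact : ∀ i : G.Agent, act w i = _ := h.1.1.2
    have hA : nA w = _ := h.1.1.1.2
    have hS : nS w = _ := h.1.1.1.1.1.2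
    refine ((Parses.flatMap (w := w) (posTrans w) fun v =>
      ((Parses.flatMap (w := w) (fun m => posTrans w v + m * (nS w * prec w)) fun m =>
        ((Parses.flatMap (w := w) (fun v' => posTrans w v + (m * nS w + v') * prec w) fun v' =>
          ((parses_bits (p := posTrans w v + (m * nS w + v') * prec w)
            (n := G.trans v (G.jointActionEquiv v m) v')
            ((prec_le w).trans (len_le_cap w)) ?_)).congr rfl (by rw [hP]) (show _ ↔ tr w v m v' =
              G.trans v (G.jointActionEquiv v m) v' from Iff.rfl) ?_)).congr ?_ rfl
              Iff.rfl ?_).congr ?_ rfl Iff.rfl ?_))).congr ?_ rfl Iff.rfl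
      (show posTrans w _ = posGoal w by rw [posGoal, ← hS])
    · rw [hP]
      exact lt_two_pow_of_sum_eq G.one_le_precision (G.sum_trans v (G.jointActionEquiv v m)) v'
    · ring
    · ring
    · rw [hS]; ring
    · ring
    · rw [prod_orderIso_eq_nJoint hA hact (hplay v), posTrans_succ]
      have := v.2
      have := nS_le w
      have := len_le_cap w
      omega
    · rw [posTrans, clamp_of_le (Nat.zero_le _), Finset.sum_range_zero, Nat.add_zero]
      rfl
  have h9 := h8.append fun h =>
    (Parses.flatMap (w := w) (fun i => posGoal w + i * nS w) fun i =>
      (Parses.map (f := fun v => decide (v ∈ G.goal i))).congr rfl rfl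
        (show _ ↔ ∀ v : G.State, isGoal w i v = (decide (v ∈ G.goal i)).toNat by
          simp only [isGoal, Nat.add_assoc])
        (show _ = _ by rw [← show nS w = _ from h.1.1.1.1.1.1.2, Nat.add_mul, Nat.one_mul,
          Nat.add_assoc])).congr
      (by rw [Nat.zero_mul, Nat.add_zero]) rfl Iff.rfl
      (show _ = posHor w by rw [posHor, ← show nA w = _ from h.1.1.1.1.2])
  have h10 := h9.append fun _ => parses_binary w (posHor w) G.horizon
  refine h10.congr rfl rfl ?_ rfl
  constructor
  · rintro ⟨⟨⟨⟨⟨⟨⟨⟨⟨⟨a1, b1⟩, a2⟩, a3⟩, a4⟩, a5⟩, a6⟩, a7⟩, a8⟩, a9⟩, a10, b2⟩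
    exact ⟨⟨a1, a2, a3, a4, a5, a6, a7, a8, a9, a10⟩, b1, b2⟩
  · rintro ⟨⟨a1, a2, a3, a4, a5, a6, a7, a8, a9, a10⟩, b1, b2⟩
    exact ⟨⟨⟨⟨⟨⟨⟨⟨⟨⟨a1, b1⟩, a2⟩, a3⟩, a4⟩, a5⟩, a6⟩, a7⟩, a8⟩, a9⟩, a10, b2⟩

theorem parses_transducer (hG : GameData w G) {i : G.Agent} (T : G.Transducer i) (t : ℕ) :
    Parses w t T.encode (TransducerData w t T) (tEnd w t i) := by
  have hS := hG.nS
  have hP := hG.prec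
  have hcap : tS w t * nS w ≤ cap w :=
    (Nat.mul_le_mul ((tS_le w t).trans (Nat.le_succ _)) ((nS_le w).trans (Nat.le_succ _))).trans
      (sq_le_cap w)
  have hcap' : ∀ s < tS w t, s * nS w + nS w ≤ cap w := fun s hs =>
    le_trans (by rw [← Nat.succ_mul]; exact Nat.mul_le_mul_right _ hs) hcap
  have h1 := parses_unary w t T.numStates
  have h2 := h1.append fun _ => parses_unary w (t + lead w t + 1) T.init
  have h3 := h2.append fun h => by
    have hT : tS w t = _ := h.1
    refine ((Parses.flatMap (w := w) (fun s => skip w (posNext w t) (s * nS w)) fun s =>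
      ((parses_unaries (w := w) (p := skip w (posNext w t) (s * nS w)) ?_
        fun v => (T.next s v : ℕ)).congr rfl rfl
          (show _ ↔ ∀ v : G.State, nx w t s v = T.next s v from ?_) ?_))).congr ?_ rfl Iff.rfl
          (show _ = posOut w t by rw [posOut, hT])
    · rw [← hS]; exact (nS_le w).trans (len_le_cap w)
    · refine forall_congr' fun v => ?_
      rw [nx, skip_add]
      have := hcap' s (s.2.trans_eq hT.symm)
      have := v.2
      omega
    · rw [← hS, skip_add (hcap' s (s.2.trans_eq hT.symm)), Nat.succ_mul]
    · rw [Nat.zero_mul, skip, clamp_of_le (Nat.zero_le _), primRec]; rfl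
  have h4 := h3.append fun h => by
    have hT : tS w t = _ := h.1.1
    refine ((Parses.flatMap (w := w)
      (fun s => posOut w t + (s * nS w) * act w i * prec w) fun s =>
      ((Parses.flatMap (w := w) (fun v => posOut w t + (s * nS w + v) * act w i * prec w)
        fun v =>
        ((Parses.flatMap (w := w)
          (fun a => posOut w t + ((s * nS w + v) * act w i + a) * prec w) fun a =>
          ((parses_bits (p := posOut w t + ((s * nS w + v) * act w i + a) * prec w)
            (n := T.out s v a) ((prec_le w).trans (len_le_cap w)) ?_)).congr rfl (by rw [hP])
              (show _ ↔ ou w t i s v a = T.out s v a from Iff.rfl) ?_)).congr ?_ rfl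
              Iff.rfl ?_).congr ?_ rfl Iff.rfl ?_))).congr ?_ rfl Iff.rfl
      (show _ = tEnd w t i by rw [tEnd, hT])
    · rw [hP]
      exact lt_two_pow_of_sum_eq G.one_le_precision (T.sum_out s v) a
    · ring
    · ring
    · rw [hG.act]; ring
    · ring
    · rw [hS]; ring
    · ring
  refine h4.congr rfl rfl ?_ rfl
  constructor
  · rintro ⟨⟨⟨a1, a2⟩, a3⟩, a4⟩
    exact ⟨a1, a2, a3, a4⟩
  · rintro ⟨a1, a2, a3, a4⟩
    exact ⟨⟨⟨a1, a2⟩, a3⟩, a4⟩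

/-- Being an encoding splits into equations that tie `G` and `T` to the data in `w`, and conditions
on `w` alone, which `bad` tests. -/
theorem encodeInstance_eq_iff (w : List Bool) (G : ConcurrentGame)
    (T : (i : G.Agent) → G.Transducer i) : G.encodeInstance T = w ↔
      (GameData w G ∧ ∀ i : G.Agent, TransducerData w (posT w i) (T i)) ∧ badBinary w 0 = 0 ∧
        badBinary w (posHor w) = 0 ∧ posT w (nA w) = w.length := by
  have h := (parses_game w G).append fun hG => by
    have hA := hG.1.nA
    refine (Parses.flatMap (w := w) (f := fun i : G.Agent => (T i).encode) (posT w) fun i : G.Agent =>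
      (parses_transducer hG.1 (T i) (posT w i)).congr rfl rfl Iff.rfl ?_).congr
      (show _ = binEnd w (posHor w) by rw [posT, clamp_of_le (Nat.zero_le _), primRec]) rfl Iff.rfl
      (show _ = posT w (nA w) by rw [hA])
    have := nA_le w
    have := len_le_cap w
    have := i.2
    rw [posT, posT, clamp_of_le (by omega), clamp_of_le (by omega), primRec]
  rw [eq_iff_match, ConcurrentGame.encodeInstance, h.1]
  constructor
  · rintro ⟨hP, hl⟩
    have := h.2 hP
    rw [Nat.zero_add] at this
    exact ⟨⟨hP.1.1, hP.2⟩, hP.1.2.1, hP.1.2.2, by omega⟩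
  · rintro ⟨⟨hG, hT⟩, h1, h2, h3⟩
    have := h.2 ⟨⟨hG, h1, h2⟩, hT⟩
    rw [Nat.zero_add] at this
    exact ⟨⟨⟨hG, h1, h2⟩, hT⟩, by omega⟩

end Word

/-! ### The well-formed words are the encodings -/

theorem ltb_eq_zero {a b : ℕ} : ltb a b = 0 ↔ b ≤ a := by
  unfold ltb; split_ifs <;> simp <;> omega

theorem one_sub_ltb_eq_zero {a b : ℕ} : 1 - ltb a b = 0 ↔ a < b := by
  unfold ltb; split_ifs <;> simp <;> omega

theorem one_sub_eqb_eq_zero {a b : ℕ} : 1 - eqb a b = 0 ↔ a = b := by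
  unfold eqb; split_ifs <;> simpa

namespace Word

variable {w : List Bool} {G : ConcurrentGame}

theorem bad_eq_zero_iff (w : List Bool) : bad w = 0 ↔
    (1 ≤ binVal w 0 ∧ 1 ≤ hor w ∧ 1 ≤ prec w ∧ ini w < nS w ∧
      (∀ v < nS w, ∑ i ∈ Finset.range (nA w), play w v i ≤ binVal w 0 ∧
        ∀ m < nJoint w v, ∑ v' ∈ Finset.range (nS w), tr w v m v' = den w) ∧
      ∀ i < nA w, tI w (posT w i) < tS w (posT w i) ∧ ∀ s < tS w (posT w i), ∀ v < nS w,
        nx w (posT w i) s v < tS w (posT w i) ∧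
        ∑ a ∈ Finset.range (act w i), ou w (posT w i) i s v a = den w) ∧
    badBinary w 0 = 0 ∧ badBinary w (posHor w) = 0 ∧ posT w (nA w) = w.length := by
  simp only [bad, badState, badTransducer, badRow, Nat.add_eq_zero_iff, Finset.sum_eq_zero_iff,
    Finset.mem_range, ltb_eq_zero, one_sub_ltb_eq_zero, one_sub_eqb_eq_zero]
  tauto

theorem sum_range_play {n v : ℕ} {S : Finset (Fin n)}
    (h : ∀ i : Fin n, play w v i = (decide (i ∈ S)).toNat) :
    ∑ i ∈ Finset.range n, play w v i = S.card := by
  rw [← Fin.sum_univ_eq_sum_range, Finset.sum_congr rfl fun i _ => h i, Finset.card_eq_sum_ones,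
    ← Finset.sum_filter_add_sum_filter_not Finset.univ (· ∈ S)]
  rw [Finset.sum_congr (g := fun _ => 1) rfl (by simp +contextual), Finset.filter_univ_mem,
    Finset.sum_eq_zero (s := Finset.filter _ _) (by simp +contextual), add_zero]

theorem bad_eq_zero_of_encodeInstance_eq {T : (i : G.Agent) → G.Transducer i}
    (h : G.encodeInstance T = w) : bad w = 0 := by
  obtain ⟨⟨hG, hT⟩, h'⟩ := (encodeInstance_eq_iff w G T).mp h
  rw [bad_eq_zero_iff]
  refine ⟨⟨?_, ?_, ?_, ?_, ?_, ?_⟩, h'⟩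
  · exact hG.bound ▸ G.one_le_bound
  · exact hG.hor ▸ G.one_le_horizon
  · exact hG.prec ▸ G.one_le_precision
  · rw [hG.ini, hG.nS]; exact G.init.2
  · intro v hv
    rw [hG.nS] at hv ⊢
    lift v to G.State using hv
    refine ⟨?_, fun m hm => ?_⟩
    · rw [hG.nA, sum_range_play (hG.play v), hG.bound]
      exact G.card_playing_le v
    · rw [← prod_orderIso_eq_nJoint hG.nA hG.act (hG.play v)] at hm
      rw [← Fin.sum_univ_eq_sum_range, den, hG.prec, ← G.sum_trans v (G.jointActionEquiv v ⟨m, hm⟩)]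
      exact Finset.sum_congr rfl fun v' _ => hG.tr v ⟨m, hm⟩ v'
  · intro i hi
    rw [hG.nA] at hi
    lift i to G.Agent using hi
    have hT := hT i
    refine ⟨by rw [hT.tI, hT.tS]; exact (T i).init.2, fun s hs v hv => ?_⟩
    rw [hT.tS] at hs ⊢
    rw [hG.nS] at hv
    lift s to Fin (T i).numStates using hs
    lift v to G.State using hv
    refine ⟨by rw [hT.nx]; exact ((T i).next s v).2, ?_⟩
    rw [hG.act, ← Fin.sum_univ_eq_sum_range, den, hG.prec, ← (T i).sum_out s v]
    exact Finset.sum_congr rfl fun a _ => hT.ou s v a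

/-- The enumeration of the tuples of actions of the agents in a set. -/
def jointEquiv {n : ℕ} (S : Finset (Fin n)) (c : Fin n → ℕ) :
    Fin (∏ j, c (S.orderIsoOfFin rfl j)) ≃ ((i : {i // i ∈ S}) → Fin (c i)) :=
  finPiFinEquiv.symm.trans
    (Equiv.piCongrLeft (fun i : {i // i ∈ S} => Fin (c i)) (S.orderIsoOfFin rfl).toEquiv)

/-- The set of the agents that are active at `v`. -/
def playSet (w : List Bool) (v : ℕ) : Finset (Fin (nA w)) :=
  Finset.univ.filter fun i => play w v i = 1

theorem play_eq (w : List Bool) (v : ℕ) (i : Fin (nA w)) :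
    play w v i = (decide (i ∈ playSet w v)).toNat := by
  have : play w v i ≤ 1 := bitAt_le _ _
  by_cases h : play w v i = 1
  · simp [playSet, h]
  · simp [playSet, h]; omega

/-- The game and the transducers are read off from the word; the absence of failures supplies the
proofs that their structures demand. -/
theorem exists_encodeInstance_eq (h : bad w = 0) :
    ∃ (G : ConcurrentGame) (T : (i : G.Agent) → G.Transducer i), G.encodeInstance T = w := by
  obtain ⟨⟨h1, h2, h3, h4, h5, h6⟩, h'⟩ := (bad_eq_zero_iff w).mp h
  let G : ConcurrentGame :=
    { bound := binVal w 0
      one_le_bound := h1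
      numStates := nS w
      init := ⟨ini w, h4⟩
      numAgents := nA w
      numActions := fun i => act w i
      playing := fun v => playSet w v
      card_playing_le := fun v => by
        rw [← sum_range_play (play_eq w v)]
        exact (h5 v v.2).1
      precision := prec w
      one_le_precision := h3
      -- The table lists joint actions by number, so a joint action is first turned back into its
      -- number.
      trans := fun v θ v' => tr w v ((jointEquiv (playSet w v) fun i => act w i).symm θ) v'
      sum_trans := fun v θ => by
        rw [Fin.sum_univ_eq_sum_range (fun v' => tr w v _ v')]
        refine (h5 v v.2).2 _ ?_
        rw [← prod_orderIso_eq_nJoint rfl (fun _ => rfl) (play_eq w v)]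
        exact Fin.is_lt _
      goal := fun i => Finset.univ.filter fun v => isGoal w i v = 1
      horizon := hor w
      one_le_horizon := h2 }
  have hG : GameData w G :=
    { bound := rfl
      nS := rfl
      ini := rfl
      nA := rfl
      act := fun _ => rfl
      play := fun v i => play_eq w v i
      prec := rfl
      tr := fun v m v' => by
        change _ = tr w v ((jointEquiv (playSet w v) fun i => act w i).symm
          (jointEquiv (playSet w v) (fun i => act w i) m)) v'
        rw [Equiv.symm_apply_apply]
      isGoal := fun i v => by
        have h1 : isGoal w i v ≤ 1 := bitAt_le _ _
        by_cases h : isGoal w i v = 1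
        · simp [G, h]
        · simp [G, h]; omega
      hor := rfl }
  let T : (i : G.Agent) → G.Transducer i := fun i =>
    { numStates := tS w (posT w i)
      init := ⟨tI w (posT w i), (h6 i i.2).1⟩
      next := fun s v => ⟨nx w (posT w i) s v, ((h6 i i.2).2 s s.2 v v.2).1⟩
      out := fun s v a => ou w (posT w i) i s v a
      sum_out := fun s v => by
        rw [Fin.sum_univ_eq_sum_range (fun a => ou w (posT w i) i s v a)]
        exact ((h6 i i.2).2 s s.2 v v.2).2 }
  refine ⟨G, T, (encodeInstance_eq_iff w G T).mpr ⟨⟨hG, fun i => ?_⟩, h'⟩⟩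
  exact ⟨rfl, rfl, fun _ _ => rfl, fun _ _ _ => rfl⟩

end Word

/-! ### Sums over paths -/

section Paths

variable {V : Type*} [Fintype V] [DecidableEq V]

/-- The expectation of `g` over the paths with `n` steps from `v`, where `K l` is the transition
kernel after the prefix `l`. -/
noncomputable def pathSum (K : List V → V → V → ℝ) (n : ℕ) (l : List V) (v : V)
    (g : (Fin (n + 1) → V) → ℝ) : ℝ :=
  ∑ s : Fin (n + 1) → V, (if s 0 = v then 1 else 0) *
    (∏ j : Fin n, K (l ++ (List.ofFn s).take j) (s j.castSucc) (s j.succ)) * g s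

/-- The probability to visit `Γ` on a path with `n` steps from `v`. -/
noncomputable def hitProb (K : List V → V → V → ℝ) (Γ : Finset V) : ℕ → List V → V → ℝ
  | 0, _, v => if v ∈ Γ then 1 else 0
  | n + 1, l, v => if v ∈ Γ then 1 else ∑ v', K l v v' * hitProb K Γ n (l ++ [v]) v'

theorem pathSum_zero (K : List V → V → V → ℝ) (l : List V) (v : V) (g : (Fin 1 → V) → ℝ) :
    pathSum K 0 l v g = g fun _ => v := by
  rw [pathSum, Fintype.sum_eq_single fun _ => v]
  · simp
  · intro s hs
    rw [if_neg, zero_mul, zero_mul]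
    rintro rfl
    exact hs (funext fun i => congrArg s (Fin.ext (by omega)))

/-- Splitting off the first state, which must be `v`, leaves paths from the second state with the
prefix extended by `v`. -/
theorem pathSum_succ (K : List V → V → V → ℝ) (n : ℕ) (l : List V) (v : V)
    (g : (Fin (n + 2) → V) → ℝ) : pathSum K (n + 1) l v g =
      ∑ v', K l v v' * pathSum K n (l ++ [v]) v' fun s => g (Fin.cons v s) := by
  have h : ∀ s : Fin (n + 1) → V, ∑ v', K l v v' * ((if s 0 = v' then 1 else 0) *
      (∏ j : Fin n, K (l ++ [v] ++ (List.ofFn s).take j) (s j.castSucc) (s j.succ)) *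
        g (Fin.cons v s)) = K l v (s 0) *
      (∏ j : Fin n, K (l ++ [v] ++ (List.ofFn s).take j) (s j.castSucc) (s j.succ)) *
        g (Fin.cons v s) := by
    intro s
    rw [Fintype.sum_eq_single (s 0)]
    · rw [if_pos rfl]; ring
    · intro v' hv'
      rw [if_neg hv'.symm]; ring
  simp only [pathSum, Finset.mul_sum]
  rw [Finset.sum_comm, Finset.sum_congr rfl fun s _ => h s,
    ← (Fin.consEquiv fun _ : Fin (n + 2) => V).sum_comp, Fintype.sum_prod_type,
    Fintype.sum_eq_single v]
  · refine Finset.sum_congr rfl fun s _ => ?_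
    rw [Fin.prod_univ_succ]
    simp [Fin.consEquiv]
  · intro v' hv'
    refine Finset.sum_eq_zero fun s _ => ?_
    simp [Fin.consEquiv, hv']

theorem pathSum_one {K : List V → V → V → ℝ} (hK : ∀ l v, ∑ v', K l v v' = 1) (n : ℕ)
    (l : List V) (v : V) : pathSum K n l v (fun _ => 1) = 1 := by
  induction n generalizing l v with
  | zero => rw [pathSum_zero]
  | succ n ih => rw [pathSum_succ]; simp [ih, hK]

/-- After a visit to `Γ` the rest of the path is irrelevant, and its weights sum to one by
`pathSum_one`. -/
theorem pathSum_hit {K : List V → V → V → ℝ} (hK : ∀ l v, ∑ v', K l v v' = 1) (Γ : Finset V)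
    (n : ℕ) (l : List V) (v : V) :
    pathSum K n l v (fun s => if ∃ j, s j ∈ Γ then 1 else 0) = hitProb K Γ n l v := by
  have h : ∀ (n : ℕ) (v : V) (s : Fin n → V),
      (∃ j, (Fin.cons v s : Fin (n + 1) → V) j ∈ Γ) ↔ v ∈ Γ ∨ ∃ j, s j ∈ Γ :=
    fun n v s => by rw [Fin.exists_fin_succ]; rfl
  induction n generalizing l v with
  | zero => rw [pathSum_zero, hitProb]; simp
  | succ n ih =>
    rw [hitProb, pathSum_succ]
    simp_rw [h]
    split_ifs with hv
    · simp [hv, hK, pathSum_one hK]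
    · simp only [hv, false_or, ih]

end Paths

namespace ConcurrentGame

variable {G : ConcurrentGame}

/-- The expectation of `W` after one step from `v`, where the actions have the weights `D`. -/
noncomputable def step (v : G.State) (D : (j : G.Agent) → G.Action j → ℝ) (W : G.State → ℝ) : ℝ :=
  ∑ θ : G.JointAction v, (∏ j : {i // i ∈ G.playing v}, D j (θ j)) *
    ∑ v', G.transProb v θ v' * W v'

/-- The weights of the actions under the profile `π` at `v` after the prefix `l`. -/
noncomputable def weights (π : (i : G.Agent) → G.Strategy i) (l : List G.State) (v : G.State) :
    (j : G.Agent) → G.Action j → ℝ :=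
  fun j => (π j ⟨l ++ [v], by simp⟩).1

/-- The transition kernel under the profile `π`. -/
noncomputable def kernel (π : (i : G.Agent) → G.Strategy i) (l : List G.State) (v v' : G.State) :
    ℝ :=
  ∑ θ : G.JointAction v, (∏ j : {i // i ∈ G.playing v}, weights π l v j (θ j)) *
    G.transProb v θ v'

theorem transProb_nonneg (v : G.State) (θ : G.JointAction v) (v' : G.State) :
    0 ≤ G.transProb v θ v' := by
  unfold transProb; positivity

theorem sum_transProb (v : G.State) (θ : G.JointAction v) : ∑ v', G.transProb v θ v' = 1 := by
  simp only [transProb]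
  rw [← Finset.sum_div, ← Nat.cast_sum, G.sum_trans]
  simp

theorem sum_prod_weights {S : Finset G.Agent} {D : (j : G.Agent) → G.Action j → ℝ}
    (hD : ∀ j, ∑ a, D j a = 1) :
    ∑ θ : (j : {i // i ∈ S}) → G.Action j, ∏ j : {i // i ∈ S}, D j (θ j) = 1 := by
  rw [← Fintype.piFinset_univ, ← Finset.prod_univ_sum]
  simp [hD]

theorem sum_kernel (π : (i : G.Agent) → G.Strategy i) (l : List G.State) (v : G.State) :
    ∑ v', kernel π l v v' = 1 := by
  simp only [kernel]
  rw [Finset.sum_comm]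
  simp_rw [← Finset.mul_sum, sum_transProb, mul_one]
  exact sum_prod_weights fun j => (π j _).2.2

theorem sum_kernel_mul (π : (i : G.Agent) → G.Strategy i) (l : List G.State) (v : G.State)
    (W : G.State → ℝ) : ∑ v', kernel π l v v' * W v' = step v (weights π l v) W := by
  simp only [kernel, step, Finset.sum_mul]
  rw [Finset.sum_comm]
  simp_rw [Finset.mul_sum, mul_assoc]

/-- For fixed visited states, the sum over the sequences of joint actions factorises into one sum
per time step, the kernel. What remains is a sum over paths of states. -/
theorem payoff_eq (π : (i : G.Agent) → G.Strategy i) (i : G.Agent) :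
    G.payoff π i = hitProb (kernel π) (G.goal i) (G.horizon - 1) [] G.init := by
  rw [← pathSum_hit (sum_kernel π)]
  -- Stated for a variable `F`, since `G.horizon` occurs in types and cannot be replaced by a
  -- successor directly.
  have key : ∀ (F : ℕ) (hF : 1 ≤ F), ∑ s : Fin F → G.State,
      (if s ⟨0, hF⟩ = G.init then 1 else 0) * (∏ j : Fin (F - 1),
        kernel π ((List.ofFn s).take j) (s ⟨j, by omega⟩) (s ⟨j + 1, by omega⟩)) *
        (if ∃ j, s j ∈ G.goal i then 1 else 0) = pathSum (kernel π) (F - 1) [] G.init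
          (fun s => if ∃ j, s j ∈ G.goal i then 1 else 0) := by
    intro F hF
    obtain ⟨n, rfl⟩ : ∃ n, F = n + 1 := ⟨F - 1, by omega⟩
    rfl
  rw [← key G.horizon G.one_le_horizon, payoff, Fintype.sum_sigma]
  refine Finset.sum_congr rfl fun s _ => ?_
  change ∑ θ, G.playProb π ⟨s, θ⟩ * (if ∃ j, s j ∈ G.goal i then 1 else 0) = _
  rw [← Finset.sum_mul]
  congr 1
  refine Eq.trans ?_ (congrArg ((if s ⟨0, G.one_le_horizon⟩ = G.init then (1 : ℝ) else 0) * ·)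
    (?_ : ∑ θ : (j : Fin (G.horizon - 1)) → G.JointAction (s (G.before j)),
      ∏ j, ((∏ i : {i // i ∈ G.playing (s (G.before j))},
        (π i (G.historyAt s (G.before j))).1 (θ j i)) *
          G.transProb (s (G.before j)) (θ j) (s (G.after j))) = _))
  · rw [Finset.mul_sum]
    rfl
  simp only [kernel]
  rw [Finset.prod_univ_sum, Fintype.piFinset_univ]
  refine Finset.sum_congr rfl fun θ _ => Finset.prod_congr rfl fun j _ => ?_
  have : ∀ h, G.historyAt s (G.before j) =
      ⟨(List.ofFn s).take j ++ [s ⟨j, (G.before j).2⟩], h⟩ := by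
    intro h
    refine Subtype.ext ?_
    have hj : (j : ℕ) < (List.ofFn s).length := by
      rw [List.length_ofFn]; exact (G.before j).2
    change (List.ofFn s).take (j + 1) = _
    rw [← List.take_append_getElem hj, List.getElem_ofFn]
  rw [this (by simp)]
  rfl

end ConcurrentGame

/-! ### Best responses to transducers -/

namespace ConcurrentGame

variable {G : ConcurrentGame}

theorem step_mono {v : G.State} {D : (j : G.Agent) → G.Action j → ℝ} (hD : ∀ j a, 0 ≤ D j a)
    {W W' : G.State → ℝ} (h : ∀ v', W v' ≤ W' v') : step v D W ≤ step v D W' := by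
  refine Finset.sum_le_sum fun θ _ => mul_le_mul_of_nonneg_left ?_
    (Finset.prod_nonneg fun j _ => hD _ _)
  exact Finset.sum_le_sum fun v' _ => mul_le_mul_of_nonneg_left (h v') (transProb_nonneg _ _ _)

/-- If agent `i` is active, each product of weights contains its weight exactly once. If it is
inactive, the product does not involve its weights, and only `hx` is needed. -/
theorem step_update (v : G.State) (D : (j : G.Agent) → G.Action j → ℝ) (W : G.State → ℝ)
    (i : G.Agent) {x : G.Action i → ℝ} (hx : ∑ a, x a = 1) :
    step v (update D i x) W = ∑ a, x a * step v (update D i (Pi.single a 1)) W := by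
  simp only [step, Finset.mul_sum (s := Finset.univ (α := G.JointAction v))]
  rw [Finset.sum_comm]
  refine Finset.sum_congr rfl fun θ _ => ?_
  simp_rw [← mul_assoc]
  rw [← Finset.sum_mul]
  congr 1
  by_cases hi : i ∈ G.playing v
  · have h : ∀ y : G.Action i → ℝ, ∏ j : {i // i ∈ G.playing v}, update D i y j (θ j) =
        y (θ ⟨i, hi⟩) * ∏ j ∈ Finset.univ.erase (⟨i, hi⟩ : {i // i ∈ G.playing v}),
          D j (θ j) := by
      intro y
      rw [← Finset.mul_prod_erase Finset.univ _ (Finset.mem_univ ⟨i, hi⟩), update_self]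
      congr 1
      refine Finset.prod_congr rfl fun j hj => ?_
      rw [update_of_ne fun h => Finset.ne_of_mem_erase hj (Subtype.ext h)]
    simp_rw [h, ← mul_assoc]
    rw [← Finset.sum_mul]
    congr 1
    rw [Fintype.sum_eq_single (θ ⟨i, hi⟩)]
    · simp
    · intro a ha
      rw [Pi.single_eq_of_ne ha.symm, mul_zero]
  · have h : ∀ y : G.Action i → ℝ, ∏ j : {i // i ∈ G.playing v}, update D i y j (θ j) =
        ∏ j : {i // i ∈ G.playing v}, D j (θ j) := by
      intro y
      refine Finset.prod_congr rfl fun j _ => ?_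
      rw [update_of_ne fun h : (j : G.Agent) = i => hi (h ▸ j.2)]
    simp_rw [h]
    rw [← Finset.sum_mul, hx, one_mul]

variable (T : (i : G.Agent) → G.Transducer i)

/-- The states of all transducers. -/
abbrev Memory : Type := (j : G.Agent) → Fin (T j).numStates

/-- The weights of the actions according to the outputs of the transducers. -/
noncomputable def outWeights (q : Memory T) (v : G.State) : (j : G.Agent) → G.Action j → ℝ :=
  fun j => ((T j).outDist (q j) v).1

/-- The states of the transducers after reading `v`. -/
def nextMemory (q : Memory T) (v : G.State) : Memory T := fun j => (T j).next (q j) v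

/-- The states of the transducers after reading `l`. -/
def memory (l : List G.State) : Memory T := fun j => l.foldl (T j).next (T j).init

theorem memory_append (l : List G.State) (v : G.State) :
    memory T (l ++ [v]) = nextMemory T (memory T l) v := by
  funext j
  simp [memory, nextMemory]

variable {T}

/-- A distribution on no actions could not have total mass one. This makes the maximum in `optVal`
meaningful. -/
theorem univ_action_nonempty (q : Memory T) (v : G.State) (i : G.Agent) :
    (Finset.univ : Finset (G.Action i)).Nonempty := by
  by_contra h
  rw [Finset.not_nonempty_iff_eq_empty] at h
  have := ((T i).outDist (q i) v).2.2
  rw [h] at this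
  simp at this

/-- The probability that agent `i` reaches its goal, with `t` steps left. If `e` holds, then the
agent plays optimally against the transducers of the others, otherwise it follows its own one. -/
noncomputable def optVal (i : G.Agent) (e : Prop) [Decidable e] : ℕ → G.State → Memory T → ℝ
  | 0, v, _ => if v ∈ G.goal i then 1 else 0
  | t + 1, v, q => if v ∈ G.goal i then 1 else
      Finset.univ.sup' (univ_action_nonempty q v i) fun a =>
        step v (if e then update (outWeights T q v) i (Pi.single a 1) else outWeights T q v)
          fun v' => optVal i e t v' (nextMemory T q v)

theorem weights_strategy (l : List G.State) (v : G.State) :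
    weights (fun i => (T i).strategy) l v = outWeights T (memory T l) v := by
  funext j
  simp [weights, outWeights, Transducer.strategy, memory]

theorem weights_nonneg (π : (i : G.Agent) → G.Strategy i) (l : List G.State) (v : G.State)
    (j : G.Agent) (a : G.Action j) : 0 ≤ weights π l v j a :=
  (π j _).2.1 a

theorem weights_update (π : (i : G.Agent) → G.Strategy i) (i : G.Agent) (σ : G.Strategy i)
    (l : List G.State) (v : G.State) : weights (update π i σ) l v =
      update (weights π l v) i (σ ⟨l ++ [v], by simp⟩).1 := by
  funext j
  by_cases h : j = i
  · subst h; simp [weights]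
  · simp [weights, h]

theorem hitProb_strategy (i : G.Agent) (t : ℕ) (l : List G.State) (v : G.State) :
    hitProb (kernel fun i => (T i).strategy) (G.goal i) t l v =
      optVal i False t v (memory T l) := by
  induction t generalizing l v with
  | zero => rfl
  | succ t ih =>
    rw [hitProb, optVal, sum_kernel_mul]
    have h : hitProb (kernel fun i => (T i).strategy) (G.goal i) t (l ++ [v]) =
        fun v' => optVal i False t v' (nextMemory T (memory T l) v) :=
      funext fun v' => by rw [ih, memory_append]
    -- Without deviation the term does not depend on the action, so the maximum is over a constant.
    simp only [if_false, Finset.sup'_const, weights_strategy, h]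

/-- Induction on the remaining steps. The history influences the other agents only through the
product state, and the mixed action of the deviator is an average of pure ones, hence no better than
their maximum. -/
theorem hitProb_update_le (i : G.Agent) (σ : G.Strategy i) (t : ℕ) (l : List G.State)
    (v : G.State) :
    hitProb (kernel (update (fun i => (T i).strategy) i σ)) (G.goal i) t l v ≤
      optVal i True t v (memory T l) := by
  induction t generalizing l v with
  | zero => exact le_rfl
  | succ t ih =>
    rw [hitProb, optVal, sum_kernel_mul]
    split_ifs with hv
    · exact le_rfl
    refine (step_mono (weights_nonneg _ l v) fun v' => ih (l ++ [v]) v').trans ?_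
    obtain ⟨x, hx⟩ : ∃ x, x = σ ⟨l ++ [v], by simp⟩ := ⟨_, rfl⟩
    rw [weights_update, ← hx, weights_strategy, memory_append, step_update _ _ _ _ x.2.2]
    generalize hM : Finset.sup' (α := ℝ) (β := G.Action i) _ _ _ = M
    have hle : ∀ a, step v (update (outWeights T (memory T l) v) i (Pi.single a 1))
        (fun v' => optVal i True t v' (nextMemory T (memory T l) v)) ≤ M := fun a =>
      hM ▸ Finset.le_sup'
        (fun a => step v (update (outWeights T (memory T l) v) i (Pi.single a 1))
          fun v' => optVal i True t v' (nextMemory T (memory T l) v)) (Finset.mem_univ a)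
    refine (Finset.sum_le_sum fun a _ => mul_le_mul_of_nonneg_left (hle a) (x.2.1 a)).trans ?_
    rw [← Finset.sum_mul, x.2.2, one_mul]

/-- A strategy sees only the history, but this determines the product state, and its length together
with `n` determines the number of remaining steps. -/
theorem exists_optimal (i : G.Agent) (n : ℕ) : ∃ σ : G.Strategy i, ∀ (t : ℕ) (l : List G.State)
    (v : G.State), l.length + t = n →
    hitProb (kernel (update (fun i => (T i).strategy) i σ)) (G.goal i) t l v =
      optVal i True t v (memory T l) := by
  have h : ∀ (t : ℕ) (v : G.State) (q : Memory T), ∃ a : G.Action i,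
      Finset.univ.sup' (univ_action_nonempty q v i) (fun a =>
        step v (update (outWeights T q v) i (Pi.single a 1))
          fun v' => optVal i True t v' (nextMemory T q v)) =
        step v (update (outWeights T q v) i (Pi.single a 1))
          fun v' => optVal i True t v' (nextMemory T q v) := fun t v q => by
    obtain ⟨a, _, ha⟩ := Finset.exists_mem_eq_sup' (univ_action_nonempty q v i) (fun a =>
        step v (update (outWeights T q v) i (Pi.single a 1))
          fun v' => optVal i True t v' (nextMemory T q v))
    exact ⟨a, ha⟩
  choose best hbest using h
  -- With `t + 1` steps left after the prefix `l`, the best action refers to the values with `t`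
  -- steps left, and `t = n - l.length - 1`.
  refine ⟨fun h => ⟨Pi.single (best (n - h.1.dropLast.length - 1) (h.1.getLast h.2)
    (memory T h.1.dropLast)) 1, single_mem_stdSimplex ℝ _⟩, fun t => ?_⟩
  induction t with
  | zero => intro l v _; rfl
  | succ t ih =>
    intro l v hl
    rw [hitProb, optVal, sum_kernel_mul]
    split_ifs with hv
    · rfl
    rw [hbest, weights_update, weights_strategy]
    have ht : n - l.length - 1 = t := by omega
    simp only [List.dropLast_concat, List.getLast_concat, ht]
    congr 1
    funext v'
    rw [ih (l ++ [v]) v' (by simp; omega), memory_append]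

theorem isNash_iff : (G.IsNash fun i => (T i).strategy) ↔ ∀ i,
    optVal i True (G.horizon - 1) G.init (memory T []) ≤
      optVal i False (G.horizon - 1) G.init (memory T []) := by
  refine forall_congr' fun i => ?_
  simp only [payoff_eq, hitProb_strategy]
  constructor
  · intro h
    obtain ⟨σ, hσ⟩ := exists_optimal (T := T) i (G.horizon - 1)
    rw [← hσ _ [] _ (by simp)]
    exact h σ
  · exact fun h σ => (hitProb_update_le i σ _ _ _).trans h

end ConcurrentGame

/-! ### Numbers of joint actions and of product states -/

theorem prod_range_eq_prod_ite {M : Type*} [CommMonoid M] {k n : ℕ} (h : k ≤ n) (f : ℕ → M) :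
    ∏ i ∈ Finset.range k, f i = ∏ i ∈ Finset.range n, if i < k then f i else 1 := by
  rw [Finset.prod_ite, Finset.prod_const_one, mul_one]
  congr 1
  ext i
  simp; omega

/-- Extraction of a digit in base `2 ^ b`: the fields above `j` contribute multiples of `2 ^ (b * (j
+ 1))`, and those below `j` sum to less than `2 ^ (b * j)`. -/
theorem fields_shiftRight_mod (b n j : ℕ) (f : ℕ → ℕ) (hj : j < n) :
    (∑ x ∈ Finset.range n, (f x % 2 ^ b) * 2 ^ (b * x)) >>> (b * j) % 2 ^ b = f j % 2 ^ b := by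
  induction n with
  | zero => omega
  | succ n ih =>
    rw [Finset.sum_range_succ, Nat.shiftRight_eq_div_pow]
    rcases (Nat.lt_succ_iff.mp hj).eq_or_lt with rfl | hj
    · rw [Nat.add_mul_div_right _ _ (by positivity), Nat.div_eq_of_lt (sum_fields_lt b j f),
        Nat.zero_add, Nat.mod_mod]
    · obtain ⟨d, rfl⟩ : ∃ d, n = j + 1 + d := ⟨n - (j + 1), by omega⟩
      rw [show f (j + 1 + d) % 2 ^ b * 2 ^ (b * (j + 1 + d)) =
        (2 ^ b * (f (j + 1 + d) % 2 ^ b * 2 ^ (b * d))) * 2 ^ (b * j) by ring,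
        Nat.add_mul_div_right _ _ (by positivity), Nat.add_mul_mod_self_left,
        ← Nat.shiftRight_eq_div_pow, ih hj]

namespace Word

variable {w : List Bool} {G : ConcurrentGame} {T : (i : G.Agent) → G.Transducer i}

theorem look_table {f : ℕ → ℕ} {x : ℕ} (hx : x < nX w) (hf : f x < 2 ^ bw w) :
    look w (table w f) x = f x := by
  rw [look, table_eq, fields_shiftRight_mod _ _ _ _ hx, Nat.mod_eq_of_lt hf]

theorem jointActionEquiv_apply_val (v : G.State)
    (m : Fin (∏ j, G.numActions ((G.playing v).orderIsoOfFin rfl j)))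
    (k : Fin (G.playing v).card) :
    (G.jointActionEquiv v m ((G.playing v).orderIsoOfFin rfl k) : ℕ) =
      m / (∏ l : Fin k, G.numActions ((G.playing v).orderIsoOfFin rfl (Fin.castLE k.2.le l))) %
        G.numActions ((G.playing v).orderIsoOfFin rfl k) := by
  have h := Equiv.piCongrLeft_apply_apply (fun i : {i // i ∈ G.playing v} => G.Action i)
    ((G.playing v).orderIsoOfFin rfl).toEquiv (finPiFinEquiv.symm m) k
  exact congrArg Fin.val h

/-- The place value of an active agent in the mixed radix enumeration involves only the earlier
active agents. The other agents of smaller index have radix one and may be included. -/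
theorem prod_castLE_eq (hG : GameData w G) (v : G.State) (k : Fin (G.playing v).card) :
    ∏ l : Fin k, G.numActions ((G.playing v).orderIsoOfFin rfl (Fin.castLE k.2.le l)) =
      ∏ i ∈ Finset.range ((G.playing v).orderIsoOfFin rfl k : G.Agent), radix w v i := by
  set e := (G.playing v).orderIsoOfFin rfl
  let F : ℕ → ℕ := fun l => if h : l < (G.playing v).card then G.numActions (e ⟨l, h⟩) else 1
  have h1 : ∀ l : Fin k, G.numActions (e (Fin.castLE k.2.le l)) = F l := fun l => by
    simp only [F]; rw [dif_pos (l.2.trans k.2)]; rfl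
  have h2 : ∀ l : Fin (G.playing v).card, (if (l : ℕ) < k then F l else 1) =
      if ((e l : G.Agent) : ℕ) < (e k : G.Agent) then G.numActions (e l) else 1 := fun l => by
    have : ((e l : G.Agent) : ℕ) < (e k : G.Agent) ↔ (l : ℕ) < k := by
      rw [Fin.val_fin_lt, Subtype.coe_lt_coe, e.lt_iff_lt, Fin.lt_def]
    simp only [this, F, dif_pos l.2]
  have h3 : ∀ i : G.Agent, radix w v i = if i ∈ G.playing v then G.numActions i else 1 := by
    intro i
    rw [radix, hG.play, hG.act, ifz]
    by_cases h : i ∈ G.playing v <;> simp [h]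
  rw [Finset.prod_congr rfl fun l _ => h1 l, Fin.prod_univ_eq_prod_range,
    prod_range_eq_prod_ite k.2.le, ← Fin.prod_univ_eq_prod_range,
    Finset.prod_congr rfl fun l _ => h2 l, prod_range_eq_prod_ite (e k : G.Agent).2.le,
    ← Fin.prod_univ_eq_prod_range]
  refine (Equiv.prod_comp e.toEquiv fun i =>
    if ((i : G.Agent) : ℕ) < (e k : G.Agent) then G.numActions i else 1).trans ?_
  rw [Finset.prod_coe_sort (G.playing v)
    fun i : G.Agent => if (i : ℕ) < (e k : G.Agent) then G.numActions i else 1]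
  refine (congrArg (fun S : Finset G.Agent => ∏ i ∈ S, if (i : ℕ) < (e k : G.Agent) then G.numActions i else 1)
    (Finset.univ_inter (G.playing v)).symm).trans ((Finset.prod_ite_mem _ _ _).symm.trans ?_)
  refine Finset.prod_congr rfl fun i _ => ?_
  rw [h3]
  split_ifs <;> rfl

theorem dig_eq (hG : GameData w G) (v : G.State)
    (m : Fin (∏ j, G.numActions ((G.playing v).orderIsoOfFin rfl j)))
    (j : {i // i ∈ G.playing v}) : dig w v m (j : G.Agent) = G.jointActionEquiv v m j := by
  obtain ⟨k, rfl⟩ := ((G.playing v).orderIsoOfFin rfl).surjective j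
  have hm : (m : ℕ) ≤ cap w :=
    (m.2.trans_eq (prod_orderIso_eq_nJoint hG.nA hG.act (hG.play v))).le.trans (nJoint_le _ _)
  rw [jointActionEquiv_apply_val, prod_castLE_eq hG, dig, clamp_of_le hm,
    clamp_of_le_length (x := ((G.playing v).orderIsoOfFin rfl k : G.Agent)),
    clamp_of_le ((Nat.div_le_self _ _).trans hm), hG.act]
  exact (Fin.is_lt _).le.trans (hG.nA ▸ nA_le w)

/-- The state of the transducer of agent `j`, as a natural number. -/
def memVal (q : Memory T) (j : ℕ) : ℕ := if h : j < G.numAgents then q ⟨j, h⟩ else 0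

/-- The number of a product state. -/
def codeX (w : List Bool) (v : G.State) (q : Memory T) : ℕ :=
  v + ∑ j ∈ Finset.range (nA w), memVal q j * 2 ^ clamp w (w.length * (j + 1))

theorem memVal_agent (q : Memory T) (j : G.Agent) : memVal q j = q j := dif_pos j.2

/-- Base `2 ^ w.length`: digit zero is the game state and digit `j + 1` the state of transducer `j`.
All of them are below the base, because their numbers are written in unary in `w`. -/
theorem codeX_eq_fields (hG : GameData w G) (hT : ∀ i : G.Agent, TransducerData w (posT w i) (T i))
    (v : G.State) (q : Memory T) : codeX w v q = ∑ x ∈ Finset.range (nA w + 1),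
      ((if x = 0 then (v : ℕ) else memVal q (x - 1)) % 2 ^ w.length) * 2 ^ (w.length * x) := by
  have h0 : ∀ {n : ℕ}, n ≤ w.length → n < 2 ^ w.length := fun h =>
    h.trans_lt Nat.lt_two_pow_self
  rw [Finset.sum_range_succ', codeX, Nat.add_comm]
  congr 1
  · refine Finset.sum_congr rfl fun j hj => ?_
    rw [Finset.mem_range] at hj
    rw [if_neg (Nat.succ_ne_zero j), Nat.add_sub_cancel, clamp_of_le, Nat.mod_eq_of_lt]
    · rw [hG.nA] at hj
      lift j to G.Agent using hj
      rw [memVal_agent]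
      exact h0 ((q j).2.le.trans ((hT j).tS ▸ tS_le w _))
    · exact (Nat.mul_le_mul (Nat.le_succ _) (Nat.succ_le_of_lt (hj.trans_le ((nA_le w).trans (Nat.le_succ _))))).trans
        (sq_le_cap w)
  · rw [if_pos rfl, Nat.mod_eq_of_lt (h0 (v.2.le.trans (hG.nS ▸ nS_le w)))]
    simp

theorem codeX_lt (hG : GameData w G) (hT : ∀ i : G.Agent, TransducerData w (posT w i) (T i))
    (v : G.State) (q : Memory T) : codeX w v q < nX w := by
  rw [codeX_eq_fields hG hT]
  exact sum_fields_lt _ _ _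

theorem vOf_codeX (hG : GameData w G) (hT : ∀ i : G.Agent, TransducerData w (posT w i) (T i))
    (v : G.State) (q : Memory T) : vOf w (codeX w v q) = v := by
  have h := fields_shiftRight_mod w.length (nA w + 1) 0
    (fun x => if x = 0 then (v : ℕ) else memVal q (x - 1)) (Nat.succ_pos _)
  rw [← codeX_eq_fields hG hT, Nat.mul_zero, Nat.shiftRight_zero, if_pos rfl] at h
  rw [vOf, h, Nat.mod_eq_of_lt]
  exact (v.2.le.trans (hG.nS ▸ nS_le w)).trans_lt Nat.lt_two_pow_self

theorem qOf_codeX (hG : GameData w G) (hT : ∀ i : G.Agent, TransducerData w (posT w i) (T i))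
    (v : G.State) (q : Memory T) (j : G.Agent) : qOf w (codeX w v q) j = q j := by
  have h := fields_shiftRight_mod w.length (nA w + 1) (j + 1)
    (fun x => if x = 0 then (v : ℕ) else memVal q (x - 1)) (Nat.succ_lt_succ (j.2.trans_eq hG.nA.symm))
  rw [← codeX_eq_fields hG hT, if_neg (Nat.succ_ne_zero _), Nat.add_sub_cancel,
    memVal_agent] at h
  rw [qOf, h, Nat.mod_eq_of_lt]
  exact ((q j).2.le.trans ((hT j).tS ▸ tS_le w _)).trans_lt Nat.lt_two_pow_self

theorem nextX_codeX (hG : GameData w G) (hT : ∀ i : G.Agent, TransducerData w (posT w i) (T i))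
    (v v' : G.State) (q : Memory T) :
    nextX w (codeX w v q) v' = codeX w v' (nextMemory T q v) := by
  rw [nextX, codeX.eq_1 w v']
  congr 1
  refine Finset.sum_congr rfl fun j hj => ?_
  rw [Finset.mem_range, hG.nA] at hj
  lift j to G.Agent using hj
  rw [vOf_codeX hG hT, qOf_codeX hG hT, (hT j).nx, memVal_agent, nextMemory]

theorem iniX_eq_codeX (hG : GameData w G) (hT : ∀ i : G.Agent, TransducerData w (posT w i) (T i)) :
    iniX w = codeX w G.init (memory T []) := by
  rw [iniX, codeX, hG.ini]
  congr 1
  refine Finset.sum_congr rfl fun j hj => ?_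
  rw [Finset.mem_range, hG.nA] at hj
  lift j to G.Agent using hj
  rw [(hT j).tI, memVal_agent]
  rfl

end Word

/-! ### Correctness of the decision function -/

namespace ConcurrentGame

variable {G : ConcurrentGame} {T : (i : G.Agent) → G.Transducer i}

/-- The weights of the actions when agent `i` plays `a` if `P` holds, and all agents follow their
transducers otherwise. -/
noncomputable def devWeights (i : G.Agent) (P : Prop) [Decidable P] (a : G.Action i) (q : Memory T)
    (v : G.State) : (j : G.Agent) → G.Action j → ℝ :=
  if P then update (outWeights T q v) i (Pi.single a 1) else outWeights T q v

theorem devWeights_mem (i : G.Agent) (P : Prop) [Decidable P] (a : G.Action i) (q : Memory T)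
    (v : G.State) (j : G.Agent) : devWeights i P a q v j ∈ stdSimplex ℝ (G.Action j) := by
  unfold devWeights
  split_ifs
  · by_cases h : j = i
    · subst h; rw [update_self]; exact single_mem_stdSimplex ℝ a
    · rw [update_of_ne h]; exact ((T j).outDist (q j) v).2
  · exact ((T j).outDist (q j) v).2

theorem step_one {v : G.State} {D : (j : G.Agent) → G.Action j → ℝ} (hD : ∀ j, ∑ a, D j a = 1) :
    step v D (fun _ => 1) = 1 := by
  simp only [step, mul_one, sum_transProb]
  exact sum_prod_weights hD

/-- This bounds the scaled values and thereby shows that they fit into the fields of the tables. -/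
theorem optVal_le_one (i : G.Agent) (P : Prop) [Decidable P] (t : ℕ) (v : G.State)
    (q : Memory T) : optVal i P t v q ≤ 1 := by
  induction t generalizing v q with
  | zero => rw [optVal]; split_ifs <;> norm_num
  | succ t ih =>
    rw [optVal]
    by_cases hv : v ∈ G.goal i
    · rw [if_pos hv]
    rw [if_neg hv]
    refine Finset.sup'_le _ _ fun a _ => ?_
    have hD := devWeights_mem i P a q v
    refine (step_mono (D := devWeights i P a q v) (fun j a => (hD j).1 a) fun v' => ih v' _).trans ?_
    rw [step_one fun j => (hD j).2]

end ConcurrentGame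

/-! ### The tables hold the scaled optimal values -/

namespace Word

variable {w : List Bool} {G : ConcurrentGame} {T : (i : G.Agent) → G.Transducer i}

/-- Inactive agents and the deviator contribute a factor `den w` too, so the scaling does not depend
on the product state. -/
theorem wt_codeX (hG : GameData w G) (hT : ∀ i : G.Agent, TransducerData w (posT w i) (T i))
    (i : G.Agent) (P : Prop) [Decidable P] (a : G.Action i) (v : G.State) (q : Memory T)
    (m : Fin (∏ j, G.numActions ((G.playing v).orderIsoOfFin rfl j))) :
    (wt w i (if P then 1 else 0) a (codeX w v q) m : ℝ) = (2 ^ (G.precision - 1)) ^ G.numAgents *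
      ∏ j : {i // i ∈ G.playing v}, devWeights i P a q v j (G.jointActionEquiv v m j) := by
  have h : ∀ j : G.Agent, ((ifz (play w (vOf w (codeX w v q)) j) (den w)
      (ifz ((if P then 1 else 0) * eqb j i)
        (ou w (posT w j) j (qOf w (codeX w v q) j) (vOf w (codeX w v q))
          (dig w (vOf w (codeX w v q)) m j))
        (den w * eqb (dig w (vOf w (codeX w v q)) m j) a)) : ℕ) : ℝ) = 2 ^ (G.precision - 1) *
      if h : j ∈ G.playing v then devWeights i P a q v j (G.jointActionEquiv v m ⟨j, h⟩)
        else 1 := by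
    intro j
    have hD : (den w : ℝ) = 2 ^ (G.precision - 1) := by rw [den, hG.prec]; push_cast; rfl
    have hpos : (2 : ℝ) ^ (G.precision - 1) ≠ 0 := by positivity
    rw [vOf_codeX hG hT, qOf_codeX hG hT, hG.play]
    by_cases hj : j ∈ G.playing v
    · rw [dif_pos hj, dig_eq hG v m ⟨j, hj⟩, (hT j).ou]
      have hout : (((T j).out (q j) v (G.jointActionEquiv v m ⟨j, hj⟩) : ℕ) : ℝ) =
          2 ^ (G.precision - 1) * outWeights T q v j (G.jointActionEquiv v m ⟨j, hj⟩) := by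
        simp only [outWeights, Transducer.outDist]
        field_simp
      by_cases hP : P
      · by_cases hji : j = i
        · subst hji
          simp [devWeights, hj, hP, ifz, eqb, hD, Pi.single_apply, Fin.ext_iff]
        · have : (j : ℕ) ≠ i := fun h => hji (Fin.ext h)
          simp [devWeights, hj, hP, ifz, eqb, hji, this]
          exact hout
      · simp [devWeights, hj, hP, ifz]
        exact hout
    · simp [hj, ifz, hD]
  rw [wt, hG.nA, ← Fin.prod_univ_eq_prod_range, Nat.cast_prod, Finset.prod_congr rfl fun j _ => h j,
    Finset.prod_mul_distrib, Finset.prod_const, Finset.card_univ, Fintype.card_fin,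
    Fintype.prod_dite, Finset.prod_const_one, mul_one]
  congr 1
  exact Finset.prod_congr (by ext; simp) fun _ _ => rfl

theorem expVal_codeX (hG : GameData w G) (hT : ∀ i : G.Agent, TransducerData w (posT w i) (T i))
    (i : G.Agent) (P : Prop) [Decidable P] (a : G.Action i) (v : G.State) (q : Memory T)
    {table : ℕ} {c : ℝ} {W : G.State → ℝ}
    (hW : ∀ v', (look w table (codeX w v' (nextMemory T q v)) : ℝ) = c * W v') :
    (expVal w i (if P then 1 else 0) table a (codeX w v q) : ℝ) =
      (2 ^ (G.precision - 1)) ^ (G.numAgents + 1) * c * step v (devWeights i P a q v) W := by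
  have h1 : ∀ m : Fin (∏ j, G.numActions ((G.playing v).orderIsoOfFin rfl j)),
      ((∑ v' ∈ Finset.range (nS w), tr w v m v' *
        look w table (nextX w (codeX w v q) v') : ℕ) : ℝ) = 2 ^ (G.precision - 1) * c *
        ∑ v', G.transProb v (G.jointActionEquiv v m) v' * W v' := by
    intro m
    rw [hG.nS, ← Fin.sum_univ_eq_sum_range
      (fun v' => tr w v m v' * look w table (nextX w (codeX w v q) v')), Nat.cast_sum,
      Finset.mul_sum]
    refine Finset.sum_congr rfl fun v' _ => ?_
    rw [hG.tr, nextX_codeX hG hT, Nat.cast_mul, hW, transProb]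
    field_simp
  rw [expVal, vOf_codeX hG hT, ← prod_orderIso_eq_nJoint hG.nA hG.act (hG.play v),
    ← Fin.sum_univ_eq_sum_range (fun m => wt w i (if P then 1 else 0) a (codeX w v q) m *
      ∑ v' ∈ Finset.range (nS w), tr w v m v' * look w table (nextX w (codeX w v q) v')),
    Nat.cast_sum, step, ← Equiv.sum_comp (G.jointActionEquiv v), Finset.mul_sum]
  refine Finset.sum_congr rfl fun m _ => ?_
  rw [Nat.cast_mul, h1, wt_codeX hG hT]
  ring

/-- Backward induction in exact integer arithmetic. Each step multiplies the scale by one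
denominator per agent and one for the transition, which is also the growth of the entry at goal
states. -/
theorem look_tab_codeX (hG : GameData w G)
    (hT : ∀ i : G.Agent, TransducerData w (posT w i) (T i)) (i : G.Agent) (P : Prop) [Decidable P]
    {t : ℕ} (ht : t < G.horizon) (v : G.State) (q : Memory T) :
    (look w (tab w i (if P then 1 else 0) t) (codeX w v q) : ℝ) =
      ((2 ^ (G.precision - 1)) ^ (G.numAgents + 1)) ^ t * optVal i P t v q := by
  -- Storing loses nothing: the scaled value is at most its scale, whose exponent is below `bw w`
  -- while `t` is below the horizon.
  have key : ∀ {f : ℕ → ℕ} {t : ℕ} (_ : t < G.horizon) (v : G.State) (q : Memory T),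
      (f (codeX w v q) : ℝ) = ((2 ^ (G.precision - 1)) ^ (G.numAgents + 1)) ^ t * optVal i P t v q →
      (look w (table w f) (codeX w v q) : ℝ) =
        ((2 ^ (G.precision - 1)) ^ (G.numAgents + 1)) ^ t * optVal i P t v q := by
    intro f t ht v q h
    rw [look_table (codeX_lt hG hT v q), h]
    have h1 : (f (codeX w v q) : ℝ) ≤ ((2 ^ (G.precision - 1)) ^ (G.numAgents + 1)) ^ t := by
      rw [h]
      exact mul_le_of_le_one_right (by positivity) (optVal_le_one i P t v q)
    have h2 : f (codeX w v q) ≤ ((2 ^ (G.precision - 1)) ^ (G.numAgents + 1)) ^ t := by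
      exact_mod_cast h1
    refine h2.trans_lt ?_
    rw [← pow_mul, ← pow_mul, bw, hG.prec, hG.nA, hG.hor]
    refine Nat.pow_lt_pow_right (by omega) (Nat.lt_succ_of_le ?_)
    exact (Nat.mul_le_mul (Nat.sub_le _ _) (Nat.mul_le_mul_left _ ht.le)).trans_eq
      (Nat.mul_assoc _ _ _).symm
  induction t generalizing v q with
  | zero =>
    refine key ht v q ?_
    rw [vOf_codeX hG hT, hG.isGoal, optVal]
    by_cases hv : v ∈ G.goal i <;> simp [hv]
  | succ t ih =>
    refine key ht v q ?_
    have hcap : t ≤ cap w := by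
      have := hor_lt w
      rw [hG.hor] at this
      omega
    have hexp := fun a => expVal_codeX hG hT i P a v q
      (fun v' => ih (Nat.lt_of_succ_lt ht) v' (nextMemory T q v))
    rw [stepVal, vOf_codeX hG hT, hG.isGoal, optVal, clamp_of_le hcap, hG.prec, hG.nA, hG.act]
    by_cases hv : v ∈ G.goal i
    · simp only [hv, decide_true, Bool.toNat_true, ifz, one_ne_zero, if_false, if_true, mul_one]
      push_cast
      ring
    · simp only [hv, decide_false, Bool.toNat_false, ifz, if_true, if_false]
      have hpos : (0 : ℝ) < (2 ^ (G.precision - 1)) ^ (G.numAgents + 1) *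
        ((2 ^ (G.precision - 1)) ^ (G.numAgents + 1)) ^ t := by positivity
      rw [pow_succ' _ t]
      -- The maximum of the integers is compared with that of the reals through a maximiser on each
      -- side.
      apply le_antisymm
      · obtain ⟨a, ha, h⟩ := Finset.exists_mem_eq_sup (Finset.range (G.numActions i))
          (by
            obtain ⟨a, _⟩ := univ_action_nonempty q v i
            exact ⟨a, Finset.mem_range.mpr a.2⟩)
          (fun a => expVal w i (if P then 1 else 0) (tab w i (if P then 1 else 0) t) a
            (codeX w v q))
        rw [Finset.mem_range] at ha
        lift a to G.Action i using ha
        refine (congrArg Nat.cast h).le.trans ?_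
        rw [hexp a]
        refine mul_le_mul_of_nonneg_left ?_ hpos.le
        exact Finset.le_sup' (fun a => step v (devWeights i P a q v)
          fun v' => optVal i P t v' (nextMemory T q v)) (Finset.mem_univ a)
      · obtain ⟨a, _, h⟩ := Finset.exists_mem_eq_sup' (univ_action_nonempty q v i) (fun a =>
          step v (devWeights i P a q v) fun v' => optVal i P t v' (nextMemory T q v))
        refine (congrArg (_ * ·) h).le.trans ?_
        rw [← hexp a]
        exact_mod_cast Finset.le_sup (f := fun a => expVal w i (if P then 1 else 0)
          (tab w i (if P then 1 else 0) t) a (codeX w v q)) (Finset.mem_range.mpr a.2)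

theorem value_eq (hG : GameData w G) (hT : ∀ i : G.Agent, TransducerData w (posT w i) (T i))
    (i : G.Agent) (P : Prop) [Decidable P] : (value w i (if P then 1 else 0) : ℝ) =
      ((2 ^ (G.precision - 1)) ^ (G.numAgents + 1)) ^ (G.horizon - 1) *
        optVal i P (G.horizon - 1) G.init (memory T []) := by
  rw [value, iniX_eq_codeX hG hT, hG.hor]
  exact look_tab_codeX hG hT i P (Nat.sub_lt G.one_le_horizon one_pos) _ _

/-- Both values of an agent carry the same positive scale, so comparing the integers is comparing
the payoffs. On words that encode nothing, `bad` alone decides. -/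
theorem decision_ne_zero_iff (w : List Bool) : decision w ≠ 0 ↔ w ∈ nashVerification := by
  have h : decision w ≠ 0 ↔ bad w = 0 ∧ ∀ i < nA w, value w i 1 ≤ value w i 0 := by
    rw [decision]
    rw [show ∀ n, 1 - n ≠ 0 ↔ n = 0 by omega, Nat.add_eq_zero_iff, Finset.sum_eq_zero_iff]
    simp only [Finset.mem_range, ltb_eq_zero]
  have hnash : ∀ (G : ConcurrentGame) (T : (i : G.Agent) → G.Transducer i),
      G.encodeInstance T = w →
        ((∀ i < nA w, value w i 1 ≤ value w i 0) ↔ G.IsNash fun i => (T i).strategy) := by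
    intro G T hw
    obtain ⟨⟨hG, hT⟩, -⟩ := (encodeInstance_eq_iff w G T).mp hw
    rw [isNash_iff, hG.nA]
    have hi : ∀ i : G.Agent, value w i 1 ≤ value w i 0 ↔
        optVal i True (G.horizon - 1) G.init (memory T []) ≤
          optVal i False (G.horizon - 1) G.init (memory T []) := by
      intro i
      have h1 := value_eq hG hT i True
      have h0 := value_eq hG hT i False
      rw [if_pos trivial] at h1
      rw [if_neg not_false] at h0
      rw [← Nat.cast_le (α := ℝ), h1, h0]
      exact mul_le_mul_iff_right₀ (by positivity)
    exact ⟨fun h i => (hi i).mp (h i i.2), fun h i hi' => (hi ⟨i, hi'⟩).mpr (h ⟨i, hi'⟩)⟩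
  rw [h]
  constructor
  · rintro ⟨hb, hv⟩
    obtain ⟨G, T, hw⟩ := exists_encodeInstance_eq hb
    exact ⟨G, T, hw, (hnash G T hw).mp hv⟩
  · rintro ⟨G, T, hw, hN⟩
    exact ⟨bad_eq_zero_of_encodeInstance_eq hw, (hnash G T hw).mpr hN⟩

end Word

/-- The Nash-equilibrium verification problem for bounded probabilistic concurrent games and
profiles of transducers is in EXPTIME. -/
theorem theorem4p1 : InEXPTIME ConcurrentGame.nashVerification :=
  inEXPTIME_of_pt PT.decision Word.decision_ne_zero_iff
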